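/- **Proposition 4.1.** Let $K'=\mathbb{C}(v,q)$. For $n\ge 1$ let $\ddot H_n$ be the double affine Hecke algebra of $GL(n)$: the $K'$-algebra with generators $T_i^{\pm1}$ ($1\le i\le n-1$), $X_j^{\pm1}$, $Y_j^{\pm1}$ ($1\le j\le n$) and relations $$(T_i+v^{-1})(T_i-v)=0,\quad T_iT_{i+1}T_i=T_{i+1}T_iT_{i+1},\quad T_iT_k=T_kT_i\ (|i-k|>1),$$ $$X_jX_k=X_kX_j,\quad Y_jY_k=Y_kY_j,\quad T_iX_iT_i=X_{i+1},\quad T_i^{-1}Y_iT_i^{-1}=Y_{i+1},$$ $$T_iX_k=X_kT_i,\quad T_iY_k=Y_kT_i\ (k\ne i,i+1),\quad Y_1X_1\cdots X_n=qX_1\cdots X_nY_1,\quad X_1^{-1}Y_2=Y_2X_1^{-1}T_1^{-2}.$$ Put $S=\frac{1}{[n]^+!}\sum_{w\in\mathfrak S_n}v^{l(w)}T_w$, where $[i]^+=\frac{v^{2i}-1}{v^2-1}$ and $[n]^+!=[2]^+\cdots[n]^+$; it is idempotent. Let $\mathbf S\ddot H_n=S\ddot H_nS$, an algebra with unit $S$.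 Let $\rho_1,\rho_2$ be the automorphisms of $\ddot H_n$ that fix every $T_i$ and satisfy $$\rho_1:\ X_i\mapsto X_iY_i(T_{i-1}\cdots T_1)(T_1\cdots T_{i-1}),\quad Y_i\mapsto Y_i,$$ $$\rho_2:\ X_i\mapsto X_i,\quad Y_i\mapsto Y_iX_i(T_{i-1}^{-1}\cdots T_1^{-1})(T_1^{-1}\cdots T_{i-1}^{-1}),$$ to which we attach the matrices $A_1=\begin{pmatrix}1&0\\1&1\end{pmatrix}$, $A_2=\begin{pmatrix}1&1\\0&1\end{pmatrix}$. For a word $g$ in $\rho_1^{\pm1},\rho_2^{\pm1}$ let $\rho(g)$ be the composite automorphism and $\bar g\in SL(2,\mathbb Z)$ the corresponding product of matrices. For $\mathbf x\in\mathbb Z^2\setminus\{(0,0)\}$ put $$P^n_{\mathbf x}=\rho(g)\Big(S\sum_{i=1}^nY_i^e\,S\Big)\in\mathbf S\ddot H_n,\qquad \mathbf x=\bar g\,(0,e),\ e>0 ;$$ this does not depend on the choice of $g$. Let $\mathbf S\ddot H_n^{+}$ (resp. $\mathbf S\ddot H_n^{++}$) be the unital $K'$-subalgebra of $\mathbf S\ddot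 H_n$ generated by the $P^n_{\mathbf x}$ with $\mathbf x\ne(0,0)$ in $\mathbb Z^{2,+}=\{(r,d)\in\mathbb Z^2: r\ge1,\text{ or } r=0\text{ and }d\ge0\}$ (resp. in $\mathbb Z^{2,++}=\{(r,d)\in\mathbb Z^2: r\ge0,\ d\ge0\}$). Then for every $m\ge2$ the assignment $P^m_{\mathbf x}\mapsto P^{m-1}_{\mathbf x}$, for nonzero $\mathbf x\in\mathbb Z^{2,+}$, extends to a unique $K'$-algebra morphism $\Phi_m:\mathbf S\ddot H^+_m\to\mathbf S\ddot H^+_{m-1}$, and $\Phi_m$ is surjective. Likewise, the assignment $P^m_{\mathbf x}\mapsto P^{m-1}_{\mathbf x}$, for nonzero $\mathbf x\in\mathbb Z^{2,++}$, extends to a unique $K'$-algebra morphism $\mathbf S\ddot H^{++}_m\to\mathbf S\ddot H^{++}_{m-1}$, and it is surjective. -/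

import Mathlib

/-! # Spherical double affine Hecke algebras of type `GL(n)`

The first part consists of identities in groups that are needed to see that the automorphisms
`ρ₁` and `ρ₂` below are well defined. -/

namespace Daha

section GroupPart
variable {G : Type*} [Group G]

/-- The sequence `a`, `T_1 a T_1`, `T_2 T_1 a T_1 T_2`, …, from which `X_1`, `X_2`, … is obtained for
`a = X_1` (and `Y_1`, `Y_2`, … for `a = Y_1` and the inverses of the `T_i`). -/
def affX (T : ℕ → G) (a : G) : ℕ → G
  | 0 => a
  | k + 1 => T k * affX T a k * T k

/-- The element `α` with `X_{k+2}⁻¹ Y_1 X_{k+2} = α Y_1` (auxiliary). -/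
def al (T : ℕ → G) : ℕ → G
  | 0 => (T 0)⁻¹ * (T 0)⁻¹
  | k + 1 => (T (k + 1))⁻¹ * al T k * T (k + 1)

/-- The product of the first `k` of these elements (auxiliary). -/
def bigA (T : ℕ → G) : ℕ → G
  | 0 => 1
  | k + 1 => bigA T k * al T k

/-- The braid relations (auxiliary). -/
structure IsBraid (n : ℕ) (T : ℕ → G) : Prop where
  braid : ∀ i, i + 2 < n → T i * T (i + 1) * T i = T (i + 1) * T i * T (i + 1)
  comm : ∀ i j, i + 1 < j → j + 1 < n → Commute (T i) (T j)

theorem IsBraid.inv {n : ℕ} {T : ℕ → G} (h : IsBraid n T) : IsBraid n (fun i => (T i)⁻¹) where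
  braid i hi := by
    have := congrArg (·⁻¹) (h.braid i hi)
    simpa [mul_assoc] using this
  comm i j hij hj := (h.comm i j hij hj).inv_inv

theorem affX_commT {n : ℕ} {T : ℕ → G} (h : IsBraid n T) {a : G}
    (ha : ∀ i, 1 ≤ i → i + 1 < n → Commute (T i) a) (i k : ℕ) (hi : i + 1 < n) (hk : k < n)
    (h1 : k ≠ i) (h2 : k ≠ i + 1) : Commute (T i) (affX T a k) := by
  induction k with
  | zero => exact ha i (by omega) hi
  | succ k ih =>
    by_cases hki : k = i + 1
    · subst hki
      have hb := h.braid i (by omega)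
      have hc : Commute (T (i + 1)) (affX T a i) := by
        clear ih
        have : ∀ k, k ≤ i → Commute (T (i + 1)) (affX T a k) := by
          intro k
          induction k with
          | zero => intro _; exact ha _ (by omega) (by omega)
          | succ k ih =>
            intro hk
            have c := (h.comm k (i + 1) (by omega) (by omega)).symm
            exact (c.mul_right (ih (by omega))).mul_right c
        exact this i le_rfl
      simp only [affX]
      show _ = _
      calc T i * (T (i+1) * (T i * affX T a i * T i) * T (i+1))
          = (T i * T (i+1) * T i) * affX T a i * T i * T (i+1) := by group
        _ = T (i+1) * T i * (T (i+1) * affX T a i) * T i * T (i+1) := by rw [hb]; group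
        _ = T (i+1) * T i * affX T a i * (T (i+1) * T i * T (i+1)) := by rw [hc.eq]; group
        _ = _ := by rw [← hb]; group
    · have c : Commute (T i) (T k) := by
        rcases lt_or_gt_of_ne (show i ≠ k by omega) with hlt | hgt
        · exact h.comm i k (by omega) (by omega)
        · exact (h.comm k i (by omega) (by omega)).symm
      exact (c.mul_right (ih (by omega) (by omega) (by omega))).mul_right c

theorem affX_comm {n : ℕ} {T : ℕ → G} (h : IsBraid n T) {a : G}
    (ha : ∀ i, 1 ≤ i → i + 1 < n → Commute (T i) a)
    (h4 : 1 < n → a * T 0 * a * T 0 = T 0 * a * T 0 * a) (i j : ℕ) (hi : i < n) (hj : j < n) :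
    Commute (affX T a i) (affX T a j) := by
  have h0 : ∀ k, 1 ≤ k → k < n → Commute a (affX T a k) := by
    intro k hk
    induction k, hk using Nat.le_induction with
    | base => intro hn; have := h4 hn; show _ = _; simp only [affX]; simpa [mul_assoc] using this
    | succ k hk ih =>
      intro hn
      have c := (ha k hk hn).symm
      exact (c.mul_right (ih (by omega))).mul_right c
  have key : ∀ i j, i < j → j < n → Commute (affX T a i) (affX T a j) := by
    intro i
    induction i with
    | zero => intro j h1 h2; exact h0 j h1 h2
    | succ i ih =>
      intro j h1 h2
      have c := affX_commT h ha i j (by omega) h2 (by omega) (by omega)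
      exact (c.mul_left (ih j (by omega) h2)).mul_left c
  rcases lt_trichotomy i j with hl | rfl | hl
  · exact key i j hl hj
  · exact Commute.refl _
  · exact (key j i hl hi).symm

/-- Relations between `T`, `X_1 = a`, `Y_1 = b` equivalent to the full list of relations. -/
structure Core (n : ℕ) (z : G) (T : ℕ → G) (a b : G) : Prop where
  br : IsBraid n T
  z_comm : ∀ g, Commute z g
  Ta : ∀ i, 1 ≤ i → i + 1 < n → Commute (T i) a
  Tb : ∀ i, 1 ≤ i → i + 1 < n → Commute (T i) b
  a4 : 1 < n → a * T 0 * a * T 0 = T 0 * a * T 0 * a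
  b4 : 1 < n → b * (T 0)⁻¹ * b * (T 0)⁻¹ = (T 0)⁻¹ * b * (T 0)⁻¹ * b
  ab : 1 < n → a⁻¹ * ((T 0)⁻¹ * b * (T 0)⁻¹) =
    ((T 0)⁻¹ * b * (T 0)⁻¹) * a⁻¹ * ((T 0)⁻¹ * (T 0)⁻¹)
  A : 0 < n → bigA T (n - 1) * b * a = z * (a * b)

/-- `X_2⁻¹ Y_1 X_2 = T_1⁻² Y_1` -/
theorem ab_iff (a b t : G) :
    a⁻¹ * (t⁻¹ * b * t⁻¹) = (t⁻¹ * b * t⁻¹) * a⁻¹ * (t⁻¹ * t⁻¹) ↔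
    b * (t * a * t) = (t * a * t) * (t⁻¹ * t⁻¹ * b) := by
  constructor
  · intro h
    have : b * t⁻¹ * a⁻¹ * t⁻¹ = t * a⁻¹ * t⁻¹ * b := by
      calc b * t⁻¹ * a⁻¹ * t⁻¹ = t * (t⁻¹ * b * t⁻¹ * a⁻¹ * (t⁻¹ * t⁻¹)) * t := by group
        _ = _ := by rw [← h]; group
    -- a t b t^-1 = b ..
    have h2 : t * a * t⁻¹ * b = b * t * a * t := by
      calc t * a * t⁻¹ * b = t * a * t⁻¹ * (b * t⁻¹ * a⁻¹ * t⁻¹) * t * a * t := by group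
        _ = _ := by rw [this]; group
    calc b * (t * a * t) = b * t * a * t := by group
      _ = _ := by rw [← h2]; group
  · intro h
    have h2 : t * a * t⁻¹ * b = b * t * a * t := by
      calc t * a * t⁻¹ * b = (t * a * t) * (t⁻¹ * t⁻¹ * b) := by group
        _ = _ := by rw [← h]; group
    have : b * t⁻¹ * a⁻¹ * t⁻¹ = t * a⁻¹ * t⁻¹ * b := by
      calc b * t⁻¹ * a⁻¹ * t⁻¹ = t * a⁻¹ * t⁻¹ * (t * a * t⁻¹ * b) * t⁻¹ * a⁻¹ * t⁻¹ := by group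
        _ = _ := by rw [h2]; group
    calc a⁻¹ * (t⁻¹ * b * t⁻¹) = t⁻¹ * (t * a⁻¹ * t⁻¹ * b) * t⁻¹ := by group
      _ = _ := by rw [← this]; group

/-- partial product `X_2 ⋯ X_{k+1}` -/
def tailProd (X : ℕ → G) : ℕ → G
  | 0 => 1
  | k + 1 => tailProd X k * X (k + 1)

theorem range_prod_eq (X : ℕ → G) (k : ℕ) :
    ((List.range (k + 1)).map X).prod = X 0 * tailProd X k := by
  induction k with
  | zero => simp [tailProd]
  | succ k ih => rw [List.range_succ, List.map_append, List.prod_append, ih]; simp [tailProd, mul_assoc]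

theorem rel4_iff {n : ℕ} {z : G} {T : ℕ → G} {a b : G} (br : IsBraid n T)
    (z_comm : ∀ g, Commute z g)
    (Ta : ∀ i, 1 ≤ i → i + 1 < n → Commute (T i) a)
    (Tb : ∀ i, 1 ≤ i → i + 1 < n → Commute (T i) b)
    (a4 : 1 < n → a * T 0 * a * T 0 = T 0 * a * T 0 * a)
    (ab : 1 < n → a⁻¹ * ((T 0)⁻¹ * b * (T 0)⁻¹) =
      ((T 0)⁻¹ * b * (T 0)⁻¹) * a⁻¹ * ((T 0)⁻¹ * (T 0)⁻¹)) (hn : 0 < n) :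
    bigA T (n - 1) * b * a = z * (a * b) ↔
      b * ((List.range n).map (affX T a)).prod = z * (((List.range n).map (affX T a)).prod * b) := by
  have hal : ∀ k, k + 1 < n → b * affX T a (k + 1) = affX T a (k + 1) * (al T k * b) := by
    intro k
    induction k with
    | zero =>
      intro h
      exact (ab_iff a b (T 0)).1 (ab h)
    | succ k ih =>
      intro h
      have ih := ih (by omega)
      have c := Tb (k + 1) (by omega) h
      rw [affX]
      generalize affX T a (k + 1) = x at *
      rw [al]
      calc b * (T (k+1) * x * T (k+1)) = (b * T (k+1)) * x * T (k+1) := by group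
        _ = T (k+1) * (b * x) * T (k+1) := by rw [← c.eq]; group
        _ = T (k+1) * x * al T k * (b * T (k+1)) := by rw [ih]; group
        _ = _ := by rw [← c.eq]; group
  have hcal : ∀ k j, k + 1 < j → j < n → Commute (al T k) (affX T a j) := by
    intro k
    induction k with
    | zero =>
      intro j h1 h2
      have c := (affX_commT br Ta 0 j (by omega) h2 (by omega) (by omega)).inv_left
      exact c.mul_left c
    | succ k ih =>
      intro j h1 h2
      have c := affX_commT br Ta (k + 1) j (by omega) h2 (by omega) (by omega)
      exact (c.inv_left.mul_left (ih j (by omega) h2)).mul_left c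
  have hcA : ∀ k j, k < j → j < n → Commute (bigA T k) (affX T a j) := by
    intro k
    induction k with
    | zero => intro j _ _; exact Commute.one_left _
    | succ k ih =>
      intro j h1 h2
      exact (ih j (by omega) h2).mul_left (hcal k j h1 h2)
  have hQ : ∀ k, k < n → b * tailProd (affX T a) k = tailProd (affX T a) k * (bigA T k * b) := by
    intro k
    induction k with
    | zero => intro _; simp [tailProd, bigA]
    | succ k ih =>
      intro h
      have ih := ih (by omega)
      have c := hcA k (k + 1) (by omega) h
      have e := hal k h
      rw [tailProd, bigA]
      generalize affX T a (k + 1) = x at *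
      generalize tailProd (affX T a) k = Q at *
      calc b * (Q * x) = (b * Q) * x := by group
        _ = Q * bigA T k * (b * x) := by rw [ih]; group
        _ = Q * (bigA T k * x) * al T k * b := by rw [e]; group
        _ = _ := by rw [c.eq]; group
  obtain ⟨k, rfl⟩ : ∃ k, n = k + 1 := ⟨n - 1, by omega⟩
  rw [range_prod_eq]
  have hX0 : Commute a (tailProd (affX T a) k) := by
    have : ∀ j, j < k + 1 → Commute a (tailProd (affX T a) j) := by
      intro j
      induction j with
      | zero => intro _; exact Commute.one_right _
      | succ j ih =>
        intro h
        exact (ih (by omega)).mul_right (affX_comm br Ta a4 0 (j + 1) (by omega) h)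
    exact this k (by omega)
  have e := hQ k (by omega)
  simp only [Nat.add_sub_cancel]
  change _ ↔ b * (a * _) = z * (a * _ * b)
  generalize tailProd (affX T a) k = Q at *
  rw [hX0.eq]
  have h1 : b * (Q * a) = Q * (bigA T k * b * a) := by rw [← mul_assoc, e]; group
  have h2 : z * (Q * a * b) = Q * (z * (a * b)) := by
    rw [← mul_assoc z, ← mul_assoc z, (z_comm Q).eq]; group
  rw [h1, h2]
  exact mul_right_inj Q |>.symm

theorem Core.rho1 {n : ℕ} {z : G} {T : ℕ → G} {a b : G} (h : Core n z T a b) :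
    Core n z T (a * b) b := by
  refine ⟨h.br, h.z_comm, fun i h1 h2 => (h.Ta i h1 h2).mul_right (h.Tb i h1 h2), h.Tb, ?_, h.b4,
    ?_, ?_⟩
  · intro hn
    have ha := h.a4 hn
    have hb := h.b4 hn
    have hx := (ab_iff a b (T 0)).1 (h.ab hn)
    generalize T 0 = t at *
    have hV : t * (a * t * a * t) = (a * t * a * t) * t := by
      calc t * (a * t * a * t) = (t * a * t * a) * t := by group
        _ = _ := by rw [← ha]
    have hW : t * (b * t⁻¹ * b * t⁻¹) = (b * t⁻¹ * b * t⁻¹) * t := by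
      calc t * (b * t⁻¹ * b * t⁻¹) = t * (t⁻¹ * b * t⁻¹ * b) := by rw [hb]
        _ = _ := by group
    have e : a * b * t * (a * b) * t = (a * t * a * t) * (b * t⁻¹ * b * t⁻¹) := by
      calc a * b * t * (a * b) * t = a * (b * (t * a * t)) * t⁻¹ * b * t := by group
        _ = (a * t * a * t) * t⁻¹ * t⁻¹ * ((b * t⁻¹ * b * t⁻¹) * t) * t := by rw [hx]; group
        _ = (a * t * a * t) * t⁻¹ * t⁻¹ * (t * (b * t⁻¹ * b * t⁻¹)) * t := by rw [hW]
        _ = (a * t * a * t) * t⁻¹ * ((b * t⁻¹ * b * t⁻¹) * t) := by group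
        _ = (a * t * a * t) * t⁻¹ * (t * (b * t⁻¹ * b * t⁻¹)) := by rw [hW]
        _ = _ := by group
    calc a * b * t * (a * b) * t
        = (a * t * a * t) * ((b * t⁻¹ * b * t⁻¹) * t) * t⁻¹ := by rw [e]; group
      _ = ((a * t * a * t) * t) * (b * t⁻¹ * b * t⁻¹) * t⁻¹ := by rw [← hW]; group
      _ = t * (a * t * a * t) * (b * t⁻¹ * b * t⁻¹) * t⁻¹ := by rw [← hV]
      _ = t * (a * b * t * (a * b) * t) * t⁻¹ := by rw [e]; group
      _ = _ := by group
  · intro hn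
    have hb := h.b4 hn
    have hx := h.ab hn
    generalize T 0 = t at *
    calc (a * b)⁻¹ * (t⁻¹ * b * t⁻¹) = b⁻¹ * (a⁻¹ * (t⁻¹ * b * t⁻¹)) := by group
      _ = b⁻¹ * (t⁻¹ * b * t⁻¹ * b) * b⁻¹ * a⁻¹ * (t⁻¹ * t⁻¹) := by rw [hx]; group
      _ = _ := by rw [← hb]; group
  · intro hn
    calc bigA T (n - 1) * b * (a * b) = (bigA T (n - 1) * b * a) * b := by group
      _ = _ := by rw [h.A hn]; group

theorem Core.rho1' {n : ℕ} {z : G} {T : ℕ → G} {a b : G} (h : Core n z T a b) :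
    Core n z T (a * b⁻¹) b := by
  refine ⟨h.br, h.z_comm, fun i h1 h2 => (h.Ta i h1 h2).mul_right (h.Tb i h1 h2).inv_right,
    h.Tb, ?_, h.b4, ?_, ?_⟩
  · intro hn
    have ha := h.a4 hn
    have hb := h.b4 hn
    have hx := (ab_iff a b (T 0)).1 (h.ab hn)
    generalize T 0 = t at *
    have hb' : b⁻¹ * t * b⁻¹ * t = t * b⁻¹ * t * b⁻¹ := by
      have := congrArg (·⁻¹) hb
      simpa [mul_assoc] using this.symm
    have hx' : b⁻¹ * (t * a * t) = t * a * t * b⁻¹ * t * t := by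
      calc b⁻¹ * (t * a * t) = b⁻¹ * (t * a * t * (t⁻¹ * t⁻¹ * b)) * b⁻¹ * t * t := by group
        _ = _ := by rw [← hx]; group
    have e : a * b⁻¹ * t * (a * b⁻¹) * t = (a * t * a * t) * (b⁻¹ * t * b⁻¹ * t) := by
      calc a * b⁻¹ * t * (a * b⁻¹) * t = a * (b⁻¹ * (t * a * t)) * t⁻¹ * b⁻¹ * t := by group
        _ = _ := by rw [hx']; group
    have e2 : t * ((a * t * a * t) * (b⁻¹ * t * b⁻¹ * t)) * t⁻¹
        = (a * t * a * t) * (b⁻¹ * t * b⁻¹ * t) := by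
      calc t * ((a * t * a * t) * (b⁻¹ * t * b⁻¹ * t)) * t⁻¹
          = (t * a * t * a) * (t * b⁻¹ * t * b⁻¹) := by group
        _ = _ := by rw [ha, hb']
    calc a * b⁻¹ * t * (a * b⁻¹) * t = t * ((a * t * a * t) * (b⁻¹ * t * b⁻¹ * t)) * t⁻¹ := by
          rw [e2, e]
      _ = _ := by rw [← e]; group
  · intro hn
    have hb := h.b4 hn
    have hx := h.ab hn
    generalize T 0 = t at *
    calc (a * b⁻¹)⁻¹ * (t⁻¹ * b * t⁻¹) = b * (a⁻¹ * (t⁻¹ * b * t⁻¹)) := by group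
      _ = (b * t⁻¹ * b * t⁻¹) * a⁻¹ * (t⁻¹ * t⁻¹) := by rw [hx]; group
      _ = _ := by rw [hb]; group
  · intro hn
    calc bigA T (n - 1) * b * (a * b⁻¹) = (bigA T (n - 1) * b * a) * b⁻¹ := by group
      _ = _ := by rw [h.A hn]; group

/-- the two relations of rank two for `b a`, from those for `a`, `b` -/
theorem Core.rho2 {n : ℕ} {z : G} {T : ℕ → G} {a b : G} (h : Core n z T a b) :
    Core n z T a (b * a) := by
  have hab : 1 < n → a⁻¹ * ((T 0)⁻¹ * (b * a) * (T 0)⁻¹) =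
      ((T 0)⁻¹ * (b * a) * (T 0)⁻¹) * a⁻¹ * ((T 0)⁻¹ * (T 0)⁻¹) := by
    intro hn
    have ha := h.a4 hn
    have hx := h.ab hn
    generalize T 0 = t at *
    have e : a⁻¹ * t⁻¹ * a * t = t * a * t⁻¹ * a⁻¹ := by
      calc a⁻¹ * t⁻¹ * a * t = a⁻¹ * t⁻¹ * (a * t * a * t) * t⁻¹ * a⁻¹ := by group
        _ = _ := by rw [ha]; group
    calc a⁻¹ * (t⁻¹ * (b * a) * t⁻¹) = (a⁻¹ * (t⁻¹ * b * t⁻¹)) * t * a * t⁻¹ := by group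
      _ = t⁻¹ * b * t⁻¹ * (a⁻¹ * t⁻¹ * a * t) * t⁻¹ * t⁻¹ := by rw [hx]; group
      _ = _ := by rw [e]; group
  refine ⟨h.br, h.z_comm, h.Ta, fun i h1 h2 => (h.Tb i h1 h2).mul_right (h.Ta i h1 h2), h.a4, ?_,
    hab, ?_⟩
  · intro hn
    have ha := h.a4 hn
    have hb := h.b4 hn
    have hx := (h.ab hn)
    generalize T 0 = t at *
    have hx2 : a * (t⁻¹ * b * t⁻¹) = (t⁻¹ * b * t⁻¹) * t * t * a := by
      calc a * (t⁻¹ * b * t⁻¹) = a * (t⁻¹ * b * t⁻¹ * a⁻¹ * (t⁻¹ * t⁻¹)) * t * t * a := by group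
        _ = _ := by rw [← hx]; group
    have hV : t * (a * t * a * t) = (a * t * a * t) * t := by
      calc t * (a * t * a * t) = (t * a * t * a) * t := by group
        _ = _ := by rw [← ha]
    have hW : t * (b * t⁻¹ * b * t⁻¹) = (b * t⁻¹ * b * t⁻¹) * t := by
      calc t * (b * t⁻¹ * b * t⁻¹) = t * (t⁻¹ * b * t⁻¹ * b) := by rw [hb]
        _ = _ := by group
    have e : b * a * t⁻¹ * (b * a) * t⁻¹ = (b * t⁻¹ * b * t⁻¹) * (a * t * a * t) := by
      calc b * a * t⁻¹ * (b * a) * t⁻¹ = b * (a * (t⁻¹ * b * t⁻¹)) * t * a * t⁻¹ := by group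
        _ = (b * t⁻¹ * b * t⁻¹) * t * (t * a * t * a) * t⁻¹ := by rw [hx2]; group
        _ = (b * t⁻¹ * b * t⁻¹) * (t * (a * t * a * t)) * t⁻¹ := by rw [← ha]; group
        _ = _ := by rw [hV]; group
    calc b * a * t⁻¹ * (b * a) * t⁻¹
        = t⁻¹ * (t * (b * t⁻¹ * b * t⁻¹)) * (a * t * a * t) := by rw [e]; group
      _ = t⁻¹ * (b * t⁻¹ * b * t⁻¹) * (t * (a * t * a * t)) := by rw [hW]; group
      _ = t⁻¹ * ((b * t⁻¹ * b * t⁻¹) * (a * t * a * t)) * t := by rw [hV]; group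
      _ = _ := by rw [← e]; group
  · intro hn
    calc bigA T (n - 1) * (b * a) * a = (bigA T (n - 1) * b * a) * a := by group
      _ = _ := by rw [h.A hn]; group

theorem Core.rho2' {n : ℕ} {z : G} {T : ℕ → G} {a b : G} (h : Core n z T a b) :
    Core n z T a (b * a⁻¹) := by
  refine ⟨h.br, h.z_comm, h.Ta, fun i h1 h2 => (h.Tb i h1 h2).mul_right (h.Ta i h1 h2).inv_right,
    h.a4, ?_, ?_, ?_⟩
  · intro hn
    have ha := h.a4 hn
    have hb := h.b4 hn
    have hx := (h.ab hn)
    generalize T 0 = t at *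
    have hV : t⁻¹ * (a⁻¹ * t⁻¹ * a⁻¹ * t⁻¹) = (a⁻¹ * t⁻¹ * a⁻¹ * t⁻¹) * t⁻¹ := by
      calc t⁻¹ * (a⁻¹ * t⁻¹ * a⁻¹ * t⁻¹) = (a * t * a * t)⁻¹ * t⁻¹ := by group
        _ = _ := by rw [ha]; group
    have hW : t * (b * t⁻¹ * b * t⁻¹) = (b * t⁻¹ * b * t⁻¹) * t := by
      calc t * (b * t⁻¹ * b * t⁻¹) = t * (t⁻¹ * b * t⁻¹ * b) := by rw [hb]
        _ = _ := by group
    have e : b * a⁻¹ * t⁻¹ * (b * a⁻¹) * t⁻¹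
        = (b * t⁻¹ * b * t⁻¹) * (a⁻¹ * t⁻¹ * a⁻¹ * t⁻¹) := by
      calc b * a⁻¹ * t⁻¹ * (b * a⁻¹) * t⁻¹ = b * (a⁻¹ * (t⁻¹ * b * t⁻¹)) * t * a⁻¹ * t⁻¹ := by group
        _ = _ := by rw [hx]; group
    calc b * a⁻¹ * t⁻¹ * (b * a⁻¹) * t⁻¹
        = t⁻¹ * (t * (b * t⁻¹ * b * t⁻¹)) * (a⁻¹ * t⁻¹ * a⁻¹ * t⁻¹) := by rw [e]; group
      _ = t⁻¹ * (b * t⁻¹ * b * t⁻¹) * t * ((a⁻¹ * t⁻¹ * a⁻¹ * t⁻¹) * t⁻¹) * t := by rw [hW]; group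
      _ = t⁻¹ * ((b * t⁻¹ * b * t⁻¹) * (a⁻¹ * t⁻¹ * a⁻¹ * t⁻¹)) * t := by rw [← hV]; group
      _ = _ := by rw [← e]; group
  · intro hn
    have ha := h.a4 hn
    have hx := h.ab hn
    generalize T 0 = t at *
    have e : a⁻¹ * t⁻¹ * a⁻¹ * t⁻¹ = t⁻¹ * a⁻¹ * t⁻¹ * a⁻¹ := by
      calc a⁻¹ * t⁻¹ * a⁻¹ * t⁻¹ = (t * a * t * a)⁻¹ := by group
        _ = _ := by rw [← ha]; group
    calc a⁻¹ * (t⁻¹ * (b * a⁻¹) * t⁻¹) = (a⁻¹ * (t⁻¹ * b * t⁻¹)) * t * a⁻¹ * t⁻¹ := by group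
      _ = t⁻¹ * b * (t⁻¹ * a⁻¹ * t⁻¹ * a⁻¹) * t⁻¹ := by rw [hx]; group
      _ = _ := by rw [← e]; group
  · intro hn
    calc bigA T (n - 1) * (b * a⁻¹) * a = (bigA T (n - 1) * b * a) * a⁻¹ := by group
      _ = _ := by rw [h.A hn]; group
end GroupPart

/-! ### The base field -/

/-- The field `K' = ℂ(v, q)` of rational functions in two variables. -/
abbrev K : Type := FractionRing (MvPolynomial (Fin 2) ℂ)

/-- The parameter `v`. -/
noncomputable def v : K := algebraMap (MvPolynomial (Fin 2) ℂ) K (MvPolynomial.X 0)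

/-- The parameter `q`. -/
noncomputable def q : K := algebraMap (MvPolynomial (Fin 2) ℂ) K (MvPolynomial.X 1)

theorem v_ne_zero : v ≠ 0 := by
  have h := IsFractionRing.injective (MvPolynomial (Fin 2) ℂ) K
  rw [v, ne_eq, map_eq_zero_iff _ h]
  exact MvPolynomial.X_ne_zero 0

theorem q_ne_zero : q ≠ 0 := by
  have h := IsFractionRing.injective (MvPolynomial (Fin 2) ℂ) K
  rw [q, ne_eq, map_eq_zero_iff _ h]
  exact MvPolynomial.X_ne_zero 1

/-! ### The double affine Hecke algebra -/

/-- The generators `T_i^{±1}` (`1 ≤ i ≤ n - 1`), `X_j^{±1}` and `Y_j^{±1}` (`1 ≤ j ≤ n`).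
Indices are shifted by one: `Fin (n - 1)` and `Fin n` start at `0`. -/
inductive Gen (n : ℕ) : Type
  | T (i : Fin (n - 1))
  | Tinv (i : Fin (n - 1))
  | X (j : Fin n)
  | Xinv (j : Fin n)
  | Y (j : Fin n)
  | Yinv (j : Fin n)

/-- A generator, in the free algebra. -/
noncomputable abbrev gen {n : ℕ} (g : Gen n) : FreeAlgebra K (Gen n) := FreeAlgebra.ι K g

/-- A scalar, in the free algebra. -/
noncomputable abbrev scal (n : ℕ) (c : K) : FreeAlgebra K (Gen n) :=
  algebraMap K (FreeAlgebra K (Gen n)) c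

open Gen in
/-- The defining relations of the double affine Hecke algebra of type `GL(n)`. -/
inductive Rel (n : ℕ) : FreeAlgebra K (Gen n) → FreeAlgebra K (Gen n) → Prop
  | T_inv (i : Fin (n - 1)) : Rel n (gen (T i) * gen (Tinv i)) 1
  | inv_T (i : Fin (n - 1)) : Rel n (gen (Tinv i) * gen (T i)) 1
  | X_inv (j : Fin n) : Rel n (gen (X j) * gen (Xinv j)) 1
  | inv_X (j : Fin n) : Rel n (gen (Xinv j) * gen (X j)) 1
  | Y_inv (j : Fin n) : Rel n (gen (Y j) * gen (Yinv j)) 1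
  | inv_Y (j : Fin n) : Rel n (gen (Yinv j) * gen (Y j)) 1
  /-- `(T_i + v⁻¹)(T_i - v) = 0` -/
  | quad (i : Fin (n - 1)) : Rel n ((gen (T i) + scal n v⁻¹) * (gen (T i) - scal n v)) 0
  /-- `T_i T_{i+1} T_i = T_{i+1} T_i T_{i+1}` -/
  | braid (i j : Fin (n - 1)) (h : j.val = i.val + 1) :
      Rel n (gen (T i) * gen (T j) * gen (T i)) (gen (T j) * gen (T i) * gen (T j))
  /-- `T_i T_k = T_k T_i` if `|i - k| > 1` -/
  | TT (i k : Fin (n - 1)) (h : i.val + 1 < k.val) :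
      Rel n (gen (T i) * gen (T k)) (gen (T k) * gen (T i))
  | XX (j k : Fin n) : Rel n (gen (X j) * gen (X k)) (gen (X k) * gen (X j))
  | YY (j k : Fin n) : Rel n (gen (Y j) * gen (Y k)) (gen (Y k) * gen (Y j))
  /-- `T_i X_i T_i = X_{i+1}` -/
  | TX (i : Fin (n - 1)) (j k : Fin n) (hj : j.val = i.val) (hk : k.val = i.val + 1) :
      Rel n (gen (T i) * gen (X j) * gen (T i)) (gen (X k))
  /-- `T_i⁻¹ Y_i T_i⁻¹ = Y_{i+1}` -/
  | TY (i : Fin (n - 1)) (j k : Fin n) (hj : j.val = i.val) (hk : k.val = i.val + 1) :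
      Rel n (gen (Tinv i) * gen (Y j) * gen (Tinv i)) (gen (Y k))
  /-- `T_i X_k = X_k T_i` if `k ≠ i, i + 1` -/
  | TX_comm (i : Fin (n - 1)) (k : Fin n) (h1 : k.val ≠ i.val) (h2 : k.val ≠ i.val + 1) :
      Rel n (gen (T i) * gen (X k)) (gen (X k) * gen (T i))
  /-- `T_i Y_k = Y_k T_i` if `k ≠ i, i + 1` -/
  | TY_comm (i : Fin (n - 1)) (k : Fin n) (h1 : k.val ≠ i.val) (h2 : k.val ≠ i.val + 1) :
      Rel n (gen (T i) * gen (Y k)) (gen (Y k) * gen (T i))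
  /-- `Y_1 X_1 ⋯ X_n = q X_1 ⋯ X_n Y_1` -/
  | YX (j : Fin n) (hj : j.val = 0) :
      Rel n (gen (Y j) * (List.ofFn fun k => gen (X k)).prod)
        (scal n q * ((List.ofFn fun k => gen (X k)).prod * gen (Y j)))
  /-- `X_1⁻¹ Y_2 = Y_2 X_1⁻¹ T_1⁻²` -/
  | XY (i : Fin (n - 1)) (j k : Fin n) (hi : i.val = 0) (hj : j.val = 0) (hk : k.val = 1) :
      Rel n (gen (Xinv j) * gen (Y k)) (gen (Y k) * gen (Xinv j) * (gen (Tinv i) * gen (Tinv i)))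

/-- The double affine Hecke algebra of type `GL(n)` over `K' = ℂ(v, q)`. -/
def H (n : ℕ) : Type := RingQuot (Rel n)

noncomputable instance (n : ℕ) : Ring (H n) := inferInstanceAs (Ring (RingQuot (Rel n)))

noncomputable instance (n : ℕ) : Algebra K (H n) :=
  inferInstanceAs (Algebra K (RingQuot (Rel n)))

/-- The quotient map from the free algebra. -/
noncomputable def mk (n : ℕ) : FreeAlgebra K (Gen n) →ₐ[K] H n := RingQuot.mkAlgHom K (Rel n)

theorem mk_rel {n : ℕ} {a b : FreeAlgebra K (Gen n)} (h : Rel n a b) : mk n a = mk n b :=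
  RingQuot.mkAlgHom_rel K h

theorem mk_mul_one {n : ℕ} {a b : FreeAlgebra K (Gen n)} (h : Rel n (a * b) 1) :
    mk n a * mk n b = 1 := by
  rw [← map_mul, mk_rel h, map_one]

/-- The invertible element `T_i`. -/
noncomputable def T {n : ℕ} (i : Fin (n - 1)) : (H n)ˣ :=
  ⟨mk n (gen (Gen.T i)), mk n (gen (Gen.Tinv i)), mk_mul_one (Rel.T_inv i), mk_mul_one (Rel.inv_T i)⟩

/-- The invertible element `X_j`. -/
noncomputable def X {n : ℕ} (j : Fin n) : (H n)ˣ :=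
  ⟨mk n (gen (Gen.X j)), mk n (gen (Gen.Xinv j)), mk_mul_one (Rel.X_inv j), mk_mul_one (Rel.inv_X j)⟩

/-- The invertible element `Y_j`. -/
noncomputable def Y {n : ℕ} (j : Fin n) : (H n)ˣ :=
  ⟨mk n (gen (Gen.Y j)), mk n (gen (Gen.Yinv j)), mk_mul_one (Rel.Y_inv j), mk_mul_one (Rel.inv_Y j)⟩

/-! ### The universal property -/

/-- A finite family, extended by `1`. -/
def ext {G : Type*} [One G] {m : ℕ} (f : Fin m → G) (i : ℕ) : G := if h : i < m then f ⟨i, h⟩ else 1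

theorem ext_of_lt {G : Type*} [One G] {m : ℕ} (f : Fin m → G) {i : ℕ} (h : i < m) :
    ext f i = f ⟨i, h⟩ := dif_pos h

@[simp] theorem ext_val {G : Type*} [One G] {m : ℕ} (f : Fin m → G) (i : Fin m) :
    ext f i.val = f i := dif_pos i.2

theorem ofFn_eq_range {G : Type*} [One G] {m : ℕ} (f : Fin m → G) :
    List.ofFn f = (List.range m).map (ext f) := by
  apply List.ext_getElem
  · simp
  · intro i h1 h2
    simp at h1
    simp [ext_of_lt f h1]

/-- The relations of the double affine Hecke algebra, for elements of a group; `z` is the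
scalar `q`. -/
structure FinRel {G : Type*} [Group G] (n : ℕ) (z : G) (T : Fin (n - 1) → G) (X Y : Fin n → G) :
    Prop where
  braid : ∀ i j : Fin (n - 1), j.val = i.val + 1 → T i * T j * T i = T j * T i * T j
  TT : ∀ i k : Fin (n - 1), i.val + 1 < k.val → T i * T k = T k * T i
  XX : ∀ j k, X j * X k = X k * X j
  YY : ∀ j k, Y j * Y k = Y k * Y j
  TX : ∀ (i : Fin (n - 1)) (j k : Fin n), j.val = i.val → k.val = i.val + 1 → T i * X j * T i = X k
  TY : ∀ (i : Fin (n - 1)) (j k : Fin n), j.val = i.val → k.val = i.val + 1 →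
    (T i)⁻¹ * Y j * (T i)⁻¹ = Y k
  TX_comm : ∀ (i : Fin (n - 1)) (k : Fin n), k.val ≠ i.val → k.val ≠ i.val + 1 →
    T i * X k = X k * T i
  TY_comm : ∀ (i : Fin (n - 1)) (k : Fin n), k.val ≠ i.val → k.val ≠ i.val + 1 →
    T i * Y k = Y k * T i
  YX : ∀ j : Fin n, j.val = 0 → Y j * (List.ofFn X).prod = z * ((List.ofFn X).prod * Y j)
  XY : ∀ (i : Fin (n - 1)) (j k : Fin n), i.val = 0 → j.val = 0 → k.val = 1 →
    (X j)⁻¹ * Y k = Y k * (X j)⁻¹ * ((T i)⁻¹ * (T i)⁻¹)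

section Lift
variable {A : Type*} [Ring A] [Algebra K A]

/-- A nonzero scalar, as a unit of an algebra. -/
noncomputable def scalUnit (A : Type*) [Ring A] [Algebra K A] : Aˣ :=
  Units.map (algebraMap K A : K →* A) (Units.mk0 q q_ne_zero)

theorem scalUnit_comm (g : Aˣ) : Commute (scalUnit A) g := by
  apply Units.ext
  exact Algebra.commutes q (g : A)

/-- Images of the generators. -/
def genImage {n : ℕ} (t : Fin (n - 1) → Aˣ) (x y : Fin n → Aˣ) : Gen n → A
  | .T i => t i
  | .Tinv i => ↑(t i)⁻¹
  | .X j => x j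
  | .Xinv j => ↑(x j)⁻¹
  | .Y j => y j
  | .Yinv j => ↑(y j)⁻¹

theorem coe_ofFn_prod {A : Type*} [Ring A] {n : ℕ} (x : Fin n → Aˣ) :
    (((List.ofFn x).prod : Aˣ) : A) = (List.ofFn fun k => (x k : A)).prod := by
  rw [← Units.coeHom_apply, map_list_prod, List.map_ofFn]; rfl

/-- The algebra morphism from the double affine Hecke algebra given by invertible elements
that satisfy its relations. -/
noncomputable def lift {n : ℕ} (t : Fin (n - 1) → Aˣ) (x y : Fin n → Aˣ)
    (hq : ∀ i, ((t i : A) + algebraMap K A v⁻¹) * ((t i : A) - algebraMap K A v) = 0)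
    (h : FinRel n (scalUnit A) t x y) : H n →ₐ[K] A :=
  RingQuot.liftAlgHom K ⟨FreeAlgebra.lift K (genImage t x y), by
    intro a b hab
    have cv : ∀ {g g' : Aˣ}, g = g' → (g : A) = g' := fun e => congrArg _ e
    cases hab with
    | T_inv i => simp [genImage]
    | inv_T i => simp [genImage]
    | X_inv i => simp [genImage]
    | inv_X i => simp [genImage]
    | Y_inv i => simp [genImage]
    | inv_Y i => simp [genImage]
    | quad i => simpa [genImage] using hq i
    | braid i j e => simpa [genImage] using cv (h.braid i j e)
    | TT i j e => simpa [genImage] using cv (h.TT i j e)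
    | XX i j => simpa [genImage] using cv (h.XX i j)
    | YY i j => simpa [genImage] using cv (h.YY i j)
    | TX i j k e1 e2 => simpa [genImage] using cv (h.TX i j k e1 e2)
    | TY i j k e1 e2 => simpa [genImage] using cv (h.TY i j k e1 e2)
    | TX_comm i k e1 e2 => simpa [genImage] using cv (h.TX_comm i k e1 e2)
    | TY_comm i k e1 e2 => simpa [genImage] using cv (h.TY_comm i k e1 e2)
    | YX j e =>
      have := cv (h.YX j e)
      simp only [Units.val_mul, coe_ofFn_prod] at this
      simp only [map_mul, map_list_prod, List.map_ofFn, AlgHom.commutes, FreeAlgebra.lift_ι_apply]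
      simpa [genImage, Function.comp_def, scalUnit] using this
    | XY i j k e1 e2 e3 => simpa [genImage, mul_assoc] using cv (h.XY i j k e1 e2 e3)⟩

variable {n : ℕ} (t : Fin (n - 1) → Aˣ) (x y : Fin n → Aˣ)
    (hq : ∀ i, ((t i : A) + algebraMap K A v⁻¹) * ((t i : A) - algebraMap K A v) = 0)
    (h : FinRel n (scalUnit A) t x y)

theorem lift_mk (g : Gen n) : lift t x y hq h (mk n (gen g)) = genImage t x y g := by
  unfold lift mk
  erw [RingQuot.liftAlgHom_mkAlgHom_apply]
  simp

theorem lift_T (i : Fin (n - 1)) : lift t x y hq h (T i) = t i := lift_mk t x y hq h (.T i)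
theorem lift_X (j : Fin n) : lift t x y hq h (X j) = x j := lift_mk t x y hq h (.X j)
theorem lift_Y (j : Fin n) : lift t x y hq h (Y j) = y j := lift_mk t x y hq h (.Y j)

theorem hom_ext {f g : H n →ₐ[K] A} (hT : ∀ i : Fin (n - 1), f (T i) = g (T i))
    (hX : ∀ j : Fin n, f (X j) = g (X j)) (hY : ∀ j : Fin n, f (Y j) = g (Y j)) : f = g := by
  have hu : ∀ u : (H n)ˣ, f u = g u → f ↑u⁻¹ = g ↑u⁻¹ := by
    intro u e
    have : Units.map (f : H n →* A) u = Units.map (g : H n →* A) u := Units.ext e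
    have := congrArg (fun w : Aˣ => ((w⁻¹ : Aˣ) : A)) this
    exact this
  refine RingQuot.ringQuot_ext' K f g (FreeAlgebra.hom_ext (funext fun s => ?_))
  cases s with
  | T i => exact hT i
  | Tinv i => exact hu _ (hT i)
  | X i => exact hX i
  | Xinv i => exact hu _ (hX i)
  | Y i => exact hY i
  | Yinv i => exact hu _ (hY i)

end Lift

theorem quad_H {n : ℕ} (i : Fin (n - 1)) :
    ((T i : H n) + algebraMap K (H n) v⁻¹) * ((T i : H n) - algebraMap K (H n) v) = 0 := by
  have := mk_rel (Rel.quad i)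
  simp only [map_mul, map_add, map_sub, AlgHom.commutes, map_zero] at this
  exact this

theorem finRel_H (n : ℕ) : FinRel n (scalUnit (H n)) T X Y where
  braid i j e := by have := mk_rel (Rel.braid i j e); apply Units.ext; simp only [map_mul] at this; exact this
  TT i j e := by have := mk_rel (Rel.TT i j e); apply Units.ext; simp only [map_mul] at this; exact this
  XX i j := by have := mk_rel (Rel.XX i j); apply Units.ext; simp only [map_mul] at this; exact this
  YY i j := by have := mk_rel (Rel.YY i j); apply Units.ext; simp only [map_mul] at this; exact this
  TX i j k e e' := by
    have := mk_rel (Rel.TX i j k e e'); apply Units.ext; simp only [map_mul] at this; exact this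
  TY i j k e e' := by
    have := mk_rel (Rel.TY i j k e e'); apply Units.ext; simp only [map_mul] at this; exact this
  TX_comm i k e e' := by
    have := mk_rel (Rel.TX_comm i k e e'); apply Units.ext; simp only [map_mul] at this; exact this
  TY_comm i k e e' := by
    have := mk_rel (Rel.TY_comm i k e e'); apply Units.ext; simp only [map_mul] at this; exact this
  YX j e := by
    have := mk_rel (Rel.YX j e)
    apply Units.ext
    simp only [Units.val_mul, coe_ofFn_prod]
    simp only [map_mul, map_list_prod, List.map_ofFn, AlgHom.commutes] at this
    exact this
  XY i j k e e' e'' := by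
    have := mk_rel (Rel.XY i j k e e' e''); apply Units.ext; simp only [map_mul] at this; exact this

/-! ### Passing between the relations and their short form -/

section Pass
variable {G : Type*} [Group G] {n : ℕ} {z : G} {t : Fin (n - 1) → G}

theorem FinRel.X_eq {x y : Fin n → G} (h : FinRel n z t x y) (j : Fin n) :
    x j = affX (ext t) (ext x 0) j := by
  obtain ⟨j, hj⟩ := j
  induction j with
  | zero => simp [affX, ext_of_lt x hj]
  | succ j ih =>
    have := h.TX ⟨j, by omega⟩ ⟨j, by omega⟩ ⟨j + 1, hj⟩ rfl rfl
    rw [← this, ih (by omega)]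
    simp only [affX]
    rw [ext_of_lt t (show j < n - 1 by omega)]

theorem FinRel.Y_eq {x y : Fin n → G} (h : FinRel n z t x y) (j : Fin n) :
    y j = affX (fun i => (ext t i)⁻¹) (ext y 0) j := by
  obtain ⟨j, hj⟩ := j
  induction j with
  | zero => simp [affX, ext_of_lt y hj]
  | succ j ih =>
    have := h.TY ⟨j, by omega⟩ ⟨j, by omega⟩ ⟨j + 1, hj⟩ rfl rfl
    rw [← this, ih (by omega)]
    simp only [affX]
    rw [ext_of_lt t (show j < n - 1 by omega)]

theorem map_range_congr {x : Fin n → G} {f : ℕ → G} (h : ∀ j : Fin n, x j = f j) :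
    List.ofFn x = (List.range n).map f := by
  rw [ofFn_eq_range]
  apply List.map_congr_left
  intro i hi
  rw [ext_of_lt x (List.mem_range.1 hi), h]

theorem FinRel.core {x y : Fin n → G} (hz : ∀ g, Commute z g) (h : FinRel n z t x y) :
    Core n z (ext t) (ext x 0) (ext y 0) := by
  have hTa : ∀ i, 1 ≤ i → i + 1 < n → Commute (ext t i) (ext x 0) := by
    intro i h1 h2
    rw [ext_of_lt t (show i < n - 1 by omega), ext_of_lt x (show 0 < n by omega)]
    exact h.TX_comm _ _ (by simp; omega) (by simp)
  have hTb : ∀ i, 1 ≤ i → i + 1 < n → Commute (ext t i) (ext y 0) := by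
    intro i h1 h2
    rw [ext_of_lt t (show i < n - 1 by omega), ext_of_lt y (show 0 < n by omega)]
    exact h.TY_comm _ _ (by simp; omega) (by simp)
  have hbr : IsBraid n (ext t) := by
    constructor
    · intro i hi
      rw [ext_of_lt t (show i < n - 1 by omega), ext_of_lt t (show i + 1 < n - 1 by omega)]
      exact h.braid _ _ rfl
    · intro i j hi hj
      rw [ext_of_lt t (show i < n - 1 by omega), ext_of_lt t (show j < n - 1 by omega)]
      exact h.TT _ _ hi
  have ha4 : 1 < n → ext x 0 * ext t 0 * ext x 0 * ext t 0 = ext t 0 * ext x 0 * ext t 0 * ext x 0 := by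
    intro hn
    have e := h.XX ⟨0, by omega⟩ ⟨1, by omega⟩
    rw [h.X_eq ⟨0, _⟩, h.X_eq ⟨1, _⟩] at e
    simpa only [affX, mul_assoc] using e
  have hab : 1 < n → (ext x 0)⁻¹ * ((ext t 0)⁻¹ * ext y 0 * (ext t 0)⁻¹) =
      ((ext t 0)⁻¹ * ext y 0 * (ext t 0)⁻¹) * (ext x 0)⁻¹ * ((ext t 0)⁻¹ * (ext t 0)⁻¹) := by
    intro hn
    have e := h.XY ⟨0, by omega⟩ ⟨0, by omega⟩ ⟨1, by omega⟩ rfl rfl rfl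
    rw [h.X_eq ⟨0, _⟩, h.Y_eq ⟨1, _⟩] at e
    rw [← ext_of_lt t] at e
    simpa only [affX] using e
  refine ⟨hbr, hz, hTa, hTb, ha4, ?_, hab, ?_⟩
  · intro hn
    have e := h.YY ⟨0, by omega⟩ ⟨1, by omega⟩
    rw [h.Y_eq ⟨0, _⟩, h.Y_eq ⟨1, _⟩] at e
    simpa only [affX, mul_assoc] using e
  · intro hn
    rw [rel4_iff hbr hz hTa hTb ha4 hab hn]
    have e := h.YX ⟨0, hn⟩ rfl
    rw [map_range_congr (f := affX (ext t) (ext x 0)) h.X_eq] at e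
    rw [ext_of_lt y hn]
    exact e

theorem Core.finRel {a b : G} (h : Core n z (ext t) a b) :
    FinRel n z t (fun j => affX (ext t) a j) (fun j => affX (fun i => (ext t i)⁻¹) b j) := by
  have hTb' : ∀ i, 1 ≤ i → i + 1 < n → Commute (ext t i)⁻¹ b :=
    fun i h1 h2 => (h.Tb i h1 h2).inv_left
  constructor
  · intro i j e
    have := h.br.braid i.val (by omega)
    rwa [← e, ext_val, ext_val] at this
  · intro i k e
    have := h.br.comm i.val k.val e (by omega)
    rwa [ext_val, ext_val] at this
  · intro j k
    exact affX_comm h.br h.Ta h.a4 j k j.2 k.2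
  · intro j k
    exact affX_comm h.br.inv hTb' h.b4 j k j.2 k.2
  · intro i j k e1 e2
    simp only [e1, e2, affX, ext_val]
  · intro i j k e1 e2
    simp only [e1, e2, affX, ext_val]
  · intro i k e1 e2
    have := affX_commT h.br h.Ta i.val k.val (by omega) k.2 e1 e2
    rwa [ext_val] at this
  · intro i k e1 e2
    have := (affX_commT h.br.inv hTb' i.val k.val (by omega) k.2 e1 e2).inv_left
    rwa [inv_inv, ext_val] at this
  · intro j e
    have hn : 0 < n := by omega
    have := (rel4_iff h.br h.z_comm h.Ta h.Tb h.a4 h.ab hn).1 (h.A hn)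
    rw [map_range_congr (f := affX (ext t) a) (fun _ => rfl)]
    simpa only [e, affX] using this
  · intro i j k e1 e2 e3
    have := h.ab (by omega)
    have hi : ext t 0 = t i := by rw [← e1, ext_val]
    simp only [e2, e3, affX, hi]
    rw [hi] at this
    exact this

end Pass

theorem core_H (n : ℕ) : Core n (scalUnit (H n)) (ext T) (ext X 0) (ext Y 0) :=
  (finRel_H n).core scalUnit_comm

/-! ### The automorphisms `ρ₁`, `ρ₂` -/

/-- `(t_{i-1} ⋯ t_1)(t_1 ⋯ t_{i-1})` for the index `i` (in `1`-based notation); with indices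
starting at `0`, this is `(t (i-1) ⋯ t 0)(t 0 ⋯ t (i-1))`. -/
def loop {G : Type*} [Monoid G] (t : ℕ → G) (i : ℕ) : G :=
  ((List.range i).reverse.map t).prod * ((List.range i).map t).prod

theorem loop_succ {G : Type*} [Monoid G] (t : ℕ → G) (i : ℕ) :
    loop t (i + 1) = t i * loop t i * t i := by
  simp [loop, List.range_succ, mul_assoc]

theorem affX_mul {G : Type*} [Group G] (t : ℕ → G) (a b : G) (i : ℕ) :
    affX t (a * b) i = affX t a i * affX (fun i => (t i)⁻¹) b i * loop t i := by
  induction i with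
  | zero => simp [affX, loop]
  | succ i ih => rw [loop_succ]; simp only [affX]; rw [ih]; group

/-- The endomorphism `ρ₁`: `T_i ↦ T_i`, `X_i ↦ X_i Y_i (T_{i-1} ⋯ T_1)(T_1 ⋯ T_{i-1})`,
`Y_i ↦ Y_i`. -/
noncomputable def rho1Hom (n : ℕ) : H n →ₐ[K] H n :=
  lift T (fun i => X i * Y i * loop (ext T) i) Y quad_H (by
    convert (core_H n).rho1.finRel using 1
    · funext i; rw [affX_mul, ← (finRel_H n).X_eq, ← (finRel_H n).Y_eq]
    · funext i; exact (finRel_H n).Y_eq i)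

/-- The endomorphism `ρ₂`: `T_i ↦ T_i`, `X_i ↦ X_i`,
`Y_i ↦ Y_i X_i (T_{i-1}⁻¹ ⋯ T_1⁻¹)(T_1⁻¹ ⋯ T_{i-1}⁻¹)`. -/
noncomputable def rho2Hom (n : ℕ) : H n →ₐ[K] H n :=
  lift T X (fun i => Y i * X i * loop (fun k => (ext T k)⁻¹) i) quad_H (by
    convert (core_H n).rho2.finRel using 1
    · funext i; exact (finRel_H n).X_eq i
    · funext i
      rw [affX_mul]
      simp only [inv_inv]
      rw [← (finRel_H n).Y_eq, (finRel_H n).X_eq])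

/-- The inverse of `ρ₁`. -/
noncomputable def rho1Inv (n : ℕ) : H n →ₐ[K] H n :=
  lift T (fun i => affX (ext T) (ext X 0 * (ext Y 0)⁻¹) i) Y quad_H (by
    convert (core_H n).rho1'.finRel using 1
    funext i; exact (finRel_H n).Y_eq i)

/-- The inverse of `ρ₂`. -/
noncomputable def rho2Inv (n : ℕ) : H n →ₐ[K] H n :=
  lift T X (fun i => affX (fun k => (ext T k)⁻¹) (ext Y 0 * (ext X 0)⁻¹) i) quad_H (by
    convert (core_H n).rho2'.finRel using 1
    funext i; exact (finRel_H n).X_eq i)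

theorem map_affX {G G' : Type*} [Group G] [Group G'] (f : G →* G') (t : ℕ → G) (a : G) (i : ℕ) :
    f (affX t a i) = affX (fun k => f (t k)) (f a) i := by
  induction i with
  | zero => rfl
  | succ i ih => simp only [affX, map_mul, ih]

/-- An algebra endomorphism, on units. -/
noncomputable abbrev onUnits {n : ℕ} (f : H n →ₐ[K] H n) : (H n)ˣ →* (H n)ˣ :=
  Units.map (f : H n →* H n)

theorem map_ext {G G' : Type*} [Group G] [Group G'] (f : G →* G') {m : ℕ} (t : Fin m → G) (k : ℕ) :
    f (ext t k) = ext (fun i => f (t i)) k := by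
  unfold ext; split_ifs <;> simp

/-- Two endomorphisms that fix the `T_i` and agree on `X_1`, `Y_1` are equal. -/
theorem end_ext {n : ℕ} {f g : H n →ₐ[K] H n} (hf : ∀ i : Fin (n - 1), onUnits f (T i) = T i)
    (hg : ∀ i : Fin (n - 1), onUnits g (T i) = T i)
    (hX : onUnits f (ext X 0) = onUnits g (ext X 0))
    (hY : onUnits f (ext Y 0) = onUnits g (ext Y 0)) : f = g := by
  have eT : ∀ k, onUnits f (ext T k) = onUnits g (ext T k) := by
    intro k; rw [map_ext, map_ext]; simp only [hf, hg]
  refine hom_ext (fun i => ?_) (fun j => ?_) (fun j => ?_)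
  · exact congrArg Units.val ((hf i).trans (hg i).symm)
  · refine congrArg Units.val (?_ : onUnits f (X j) = onUnits g (X j))
    rw [(finRel_H n).X_eq, map_affX, map_affX, hX]; simp only [eT]
  · refine congrArg Units.val (?_ : onUnits f (Y j) = onUnits g (Y j))
    rw [(finRel_H n).Y_eq, map_affX, map_affX, hY]; simp only [map_inv, eT]

theorem onUnits_lift {n : ℕ} {x y : Fin n → (H n)ˣ} (h : FinRel n (scalUnit (H n)) T x y) :
    (∀ i : Fin (n - 1), onUnits (lift T x y quad_H h) (T i) = T i) ∧
    onUnits (lift T x y quad_H h) (ext X 0) = ext x 0 ∧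
    onUnits (lift T x y quad_H h) (ext Y 0) = ext y 0 := by
  refine ⟨fun i => Units.ext (lift_T ..), ?_, ?_⟩
  · rw [map_ext]; congr 1; funext j; exact Units.ext (lift_X ..)
  · rw [map_ext]; congr 1; funext j; exact Units.ext (lift_Y ..)

theorem ext_zero_congr {G : Type*} [One G] {n : ℕ} {x : Fin n → G} {a : G}
    (h : ∀ h0 : 0 < n, x ⟨0, h0⟩ = a) (h1 : n = 0 → a = 1) : ext x 0 = a := by
  unfold ext; split_ifs with h0
  · exact h h0
  · exact (h1 (by omega)).symm

theorem rho1_spec (n : ℕ) : (∀ i : Fin (n - 1), onUnits (rho1Hom n) (T i) = T i) ∧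
    onUnits (rho1Hom n) (ext X 0) = ext X 0 * ext Y 0 ∧
    onUnits (rho1Hom n) (ext Y 0) = ext Y 0 := by
  refine ⟨(onUnits_lift _).1, (onUnits_lift _).2.1.trans (ext_zero_congr ?_ ?_), (onUnits_lift _).2.2⟩
  · intro h0; simp [loop, ext_of_lt _ h0]
  · rintro rfl; simp [ext]

theorem rho1Inv_spec (n : ℕ) : (∀ i : Fin (n - 1), onUnits (rho1Inv n) (T i) = T i) ∧
    onUnits (rho1Inv n) (ext X 0) = ext X 0 * (ext Y 0)⁻¹ ∧
    onUnits (rho1Inv n) (ext Y 0) = ext Y 0 := by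
  refine ⟨(onUnits_lift _).1, (onUnits_lift _).2.1.trans (ext_zero_congr ?_ ?_), (onUnits_lift _).2.2⟩
  · intro h0; simp [affX]
  · rintro rfl; simp [ext]

theorem rho2_spec (n : ℕ) : (∀ i : Fin (n - 1), onUnits (rho2Hom n) (T i) = T i) ∧
    onUnits (rho2Hom n) (ext X 0) = ext X 0 ∧
    onUnits (rho2Hom n) (ext Y 0) = ext Y 0 * ext X 0 := by
  refine ⟨(onUnits_lift _).1, (onUnits_lift _).2.1, (onUnits_lift _).2.2.trans (ext_zero_congr ?_ ?_)⟩
  · intro h0; simp [loop, ext_of_lt _ h0]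
  · rintro rfl; simp [ext]

theorem rho2Inv_spec (n : ℕ) : (∀ i : Fin (n - 1), onUnits (rho2Inv n) (T i) = T i) ∧
    onUnits (rho2Inv n) (ext X 0) = ext X 0 ∧
    onUnits (rho2Inv n) (ext Y 0) = ext Y 0 * (ext X 0)⁻¹ := by
  refine ⟨(onUnits_lift _).1, (onUnits_lift _).2.1, (onUnits_lift _).2.2.trans (ext_zero_congr ?_ ?_)⟩
  · intro h0; simp [affX]
  · rintro rfl; simp [ext]

theorem onUnits_comp {n : ℕ} (f g : H n →ₐ[K] H n) (u : (H n)ˣ) :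
    onUnits (f.comp g) u = onUnits f (onUnits g u) := rfl

theorem onUnits_id {n : ℕ} (u : (H n)ˣ) : onUnits (AlgHom.id K (H n)) u = u := rfl

/-- The automorphism `ρ₁`. -/
noncomputable def rho1 (n : ℕ) : H n ≃ₐ[K] H n :=
  AlgEquiv.ofAlgHom (rho1Hom n) (rho1Inv n)
    (by
      obtain ⟨a, b, c⟩ := rho1_spec n
      obtain ⟨a', b', c'⟩ := rho1Inv_spec n
      apply end_ext <;> intros <;>
        simp only [onUnits_comp, onUnits_id, map_mul, map_inv, a, b, c, a', b', c',
          mul_inv_cancel_right])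
    (by
      obtain ⟨a, b, c⟩ := rho1_spec n
      obtain ⟨a', b', c'⟩ := rho1Inv_spec n
      apply end_ext <;> intros <;>
        simp only [onUnits_comp, onUnits_id, map_mul, a, b, c, a', b', c',
          inv_mul_cancel_right])

/-- The automorphism `ρ₂`. -/
noncomputable def rho2 (n : ℕ) : H n ≃ₐ[K] H n :=
  AlgEquiv.ofAlgHom (rho2Hom n) (rho2Inv n)
    (by
      obtain ⟨a, b, c⟩ := rho2_spec n
      obtain ⟨a', b', c'⟩ := rho2Inv_spec n
      apply end_ext <;> intros <;>
        simp only [onUnits_comp, onUnits_id, map_mul, map_inv, a, b, c, a', b', c',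
          mul_inv_cancel_right])
    (by
      obtain ⟨a, b, c⟩ := rho2_spec n
      obtain ⟨a', b', c'⟩ := rho2Inv_spec n
      apply end_ext <;> intros <;>
        simp only [onUnits_comp, onUnits_id, map_mul, a, b, c, a', b', c',
          inv_mul_cancel_right])


/-! ### The symmetric group -/

section Sym
variable {n : ℕ}

/-- The position `i`, as an element of `Fin n`. -/
def lo (i : Fin (n - 1)) : Fin n := ⟨i.val, by omega⟩

/-- The position `i + 1`, as an element of `Fin n`. -/
def hi (i : Fin (n - 1)) : Fin n := ⟨i.val + 1, by omega⟩

/-- The transposition `s_i = (i, i+1)`. -/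
def s (i : Fin (n - 1)) : Equiv.Perm (Fin n) := Equiv.swap (lo i) (hi i)

/-- The permutation `s_{i_1} ⋯ s_{i_r}`. -/
def wordPerm (l : List (Fin (n - 1))) : Equiv.Perm (Fin n) := (l.map s).prod

/-- `s_{i_1} ⋯ s_{i_r}` is a reduced decomposition of `w`. -/
def IsReduced (w : Equiv.Perm (Fin n)) (l : List (Fin (n - 1))) : Prop :=
  wordPerm l = w ∧ ∀ l', wordPerm l' = w → l.length ≤ l'.length

/-- The number of inversions. -/
def invs (w : Equiv.Perm (Fin n)) : ℕ :=
  (Finset.univ.filter fun p : Fin n × Fin n => p.1 < p.2 ∧ w p.2 < w p.1).card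

theorem s_lo (i : Fin (n - 1)) : s i (lo i) = hi i := Equiv.swap_apply_left _ _
theorem s_hi (i : Fin (n - 1)) : s i (hi i) = lo i := Equiv.swap_apply_right _ _
theorem s_ne (i : Fin (n - 1)) {a : Fin n} (h1 : a ≠ lo i) (h2 : a ≠ hi i) : s i a = a :=
  Equiv.swap_apply_of_ne_of_ne h1 h2
theorem s_s (i : Fin (n - 1)) : s i * s i = 1 := Equiv.swap_mul_self _ _
theorem s_inv (i : Fin (n - 1)) : (s i)⁻¹ = s i := Equiv.swap_inv _ _
theorem lo_lt_hi (i : Fin (n - 1)) : lo i < hi i := by simp [lo, hi]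

theorem s_lt (i : Fin (n - 1)) {a b : Fin n} (h : a < b) (hab : ¬ (a = lo i ∧ b = hi i)) :
    s i a < s i b := by
  by_cases a1 : a = lo i
  · by_cases b2 : b = hi i
    · exact absurd ⟨a1, b2⟩ hab
    · subst a1
      have b1 : b ≠ lo i := h.ne'
      rw [s_lo, s_ne i b1 b2]
      simp only [Fin.lt_def, Fin.ext_iff, lo, hi] at *; omega
  · by_cases a2 : a = hi i
    · subst a2
      have b1 : b ≠ lo i := fun e => by subst e; exact absurd (lo_lt_hi i) h.not_gt
      rw [s_hi, s_ne i b1 h.ne']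
      exact (lo_lt_hi i).trans h
    · rw [s_ne i a1 a2]
      by_cases b1 : b = lo i
      · subst b1; rw [s_lo]; exact h.trans (lo_lt_hi i)
      · by_cases b2 : b = hi i
        · subst b2; rw [s_hi]
          simp only [Fin.lt_def, Fin.ext_iff, lo, hi] at *; omega
        · rwa [s_ne i b1 b2]

theorem invs_mul_s (w : Equiv.Perm (Fin n)) (i : Fin (n - 1)) (h : w (lo i) < w (hi i)) :
    invs (w * s i) = invs w + 1 := by
  unfold invs
  have hinj : Function.Injective (Prod.map (s i) (s i)) :=
    (s i).injective.prodMap (s i).injective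
  have hss : ∀ a, s i (s i a) = a := fun a => by rw [← Equiv.Perm.mul_apply, s_s]; rfl
  have hset : (Finset.univ.filter fun p : Fin n × Fin n => p.1 < p.2 ∧ (w * s i) p.2 < (w * s i) p.1)
      = insert (lo i, hi i) ((Finset.univ.filter fun p : Fin n × Fin n =>
          p.1 < p.2 ∧ w p.2 < w p.1).image (Prod.map (s i) (s i))) := by
    ext ⟨a, b⟩
    simp only [Finset.mem_filter, Finset.mem_univ, true_and, Finset.mem_insert, Finset.mem_image,
      Prod.exists, Prod.map_apply, Prod.mk.injEq]
    simp only [Equiv.Perm.mul_apply]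
    constructor
    · rintro ⟨hab, hw⟩
      by_cases hc : a = lo i ∧ b = hi i
      · exact Or.inl hc
      · exact Or.inr ⟨s i a, s i b, ⟨s_lt i hab hc, hw⟩, hss a, hss b⟩
    · rintro (⟨rfl, rfl⟩ | ⟨c, d, ⟨hcd, hw⟩, rfl, rfl⟩)
      · exact ⟨lo_lt_hi i, by rwa [s_lo, s_hi]⟩
      · rw [hss, hss]
        refine ⟨s_lt i hcd ?_, hw⟩
        rintro ⟨rfl, rfl⟩
        exact absurd h hw.not_gt
  rw [hset, Finset.card_insert_of_notMem, Finset.card_image_of_injective _ hinj]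
  simp only [Finset.mem_image, Finset.mem_filter, Finset.mem_univ, true_and, Prod.exists,
    Prod.map_apply, Prod.mk.injEq, not_exists, not_and]
  rintro a b ⟨hab, -⟩ ha hb
  have ha' : a = hi i := by rw [← hss a, ha, s_lo]
  have hb' : b = lo i := by rw [← hss b, hb, s_hi]
  subst ha' hb'
  exact absurd (lo_lt_hi i) hab.not_gt

/-- The length, as the number of inversions of the inverse. -/
def len (w : Equiv.Perm (Fin n)) : ℕ := invs w⁻¹

/-- `s_i w` is longer than `w`. -/
def Up (i : Fin (n - 1)) (w : Equiv.Perm (Fin n)) : Prop := w⁻¹ (lo i) < w⁻¹ (hi i)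

theorem len_up {i : Fin (n - 1)} {w : Equiv.Perm (Fin n)} (h : Up i w) : len (s i * w) = len w + 1 := by
  unfold len
  rw [mul_inv_rev, s_inv]
  exact invs_mul_s _ i h

theorem up_s_iff {i : Fin (n - 1)} {w : Equiv.Perm (Fin n)} : Up i (s i * w) ↔ ¬ Up i w := by
  unfold Up
  rw [mul_inv_rev, s_inv, Equiv.Perm.mul_apply, Equiv.Perm.mul_apply, s_lo, s_hi, not_lt]
  refine ⟨le_of_lt, fun h => lt_of_le_of_ne h fun e => ?_⟩
  exact absurd (w⁻¹.injective e) (lo_lt_hi i).ne'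

theorem s_mul_s_mul (i : Fin (n - 1)) (w : Equiv.Perm (Fin n)) : s i * (s i * w) = w := by
  rw [← mul_assoc, s_s, one_mul]

theorem len_down {i : Fin (n - 1)} {w : Equiv.Perm (Fin n)} (h : ¬ Up i w) :
    len w = len (s i * w) + 1 := by
  have := len_up (up_s_iff.2 h)
  rwa [s_mul_s_mul] at this

theorem eq_one_of_up {w : Equiv.Perm (Fin n)} (h : ∀ i, Up i w) : w = 1 := by
  have hm : StrictMono (w⁻¹ : Equiv.Perm (Fin n)) := by
    cases n with
    | zero => intro a; exact a.elim0
    | succ n => exact Fin.strictMono_iff_lt_succ.2 fun i => h i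
  have e : w⁻¹ = 1 := by
    have := Subsingleton.elim
      (hm.orderIsoOfSurjective _ (w⁻¹).surjective) (OrderIso.refl (Fin n))
    ext a
    exact congrArg Fin.val (DFunLike.congr_fun this a)
  rwa [inv_eq_one] at e

theorem len_one : len (1 : Equiv.Perm (Fin n)) = 0 := by
  unfold len invs
  rw [Finset.card_eq_zero, Finset.filter_eq_empty_iff]
  rintro ⟨a, b⟩ - ⟨h1, h2⟩
  exact absurd h1 (by simpa using h2.not_gt)

theorem wordPerm_cons (i : Fin (n - 1)) (l : List (Fin (n - 1))) :
    wordPerm (i :: l) = s i * wordPerm l := rfl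

theorem len_wordPerm_le (l : List (Fin (n - 1))) : len (wordPerm l) ≤ l.length := by
  induction l with
  | nil => exact len_one.le
  | cons i l ih =>
    rw [wordPerm_cons, List.length_cons]
    by_cases h : Up i (wordPerm l)
    · rw [len_up h]; omega
    · have := len_down h; omega

theorem exists_word (w : Equiv.Perm (Fin n)) : ∃ l, wordPerm l = w ∧ l.length = len w := by
  induction hk : len w using Nat.strong_induction_on generalizing w with
  | _ k ih =>
    by_cases h : ∀ i, Up i w
    · exact ⟨[], (eq_one_of_up h).symm, by rw [← hk, eq_one_of_up h, len_one]; rfl⟩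
    · push Not at h
      obtain ⟨i, hi⟩ := h
      have hl := len_down hi
      obtain ⟨l, h1, h2⟩ := ih (len (s i * w)) (by omega) _ rfl
      exact ⟨i :: l, by rw [wordPerm_cons, h1, s_mul_s_mul], by rw [List.length_cons, h2]; omega⟩

theorem isReduced_iff {w : Equiv.Perm (Fin n)} {l : List (Fin (n - 1))} :
    IsReduced w l ↔ wordPerm l = w ∧ l.length = len w := by
  constructor
  · rintro ⟨h1, h2⟩
    obtain ⟨l', h3, h4⟩ := exists_word w
    have := h2 l' h3
    have := len_wordPerm_le l
    rw [h1] at this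
    exact ⟨h1, by omega⟩
  · rintro ⟨h1, h2⟩
    refine ⟨h1, fun l' h => ?_⟩
    rw [h2, ← h]
    exact len_wordPerm_le l'

theorem exists_isReduced (w : Equiv.Perm (Fin n)) : ∃ l, IsReduced w l := by
  obtain ⟨l, h⟩ := exists_word w
  exact ⟨l, isReduced_iff.2 h⟩

/-- A reduced decomposition of `w`. -/
noncomputable def redWord (w : Equiv.Perm (Fin n)) : List (Fin (n - 1)) :=
  (exists_isReduced w).choose

theorem redWord_spec (w : Equiv.Perm (Fin n)) : IsReduced w (redWord w) :=
  (exists_isReduced w).choose_spec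

theorem length_redWord (w : Equiv.Perm (Fin n)) : (redWord w).length = len w :=
  (isReduced_iff.1 (redWord_spec w)).2

theorem up_of_reduced_cons {i : Fin (n - 1)} {l : List (Fin (n - 1))} {w : Equiv.Perm (Fin n)}
    (h1 : wordPerm (i :: l) = w) (h2 : (i :: l).length = len w) :
    ¬ Up i w ∧ wordPerm l = s i * w ∧ l.length = len (s i * w) := by
  rw [wordPerm_cons] at h1
  have e : wordPerm l = s i * w := by rw [← h1, s_mul_s_mul]
  have hle := len_wordPerm_le l
  rw [e] at hle
  rw [List.length_cons] at h2
  have hup : ¬ Up i w := fun hu => by have := len_up hu; omega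
  exact ⟨hup, e, by have := len_down hup; omega⟩

/-- All reduced decompositions of a permutation give the same product of elements that satisfy
the braid relations. -/
theorem prod_reduced {M : Type*} [Monoid M] (t : Fin (n - 1) → M)
    (hb : ∀ i j : Fin (n - 1), j.val = i.val + 1 → t i * t j * t i = t j * t i * t j)
    (hc : ∀ i j : Fin (n - 1), i.val + 1 < j.val → t i * t j = t j * t i)
    (w : Equiv.Perm (Fin n)) (l l' : List (Fin (n - 1)))
    (h : wordPerm l = w ∧ l.length = len w) (h' : wordPerm l' = w ∧ l'.length = len w) :
    (l.map t).prod = (l'.map t).prod := by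
  induction hk : len w using Nat.strong_induction_on generalizing w l l' with
  | _ k ih =>
    subst hk
    -- the case of two different first letters, in order
    have key : ∀ (i j : Fin (n - 1)) (l l' : List (Fin (n - 1))), i.val < j.val →
        (wordPerm (i :: l) = w ∧ (i :: l).length = len w) →
        (wordPerm (j :: l') = w ∧ (j :: l').length = len w) →
        ((i :: l).map t).prod = ((j :: l').map t).prod := by
      intro i j l l' hij h h'
      obtain ⟨hu, e1, e2⟩ := up_of_reduced_cons h.1 h.2
      obtain ⟨hu', e1', e2'⟩ := up_of_reduced_cons h'.1 h'.2
      have hd := len_down hu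
      have hd' := len_down hu'
      simp only [List.map_cons, List.prod_cons]
      have hwi : ∀ a, (s i * w)⁻¹ a = w⁻¹ (s i a) := fun a => by rw [mul_inv_rev, s_inv]; rfl
      have hwj : ∀ a, (s j * w)⁻¹ a = w⁻¹ (s j a) := fun a => by rw [mul_inv_rev, s_inv]; rfl
      have ne1 : ∀ a b : Fin n, a.val ≠ b.val → a ≠ b := fun a b h e => h (congrArg Fin.val e)
      by_cases hfar : i.val + 1 < j.val
      · have e3 : s i (lo j) = lo j := s_ne i (ne1 _ _ (by simp [lo]; omega)) (ne1 _ _ (by simp [lo, hi]; omega))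
        have e4 : s i (hi j) = hi j := s_ne i (ne1 _ _ (by simp [lo, hi]; omega)) (ne1 _ _ (by simp [hi]; omega))
        have huj : ¬ Up j (s i * w) := by
          unfold Up; rw [hwi, hwi, e3, e4]; exact hu'
        have hdj := len_down huj
        obtain ⟨m, hm1, hm2⟩ := exists_word (s j * (s i * w))
        have hsc : s i * s j = s j * s i := by
          have : Equiv.swap (s i (lo j)) (s i (hi j)) = s i * s j * (s i)⁻¹ :=
            Equiv.swap_apply_apply _ _ _
          rw [e3, e4] at this
          exact (mul_inv_eq_iff_eq_mul.1 this.symm)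
        have e5 : s j * (s i * w) = s i * (s j * w) := by
          rw [← mul_assoc, ← hsc, mul_assoc]
        have q1 := ih _ (by omega) (s i * w) l (j :: m) ⟨e1, e2⟩
          ⟨by rw [wordPerm_cons, hm1, s_mul_s_mul], by rw [List.length_cons, hm2]; omega⟩ rfl
        have q2 := ih _ (by omega) (s j * w) l' (i :: m) ⟨e1', e2'⟩
          ⟨by rw [wordPerm_cons, hm1, e5, s_mul_s_mul], by rw [List.length_cons, hm2]; omega⟩ rfl
        rw [q1, q2]
        simp only [List.map_cons, List.prod_cons, ← mul_assoc]
        rw [hc i j hfar]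
      · have hj : j.val = i.val + 1 := by omega
        have hlh : lo j = hi i := by simp [lo, hi, hj]
        -- `a = lo i < b = hi i = lo j < c = hi j`, with decreasing values
        have f1 : s i (lo j) = lo i := by rw [hlh, s_hi]
        have f2 : s i (hi j) = hi j := s_ne i (ne1 _ _ (by simp [lo, hi]; omega)) (ne1 _ _ (by simp [hi]; omega))
        have f3 : s j (lo i) = lo i := s_ne j (ne1 _ _ (by simp [lo]; omega)) (ne1 _ _ (by simp [lo, hi]; omega))
        have f4 : s j (hi i) = hi j := by rw [← hlh, s_lo]
        have g1 : w⁻¹ (hi i) < w⁻¹ (lo i) :=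
          lt_of_le_of_ne (not_lt.1 hu) fun e => absurd (w⁻¹.injective e) (lo_lt_hi i).ne'
        have g2 : w⁻¹ (hi j) < w⁻¹ (hi i) := by
          rw [← hlh]
          exact lt_of_le_of_ne (not_lt.1 hu') fun e => absurd (w⁻¹.injective e) (lo_lt_hi j).ne'
        have huj : ¬ Up j (s i * w) := by
          unfold Up; rw [hwi, hwi, f1, f2]; exact (g2.trans g1).not_gt
        have hui : ¬ Up i (s j * w) := by
          unfold Up; rw [hwj, hwj, f3, f4]; exact (g2.trans g1).not_gt
        have hdj := len_down huj
        have hdi := len_down hui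
        have huij : ¬ Up i (s j * (s i * w)) := by
          unfold Up
          have : ∀ a, (s j * (s i * w))⁻¹ a = w⁻¹ (s i (s j a)) := fun a => by
            rw [mul_inv_rev, mul_inv_rev, s_inv, s_inv]; rfl
          rw [this, this, f3, f4, s_lo, f2]
          exact g2.not_gt
        have hdij := len_down huij
        obtain ⟨m, hm1, hm2⟩ := exists_word (s i * (s j * (s i * w)))
        have hbr : s i * s j * s i = s j * s i * s j := by
          have h1 : Equiv.swap (s i (lo j)) (s i (hi j)) = s i * s j * (s i)⁻¹ :=
            Equiv.swap_apply_apply _ _ _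
          have h2 : Equiv.swap (s j (lo i)) (s j (hi i)) = s j * s i * (s j)⁻¹ :=
            Equiv.swap_apply_apply _ _ _
          rw [s_inv] at h1 h2
          rw [← h1, ← h2, f1, f2, f3, f4]
        have e5 : s i * (s j * (s i * w)) = s j * (s i * (s j * w)) := by
          simp only [← mul_assoc]; rw [hbr]
        have q1 := ih _ (by omega) (s i * w) l (j :: i :: m) ⟨e1, e2⟩
          ⟨by rw [wordPerm_cons, wordPerm_cons, hm1, s_mul_s_mul, s_mul_s_mul],
            by rw [List.length_cons, List.length_cons, hm2]; omega⟩ rfl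
        have q2 := ih _ (by omega) (s j * w) l' (i :: j :: m) ⟨e1', e2'⟩
          ⟨by rw [wordPerm_cons, wordPerm_cons, hm1, e5, s_mul_s_mul, s_mul_s_mul],
            by rw [List.length_cons, List.length_cons, hm2]; omega⟩ rfl
        rw [q1, q2]
        simp only [List.map_cons, List.prod_cons, ← mul_assoc]
        rw [hb i j hj]
    match l, l', h, h' with
    | [], [], _, _ => rfl
    | [], _ :: _, h, h' => have := h.2.trans h'.2.symm; simp at this
    | _ :: _, [], h, h' => have := h.2.trans h'.2.symm; simp at this
    | i :: l, j :: l', h, h' =>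
      rcases lt_trichotomy i.val j.val with hlt | heq | hgt
      · exact key i j l l' hlt h h'
      · obtain rfl : i = j := Fin.ext heq
        obtain ⟨hu, e1, e2⟩ := up_of_reduced_cons h.1 h.2
        obtain ⟨_, e1', e2'⟩ := up_of_reduced_cons h'.1 h'.2
        have hd := len_down hu
        simp only [List.map_cons, List.prod_cons]
        rw [ih _ (by omega) (s i * w) l l' ⟨e1, e2⟩ ⟨e1', e2'⟩ rfl]
      · exact (key j i l' l hgt h' h).symm

/-! ### The generating function of the length -/

theorem invs_eq_sum (w : Equiv.Perm (Fin n)) :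
    invs w = ∑ a, ∑ b, if a < b ∧ w b < w a then 1 else 0 := by
  unfold invs
  rw [Finset.card_filter, Fintype.sum_prod_type]

/-- The permutation that sends `0` to `p` and orders the other values as `e`. -/
def glue {n : ℕ} (p : Fin (n + 1)) (e : Equiv.Perm (Fin n)) : Equiv.Perm (Fin (n + 1)) :=
  p.cycleRange.symm * Equiv.Perm.decomposeFin.symm (0, e)

theorem glue_zero (p : Fin (n + 1)) (e : Equiv.Perm (Fin n)) : glue p e 0 = p := by
  simp [glue]

theorem glue_succ (p : Fin (n + 1)) (e : Equiv.Perm (Fin n)) (k : Fin n) :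
    glue p e k.succ = p.succAbove (e k) := by
  simp [glue]

theorem invs_glue (p : Fin (n + 1)) (e : Equiv.Perm (Fin n)) : invs (glue p e) = p + invs e := by
  rw [invs_eq_sum, invs_eq_sum, Fin.sum_univ_succ]
  congr 1
  · rw [Fin.sum_univ_succ]
    simp only [glue_zero, glue_succ, lt_irrefl, false_and, if_false, zero_add, Fin.succ_pos,
      true_and]
    rw [Equiv.sum_comp e (fun k => if p.succAbove k < p then 1 else 0)]
    simp only [Fin.succAbove_lt_iff_castSucc_lt]
    rw [← Finset.card_filter]
    have : (Finset.univ.filter fun k : Fin n => k.castSucc < p) =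
        (Finset.univ.filter fun k : Fin n => k.val < p.val) := by
      ext k; simp [Fin.lt_def]
    rw [this]
    rw [Fin.card_filter_val_lt]
    have := p.2
    omega
  · refine Finset.sum_congr rfl fun a _ => ?_
    rw [Fin.sum_univ_succ]
    simp [glue_succ]

theorem sum_len {R : Type*} [CommSemiring R] (x : R) (n : ℕ) :
    ∑ w : Equiv.Perm (Fin n), x ^ len w = ∏ i ∈ Finset.range n, ∑ j ∈ Finset.range (i + 1), x ^ j := by
  have h0 : ∀ n, ∑ w : Equiv.Perm (Fin n), x ^ len w = ∑ w : Equiv.Perm (Fin n), x ^ invs w :=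
    fun n => Equiv.sum_comp (Equiv.inv (Equiv.Perm (Fin n))) (fun w => x ^ invs w)
  rw [h0]
  induction n with
  | zero => simp [invs]
  | succ n ih =>
    have hbij : Function.Bijective
        (fun pe : Fin (n + 1) × Equiv.Perm (Fin n) => glue pe.1 pe.2) := by
      rw [Fintype.bijective_iff_injective_and_card]
      constructor
      · rintro ⟨p, e⟩ ⟨p', e'⟩ h
        have h1 : p = p' := by
          have := DFunLike.congr_fun h 0
          simpa [glue_zero] using this
        subst h1
        simp only [glue] at h
        have := Equiv.Perm.decomposeFin.symm.injective (mul_left_cancel h)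
        simpa using this
      · rw [Fintype.card_prod, Fintype.card_perm, Fintype.card_perm, Fintype.card_fin,
          Fintype.card_fin, Nat.factorial_succ]
    rw [← Function.Bijective.sum_comp hbij (fun w => x ^ invs w), Fintype.sum_prod_type,
      Finset.prod_range_succ, ← ih]
    simp only [invs_glue, pow_add]
    rw [← Finset.sum_mul_sum, mul_comm]
    congr 1
    exact Fin.sum_univ_eq_sum_range (fun j => x ^ j) (n + 1)

end Sym

/-! ### The symmetrizer and the spherical algebra -/

theorem v_pow_ne_one {k : ℕ} (hk : 0 < k) : v ^ k ≠ 1 := by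
  intro h
  have h1 := IsFractionRing.injective (MvPolynomial (Fin 2) ℂ) K
  have h2 : (MvPolynomial.X 0 : MvPolynomial (Fin 2) ℂ) ^ k = 1 := by
    apply h1
    rw [map_pow, map_one]
    exact h
  have h3 := congrArg (MvPolynomial.eval (0 : Fin 2 → ℂ)) h2
  simp [hk.ne'] at h3

/-- `[i]⁺ = (v^{2i} - 1)/(v² - 1)`. -/
noncomputable def qInt (i : ℕ) : K := (v ^ (2 * i) - 1) / (v ^ 2 - 1)

/-- `[n]⁺! = [2]⁺ ⋯ [n]⁺`. -/
noncomputable def qFact (n : ℕ) : K := ∏ i ∈ Finset.Icc 2 n, qInt i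

theorem qInt_ne_zero {i : ℕ} (hi : 0 < i) : qInt i ≠ 0 :=
  div_ne_zero (sub_ne_zero.2 (v_pow_ne_one (by omega))) (sub_ne_zero.2 (v_pow_ne_one (by omega)))

theorem qFact_ne_zero (n : ℕ) : qFact n ≠ 0 :=
  Finset.prod_ne_zero_iff.2 fun i hi => qInt_ne_zero (by have := (Finset.mem_Icc.1 hi).1; omega)

theorem qInt_eq_sum (i : ℕ) : qInt i = ∑ j ∈ Finset.range i, (v ^ 2) ^ j := by
  rw [geom_sum_eq (v_pow_ne_one (by omega)), qInt, pow_mul]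

theorem qFact_eq_sum (n : ℕ) : qFact n = ∑ w : Equiv.Perm (Fin n), (v ^ 2) ^ len w := by
  rw [sum_len]
  induction n with
  | zero => simp [qFact]
  | succ n ih =>
    rw [Finset.prod_range_succ, ← ih, ← qInt_eq_sum]
    unfold qFact
    cases n with
    | zero => simp [qInt_eq_sum]
    | succ n => exact Finset.prod_Icc_succ_top (by omega) _

/-- `T_w = T_{i_1} ⋯ T_{i_r}` for a reduced decomposition `w = s_{i_1} ⋯ s_{i_r}`. -/
noncomputable def Tw {n : ℕ} (w : Equiv.Perm (Fin n)) : H n :=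
  ((redWord w).map fun i => (T i : H n)).prod

/-- `S̃ = ∑_w v^{l(w)} T_w`. -/
noncomputable def Stilde (n : ℕ) : H n := ∑ w : Equiv.Perm (Fin n), v ^ len w • Tw w

/-- `S = S̃ / [n]⁺!`. -/
noncomputable def S (n : ℕ) : H n := (qFact n)⁻¹ • Stilde n

theorem Tw_up {n : ℕ} {i : Fin (n - 1)} {w : Equiv.Perm (Fin n)} (h : Up i w) :
    Tw (s i * w) = (T i : H n) * Tw w := by
  have h1 := isReduced_iff.1 (redWord_spec w)
  exact prod_reduced (fun i => (T i : H n))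
    (fun i j e => congrArg Units.val ((finRel_H n).braid i j e))
    (fun i j e => congrArg Units.val ((finRel_H n).TT i j e)) (s i * w) (redWord (s i * w))
    (i :: redWord w) (isReduced_iff.1 (redWord_spec _))
    ⟨by rw [wordPerm_cons, h1.1], by rw [List.length_cons, h1.2, len_up h]⟩

theorem T_sq {n : ℕ} (i : Fin (n - 1)) :
    (T i : H n) * T i = (v - v⁻¹) • (T i : H n) + 1 := by
  have h := quad_H i
  have hv : algebraMap K (H n) v⁻¹ * algebraMap K (H n) v = 1 := by
    rw [← map_mul, inv_mul_cancel₀ v_ne_zero, map_one]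
  have hc := Algebra.commutes v (T i : H n)
  rw [add_mul, mul_sub, mul_sub, hv, ← hc] at h
  rw [sub_smul, Algebra.smul_def, Algebra.smul_def]
  rw [← sub_eq_zero, ← h]
  abel

theorem smul_aux {F M : Type*} [Field F] [AddCommGroup M] [Module F M] {c : F} (hc : c ≠ 0)
    (l : ℕ) (a b : M) :
    c ^ l • a + c ^ (l + 1) • ((c - c⁻¹) • a + b) = c • (c ^ l • b + c ^ (l + 1) • a) := by
  match_scalars
  · field_simp
    ring
  · ring

theorem T_mul_Stilde {n : ℕ} (i : Fin (n - 1)) : (T i : H n) * Stilde n = v • Stilde n := by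
  classical
  have hsplit : Stilde n = ∑ w ∈ Finset.univ.filter (fun w : Equiv.Perm (Fin n) => Up i w),
      (v ^ len w • Tw w + v ^ (len w + 1) • ((T i : H n) * Tw w)) := by
    unfold Stilde
    rw [← Finset.sum_filter_add_sum_filter_not Finset.univ (fun w : Equiv.Perm (Fin n) => Up i w),
      Finset.sum_add_distrib]
    congr 1
    refine Finset.sum_bij' (fun w _ => s i * w) (fun w _ => s i * w) ?_ ?_ ?_ ?_ ?_
    · intro w hw
      simpa [up_s_iff] using hw
    · intro w hw
      simpa [up_s_iff] using hw
    · intro w _; exact s_mul_s_mul i w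
    · intro w _; exact s_mul_s_mul i w
    · intro w hw
      have hw : ¬ Up i w := by simpa using hw
      have hu := up_s_iff.2 hw
      have e := Tw_up hu
      rw [s_mul_s_mul] at e
      rw [← e, len_down hw]
  rw [hsplit, Finset.mul_sum, Finset.smul_sum]
  refine Finset.sum_congr rfl fun w _ => ?_
  rw [mul_add, mul_smul_comm, mul_smul_comm, ← mul_assoc, T_sq, add_mul, one_mul, smul_mul_assoc]
  exact smul_aux v_ne_zero _ _ _

theorem Tw_mul_Stilde {n : ℕ} (w : Equiv.Perm (Fin n)) : Tw w * Stilde n = v ^ len w • Stilde n := by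
  rw [← length_redWord w, Tw]
  induction redWord w with
  | nil => simp
  | cons i l ih =>
    rw [List.map_cons, List.prod_cons, mul_assoc, ih, mul_smul_comm, T_mul_Stilde, smul_smul,
      List.length_cons, pow_succ]

/-- The element `S` is idempotent. -/
theorem S_idem (n : ℕ) : IsIdempotentElem (S n) := by
  have h : Stilde n * Stilde n = qFact n • Stilde n := by
    conv_lhs => enter [1]; unfold Stilde
    rw [Finset.sum_mul, qFact_eq_sum, Finset.sum_smul]
    refine Finset.sum_congr rfl fun w _ => ?_
    rw [smul_mul_assoc, Tw_mul_Stilde, smul_smul]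
    congr 1
    ring
  unfold IsIdempotentElem S
  rw [smul_mul_smul_comm, h, smul_smul, mul_assoc, inv_mul_cancel₀ (qFact_ne_zero n), mul_one]

section CornerAlgebra
variable {R : Type*} [Ring R] [Algebra K R] {e : R}

/-- Scalar multiplication on the corner `e R e`. -/
noncomputable instance (idem : IsIdempotentElem e) : SMul K idem.Corner where
  smul c x := ⟨c • x.1, by
    obtain ⟨r, hr⟩ := x.2
    refine ⟨c • r, ?_⟩
    simp only [mul_smul_comm, smul_mul_assoc]
    exact congrArg (c • ·) hr⟩

/-- The corner `e R e`, as an algebra with unit `e`. -/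
noncomputable instance (idem : IsIdempotentElem e) : Algebra K idem.Corner :=
  letI : Module K idem.Corner :=
    Function.Injective.module K
      { toFun := fun x : idem.Corner => (x.1 : R), map_zero' := rfl, map_add' := fun _ _ => rfl }
      Subtype.val_injective (fun _ _ => rfl)
  Algebra.ofModule (fun c x y => Subtype.ext (smul_mul_assoc c x.1 y.1))
    (fun c x y => Subtype.ext (mul_smul_comm c x.1 y.1))

end CornerAlgebra

/-- The spherical double affine Hecke algebra `S H_n S`, an algebra with unit `S`. -/
abbrev SH (n : ℕ) : Type := (S_idem n).Corner

/-! ### The elements `P_x` -/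

/-- `S (∑_i Y_i^e) S`. -/
noncomputable def P0 (n e : ℕ) : H n := S n * (∑ i : Fin n, (Y i : H n) ^ e) * S n

/-- Words in `ρ₁^{±1}`, `ρ₂^{±1}`, acting on the double affine Hecke algebra (`true` is `ρ₁`,
`false` is `ρ₂`; a product acts by composition). -/
noncomputable def rho (n : ℕ) : FreeGroup Bool →* (H n ≃ₐ[K] H n) :=
  FreeGroup.lift fun b => if b then rho1 n else rho2 n

open Matrix in
/-- The matrix `A₁`. -/
def A1 : SpecialLinearGroup (Fin 2) ℤ := ⟨!![1, 0; 1, 1], by simp [det_fin_two]⟩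

open Matrix in
/-- The matrix `A₂`. -/
def A2 : SpecialLinearGroup (Fin 2) ℤ := ⟨!![1, 1; 0, 1], by simp [det_fin_two]⟩

/-- The matrix in `SL(2, ℤ)` of a word; `ρ₁` and `ρ₂` have the matrices `A₁` and `A₂`. -/
def toSL : FreeGroup Bool →* Matrix.SpecialLinearGroup (Fin 2) ℤ :=
  FreeGroup.lift fun b => if b then A1 else A2

/-- The action of `SL(2, ℤ)` on `ℤ²`, by matrices acting on columns. -/
def act (g : Matrix.SpecialLinearGroup (Fin 2) ℤ) (x : ℤ × ℤ) : ℤ × ℤ :=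
  (g.1 0 0 * x.1 + g.1 0 1 * x.2, g.1 1 0 * x.1 + g.1 1 1 * x.2)

theorem rho1_T {n : ℕ} (i : Fin (n - 1)) : rho1 n (T i : H n) = T i :=
  congrArg Units.val ((rho1_spec n).1 i)

theorem rho2_T {n : ℕ} (i : Fin (n - 1)) : rho2 n (T i : H n) = T i :=
  congrArg Units.val ((rho2_spec n).1 i)

theorem map_S {n : ℕ} (f : H n ≃ₐ[K] H n) (hf : ∀ i : Fin (n - 1), f (T i : H n) = T i) :
    f (S n) = S n := by
  simp only [S, Stilde, Tw, map_smul, map_sum, map_list_prod, List.map_map]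
  simp only [Function.comp_def, hf]

theorem rho_S {n : ℕ} (w : FreeGroup Bool) : rho n w (S n) = S n := by
  have h1 := map_S (rho1 n) rho1_T
  have h2 := map_S (rho2 n) rho2_T
  have hinv : ∀ f : H n ≃ₐ[K] H n, f (S n) = S n → f⁻¹ (S n) = S n := by
    intro f hf
    conv_lhs => rw [← hf]
    exact f.symm_apply_apply _
  have hg : ∀ b, rho n (FreeGroup.of b) (S n) = S n := by
    intro b; cases b <;> simp [rho, h1, h2]
  induction w using FreeGroup.induction_on with
  | C1 => simp
  | of b => exact hg b
  | inv_of b _ => rw [map_inv]; exact hinv _ (hg b)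
  | mul a b ha hb => rw [map_mul, AlgEquiv.mul_apply, hb, ha]

/-- `ρ(w) (S (∑_i Y_i^e) S)`, as an element of the spherical algebra. -/
noncomputable def rhoP (n : ℕ) (w : FreeGroup Bool) (e : ℕ) : SH n :=
  ⟨rho n w (P0 n e), rho n w (∑ i : Fin n, (Y i : H n) ^ e), by
    simp only [P0, map_mul, rho_S]⟩

theorem act_mul (g h : Matrix.SpecialLinearGroup (Fin 2) ℤ) (x : ℤ × ℤ) :
    act (g * h) x = act g (act h x) := by
  simp only [act, Matrix.SpecialLinearGroup.coe_mul, Matrix.mul_apply, Fin.sum_univ_two]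
  ext <;> ring

theorem toSL_surjective : Function.Surjective toSL := by
  have hT : ModularGroup.T ∈ toSL.range := ⟨FreeGroup.of false, by
    ext i j; fin_cases i <;> fin_cases j <;> simp [toSL, A2, ModularGroup.T]⟩
  have hS : ModularGroup.S ∈ toSL.range :=
    ⟨(FreeGroup.of false)⁻¹ * FreeGroup.of true * (FreeGroup.of false)⁻¹, by
      have h : A1 = A2 * ModularGroup.S * A2 := by
        decide
      simp only [toSL, map_mul, map_inv, FreeGroup.lift_apply_of, if_true, Bool.false_eq_true,
        if_false]
      rw [h]
      group⟩
  rw [← MonoidHom.range_eq_top, eq_top_iff, ← SpecialLinearGroup.SL2Z_generators,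
    Subgroup.closure_le]
  rintro g (rfl | rfl)
  · exact hS
  · exact hT

/-- Every `x ∈ ℤ²` is of the form `g (0, d)` where `d` is the greatest common divisor of its
coordinates. -/
theorem exists_toSL (x : ℤ × ℤ) : ∃ w, act (toSL w) (0, (Int.gcd x.1 x.2 : ℤ)) = x := by
  suffices h : ∃ g, act g (0, (Int.gcd x.1 x.2 : ℤ)) = x by
    obtain ⟨g, hg⟩ := h
    obtain ⟨w, rfl⟩ := toSL_surjective g
    exact ⟨w, hg⟩
  by_cases h0 : Int.gcd x.1 x.2 = 0
  · refine ⟨1, ?_⟩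
    obtain ⟨h1, h2⟩ := Int.gcd_eq_zero_iff.1 h0
    ext <;> simp [act, h1, h2]
  · obtain ⟨a, b, hab, ha, hb⟩ := Int.exists_gcd_one (Nat.pos_of_ne_zero h0)
    obtain ⟨g, hg⟩ := (Int.isCoprime_iff_gcd_eq_one.2 hab).exists_SL2_col 1
    refine ⟨g, Prod.ext ?_ ?_⟩
    · simp only [act, mul_zero, zero_add, hg.1]; exact ha.symm
    · simp only [act, mul_zero, zero_add, hg.2]; exact hb.symm

/-- The element `P_x` of the spherical algebra: `P_x = ρ(g) (S (∑_i Y_i^d) S)` where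
`x = g (0, d)` and `d > 0`. (A word for `g` is chosen. That the result does not depend on it is
part of the theorem. The value at `x = (0, 0)` is never used.) -/
noncomputable def P (n : ℕ) (x : ℤ × ℤ) : SH n :=
  rhoP n (exists_toSL x).choose (Int.gcd x.1 x.2)

/-- The nonzero elements of `ℤ^{2,+} = {(r, d) : r ≥ 1, or r = 0 and d ≥ 0}`. -/
def Zplus : Set (ℤ × ℤ) := {x | (1 ≤ x.1 ∨ x.1 = 0 ∧ 0 ≤ x.2) ∧ x ≠ (0, 0)}

/-- The nonzero elements of `ℤ^{2,++} = {(r, d) : r ≥ 0, d ≥ 0}`. -/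
def Zplusplus : Set (ℤ × ℤ) := {x | (0 ≤ x.1 ∧ 0 ≤ x.2) ∧ x ≠ (0, 0)}

/-- The (unital) subalgebra of the spherical algebra generated by the `P_x` with `x ∈ Z`. -/
noncomputable def subalg (n : ℕ) (Z : Set (ℤ × ℤ)) : Subalgebra K (SH n) :=
  Algebra.adjoin K (P n '' Z)

/-- `P_x`, as an element of the subalgebra generated by the `P_x` with `x ∈ Z`. -/
noncomputable def Psub (n : ℕ) (Z : Set (ℤ × ℤ)) (x : Z) : subalg n Z :=
  ⟨P n x, Algebra.subset_adjoin (Set.mem_image_of_mem _ x.2)⟩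

/-- The subalgebra generated by the `P_x` with `x ∈ ℤ^{2,+}`. -/
noncomputable abbrev SHplus (n : ℕ) : Subalgebra K (SH n) := subalg n Zplus

/-- The subalgebra generated by the `P_x` with `x ∈ ℤ^{2,++}`. -/
noncomputable abbrev SHplusplus (n : ℕ) : Subalgebra K (SH n) := subalg n Zplusplus


end Daha

/-! # Morphisms between spherical double affine Hecke algebras of consecutive ranks

Let `n ≥ 1`. The elements `T_i^{±1}`, `X_1`, `Y_1` generate a "positive" subalgebra of `H (n + 1)`.
It is preserved by `ρ₁` and `ρ₂`, which take `(X_1, Y_1)` to `(X_1 Y_1, Y_1)` and `(X_1, Y_1 X_1)`.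
The regular module `N` of `H n` induces a module `M = ⊕_{p ≤ n} T_{p-1} ⋯ T_0 ⊗ N` over this
subalgebra: `T_{i+1}` acts on `1 ⊗ N` as `T_i` on `N`, while `X_1` and `Y_1` annihilate `1 ⊗ N` and
act on `T_0 ⊗ N` essentially as `X_1` and `Y_1` do on `N` (`indT`, `indA`, `indB`, `posCore_ind`).
For a positive word `w` the operators `ρ(w) X_1` and `ρ(w) Y_1` are again of this shape
(`IsRelation.mem_posWord`). By the Euclidean algorithm (`exists_posWord`) every `x` in `ℤ^{2,++}` is
`w (0, e)` or `w (e, 0)` for a positive word `w`; the second case is reduced to the first, since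
`ρ₁⁻¹ ρ₂` maps `Y_1` to `Y_1 X_1 Y_1⁻¹`, which is a positive expression. It follows that `P_x` in
`H (n + 1)` acts on the image of `S N` in `S M` exactly as `P_x` in `H n` acts on `S N`
(`IsRelation.actsAs_P`). Hence a relation between the `P_x` in rank `n + 1` also holds in rank `n`.
For `x` in `ℤ^{2,+}` one first applies a high power of `ρ₁`, which moves the finitely many vectors
in a relation into the quadrant (`sphericalRelation`, `P_mem_sphericalRelation`).

The point that needs work is that `M` is a module over the positive subalgebra of `H (n + 1)`, and
not only over an algebra given by positive relations: `X_1` and `Y_1` are not invertible on `M`, so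
relations of `H (n + 1)` cannot be checked on `M` directly. But `M` is a quotient of a submodule of
an honest `H (n + 1)`-module (`exists_dahaModule`). Let `F` be a field of rational functions. On
`F ⊗ M` the generators `T_i` act by Demazure–Lusztig operators and the `Y_j` by multiplication with
variables; a second extension of this kind, in which `Y_1` is recovered from the cyclic rotation of
the variables, gives `V = F ⊗ (F ⊗ M)` where the `X_j` are invertible as well. Polynomials in the
variables can be evaluated on `M`, which is a partially defined map from `V` to `M`
(`exists_polyGraph`), and it respects `T_i`, `X_1` and `Y_1`. The pairs of an element of `H (n + 1)`
and an operator on `M` that are compatible with this map form the graph of a partially defined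
morphism (`exists_relation`).

That `P_x` does not depend on the word: `s = ρ₁ ρ₂⁻¹ ρ₁ = ρ₂⁻¹ ρ₁ ρ₂⁻¹`, and `s⁴` is the conjugation
by the inverse of the full twist, hence trivial on the spherical algebra. Every word is of the form
`s^a w s^b` with `w` positive (`exists_normalForm`), and if its matrix is trivial then `w` is empty
and `a + b` is divisible by four. So the stabilizer of `(0, e)`, generated by `A₁`, acts trivially
on `S ∑ Y_i^e S` (`rhoP_eq_of_act_eq`).
-/

namespace Daha

/-! ### Products of consecutive braid generators -/

section BraidGroup
variable {G : Type*} [Group G]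

/-- The product `T_0 T_1 ⋯ T_{k-1}`. -/
def asc (T : ℕ → G) : ℕ → G
  | 0 => 1
  | k + 1 => asc T k * T k

/-- The product `T_{k-1} ⋯ T_1 T_0`. -/
def cyc (T : ℕ → G) : ℕ → G
  | 0 => 1
  | k + 1 => T k * cyc T k

theorem asc_succ' (T : ℕ → G) (k : ℕ) : asc T (k + 1) = T 0 * asc (fun i => T (i + 1)) k := by
  induction k with
  | zero => simp [asc]
  | succ k ih => rw [asc, ih, asc, mul_assoc]

theorem cyc_succ' (T : ℕ → G) (k : ℕ) : cyc T (k + 1) = cyc (fun i => T (i + 1)) k * T 0 := by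
  induction k with
  | zero => simp [cyc]
  | succ k ih => rw [cyc, ih, cyc, mul_assoc]

theorem cyc_inv (T : ℕ → G) (k : ℕ) : cyc (fun i => (T i)⁻¹) k = (asc T k)⁻¹ := by
  induction k with
  | zero => simp [asc, cyc]
  | succ k ih => rw [asc, cyc, ih, mul_inv_rev]

theorem asc_inv (T : ℕ → G) (k : ℕ) : asc (fun i => (T i)⁻¹) k = (cyc T k)⁻¹ := by
  induction k with
  | zero => simp [asc, cyc]
  | succ k ih => rw [asc, cyc, ih, mul_inv_rev]

theorem commute_asc {T : ℕ → G} {g : G} {k : ℕ} (h : ∀ i < k, Commute g (T i)) :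
    Commute g (asc T k) := by
  induction k with
  | zero => exact Commute.one_right _
  | succ k ih => exact (ih fun i hi => h i (by omega)).mul_right (h k (by omega))

theorem commute_cyc {T : ℕ → G} {g : G} {k : ℕ} (h : ∀ i < k, Commute g (T i)) :
    Commute g (cyc T k) := by
  induction k with
  | zero => exact Commute.one_right _
  | succ k ih => exact (h k (by omega)).mul_right (ih fun i hi => h i (by omega))

theorem IsBraid.shift {n : ℕ} {T : ℕ → G} (h : IsBraid n T) :
    IsBraid (n - 1) (fun i => T (i + 1)) where
  braid i hi := h.braid (i + 1) (by omega)
  comm i j hij hj := h.comm (i + 1) (j + 1) (by omega) (by omega)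

theorem IsBraid.T_asc {n : ℕ} {T : ℕ → G} (h : IsBraid n T) {i k : ℕ} (hi : i + 1 < k)
    (hk : k < n) : T (i + 1) * asc T k = asc T k * T i := by
  induction k with
  | zero => omega
  | succ k ih =>
    rw [asc]
    rcases Nat.lt_or_ge (i + 1) k with h1 | h1
    · rw [← mul_assoc, ih h1 (by omega), mul_assoc, mul_assoc, (h.comm i k h1 (by omega)).eq]
    · obtain rfl : k = i + 1 := by omega
      have c : Commute (T (i + 1)) (asc T i) :=
        commute_asc fun j hj => (h.comm j (i + 1) (by omega) (by omega)).symm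
      rw [asc]
      calc T (i + 1) * (asc T i * T i * T (i + 1))
          = (T (i + 1) * asc T i) * T i * T (i + 1) := by group
        _ = asc T i * (T (i + 1) * T i * T (i + 1)) := by rw [c.eq]; group
        _ = _ := by rw [← h.braid i (by omega)]; group

theorem IsBraid.T_cyc {n : ℕ} {T : ℕ → G} (h : IsBraid n T) {i k : ℕ} (hi : i + 1 < k)
    (hk : k < n) : T i * cyc T k = cyc T k * T (i + 1) := by
  have := congrArg (·⁻¹) (h.inv.T_asc hi hk)
  simpa [asc_inv] using this.symm

theorem IsBraid.asc_shift_mul {n : ℕ} {T : ℕ → G} (h : IsBraid n T) {k : ℕ} (hk : k + 1 < n) :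
    asc (fun i => T (i + 1)) k * asc T (k + 1) = asc T (k + 1) * asc T k := by
  have : ∀ j ≤ k, asc (fun i => T (i + 1)) j * asc T (k + 1) = asc T (k + 1) * asc T j := by
    intro j
    induction j with
    | zero => intro _; simp [asc]
    | succ j ih =>
      intro hj
      rw [asc, mul_assoc, h.T_asc (by omega) hk, ← mul_assoc, ih (by omega), mul_assoc]
      rfl
  exact this k le_rfl

theorem al_eq (T : ℕ → G) (k : ℕ) :
    al T k = (asc (fun i => T (i + 1)) k)⁻¹ * ((T 0)⁻¹ * (T 0)⁻¹) *
      asc (fun i => T (i + 1)) k := by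
  induction k with
  | zero => simp [al, asc]
  | succ k ih => rw [al, ih, asc]; group

/-- The product of the elements `al` is the inverse of a Jucys–Murphy element. -/
theorem IsBraid.bigA_eq {n : ℕ} {T : ℕ → G} (h : IsBraid n T) {k : ℕ} (hk : k < n) :
    bigA T k = (asc T k * cyc T k)⁻¹ := by
  induction k with
  | zero => simp [bigA, asc, cyc]
  | succ k ih =>
    rw [bigA, ih (by omega), al_eq, asc, cyc]
    have e : T 0 * (asc (fun i => T (i + 1)) k * asc T k) =
        asc (fun i => T (i + 1)) k * asc T k * T k := by
      have := h.asc_shift_mul hk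
      rw [mul_assoc, ← asc, this, ← mul_assoc, ← asc_succ']
    have e2 : T 0 * T 0 * (asc (fun i => T (i + 1)) k * asc T k) =
        asc (fun i => T (i + 1)) k * asc T k * (T k * T k) := by
      rw [mul_assoc, e, ← mul_assoc, e, mul_assoc]
    generalize asc (fun i => T (i + 1)) k = y at *
    generalize asc T k = x at *
    generalize cyc T k = x' at *
    generalize T 0 = t at *
    generalize T k = u at *
    have e3 : u * u = (y * x)⁻¹ * (t * t) * (y * x) := by
      rw [mul_assoc, e2]; group
    calc (x * x')⁻¹ * (y⁻¹ * (t⁻¹ * t⁻¹) * y)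
        = x'⁻¹ * ((y * x)⁻¹ * (t * t) * (y * x))⁻¹ * x⁻¹ := by group
      _ = _ := by rw [← e3]; group

theorem IsBraid.bigA_comm {n : ℕ} {T : ℕ → G} (h : IsBraid n T) {i : ℕ} (hi : i + 2 < n) :
    Commute (bigA T (n - 1)) (T (i + 1)) := by
  rw [h.bigA_eq (by omega)]
  refine Commute.inv_left ?_
  show _ = _
  rw [mul_assoc, ← h.T_cyc (by omega) (by omega), ← mul_assoc, ← h.T_asc (by omega) (by omega),
    mul_assoc]

/-- If `b = (T_0 ⋯ T_{n-2}) p`, the relations between `b` and the `T_i` are relations between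
`p` and the `T_i`. -/
theorem IsBraid.rotation_iff {n : ℕ} {T : ℕ → G} (h : IsBraid n T) {b p : G}
    (hb : b = asc T (n - 1) * p) :
    ((∀ i, 1 ≤ i → i + 1 < n → Commute (T i) b) ∧
      (1 < n → b * (T 0)⁻¹ * b * (T 0)⁻¹ = (T 0)⁻¹ * b * (T 0)⁻¹ * b)) ↔
    ((∀ i, i + 2 < n → p * T (i + 1) = T i * p) ∧ (1 < n → p * p * T 0 = T (n - 2) * (p * p))) := by
  have hc : (∀ i, 1 ≤ i → i + 1 < n → Commute (T i) b) ↔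
      (∀ i, i + 2 < n → p * T (i + 1) = T i * p) := by
    constructor
    · intro hT i hi
      have c := (hT (i + 1) (by omega) (by omega)).eq
      rw [hb, ← mul_assoc, h.T_asc (by omega) (by omega), mul_assoc, mul_assoc] at c
      exact (mul_left_cancel c).symm
    · intro hT i h1 hi
      obtain ⟨i, rfl⟩ : ∃ j, i = j + 1 := ⟨i - 1, by omega⟩
      show _ = _
      rw [hb, ← mul_assoc, h.T_asc (by omega) (by omega), mul_assoc, mul_assoc, hT i (by omega)]
  rw [hc]
  refine and_congr_right fun hT => ?_
  refine imp_congr_right fun hn => ?_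
  have hT := hc.2 hT
  obtain ⟨k, rfl⟩ : ∃ k, n = k + 2 := ⟨n - 2, by omega⟩
  have e1 := h.asc_shift_mul (k := k) (by omega)
  have e2 : asc T (k + 1) = T 0 * asc (fun i => T (i + 1)) k := asc_succ' T k
  have e3 : asc T (k + 1) = asc T k * T k := rfl
  have c : Commute (asc (fun i => T (i + 1)) k) b :=
    (commute_asc fun i hi => (hT (i + 1) (by omega) (by omega)).symm).symm
  have hb' : p = (asc T (k + 1))⁻¹ * b := by rw [hb]; simp
  simp only [show k + 2 - 2 = k by omega]
  generalize asc (fun i => T (i + 1)) k = d at *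
  rw [hb']
  generalize asc T (k + 1) = g at *
  generalize asc T k = e at *
  clear hT hc hb'
  generalize T k = u at *
  generalize T 0 = t at *
  subst e3
  have hd : d⁻¹ * t⁻¹ = u⁻¹ * e⁻¹ := by rw [← mul_inv_rev, ← mul_inv_rev, e2]
  have l1 : (e * u)⁻¹ * b * ((e * u)⁻¹ * b) = (e * u)⁻¹ * d⁻¹ * (b * t⁻¹ * b) := by
    calc (e * u)⁻¹ * b * ((e * u)⁻¹ * b) = (e * u)⁻¹ * b * (u⁻¹ * e⁻¹) * b := by group
      _ = (e * u)⁻¹ * (b * d⁻¹) * t⁻¹ * b := by rw [← hd]; group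
      _ = _ := by rw [← c.inv_left.eq]; group
  have l2 : u * ((e * u)⁻¹ * d⁻¹) = (e * u)⁻¹ * d⁻¹ * t := by
    have e4 : d * (e * u) = t * d * e := by rw [e1, e2]
    calc u * ((e * u)⁻¹ * d⁻¹) = (t⁻¹ * (t * d * e))⁻¹ := by group
      _ = _ := by rw [← e4]; group
  rw [l1, ← mul_assoc u, l2]
  constructor
  · intro hQ
    have : b * t⁻¹ * b * t = t * (b * t⁻¹ * b) := by
      calc b * t⁻¹ * b * t = t * (t⁻¹ * b * t⁻¹ * b) * t := by group
        _ = _ := by rw [← hQ]; group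
    rw [mul_assoc, this]; group
  · intro hQ
    have : b * t⁻¹ * b * t = t * (b * t⁻¹ * b) := by
      rw [mul_assoc ((e * u)⁻¹ * d⁻¹), mul_assoc ((e * u)⁻¹ * d⁻¹)] at hQ
      exact mul_left_cancel hQ
    calc b * t⁻¹ * b * t⁻¹ = t⁻¹ * (t * (b * t⁻¹ * b)) * t⁻¹ := by group
      _ = _ := by rw [← this]; group

end BraidGroup

/-! ### Affine families and positive relations in a ring -/

section PositivePart
variable {R : Type*} [Ring R]

/-- The element `T_{k-1} ⋯ T_0 a T_0 ⋯ T_{k-1}`, for `a` in a ring and invertible `T_i`. -/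
def affM (T : ℕ → Rˣ) (a : R) (k : ℕ) : R := ↑(cyc T k) * a * ↑(asc T k)

theorem affM_zero (T : ℕ → Rˣ) (a : R) : affM T a 0 = a := by simp [affM, cyc, asc]

theorem affM_succ (T : ℕ → Rˣ) (a : R) (k : ℕ) : affM T a (k + 1) = T k * affM T a k * T k := by
  simp [affM, cyc, asc, mul_assoc]

theorem coe_affX (T : ℕ → Rˣ) (a : Rˣ) (k : ℕ) : ((affX T a k : Rˣ) : R) = affM T a k := by
  induction k with
  | zero => simp [affX, affM_zero]
  | succ k ih => simp [affX, affM_succ, ih]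

/-- Relations of the affine Hecke algebra (without the quadratic one) between invertible elements
`T_i` and elements `x_j` that need not be invertible. -/
structure AffRel (n : ℕ) (T : ℕ → Rˣ) (x : ℕ → R) : Prop where
  br : IsBraid n T
  xx : ∀ i j, Commute (x i) (x j)
  TxT : ∀ i, i + 1 < n → T i * x i * T i = x (i + 1)
  Tx : ∀ i j, i + 1 < n → j ≠ i → j ≠ i + 1 → Commute (T i : R) (x j)

/-- The family `affM T a`, cut off after `n` terms: the relations only concern the first `n` terms,
and the cut-off makes all terms commute. -/
def affCut (n : ℕ) (T : ℕ → Rˣ) (a : R) (k : ℕ) : R := if k < n then affM T a k else 0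

/-- The ring version of `affX_commT`, where `a` need not be invertible. -/
theorem affM_commT {n : ℕ} {T : ℕ → Rˣ} (h : IsBraid n T) {a : R}
    (ha : ∀ i, 1 ≤ i → i + 1 < n → Commute (T i : R) a) (i k : ℕ) (hi : i + 1 < n) (hk : k < n)
    (h1 : k ≠ i) (h2 : k ≠ i + 1) : Commute (T i : R) (affM T a k) := by
  have hc : ∀ {g g' : Rˣ}, Commute g g' → Commute (g : R) (g' : R) := fun e => e.units_val
  rcases Nat.lt_or_ge k i with hlt | hge
  · have c1 : Commute (T i) (cyc T k) :=
      commute_cyc fun j hj => (h.comm j i (by omega) (by omega)).symm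
    have c2 : Commute (T i) (asc T k) :=
      commute_asc fun j hj => (h.comm j i (by omega) (by omega)).symm
    exact ((hc c1).mul_right (ha i (by omega) hi)).mul_right (hc c2)
  · have e1 := congrArg Units.val (h.T_cyc (i := i) (k := k) (by omega) hk)
    have e2 := congrArg Units.val (h.T_asc (i := i) (k := k) (by omega) hk)
    rcases Nat.lt_or_ge (i + 2) n with hn | hn
    · have c := ha (i + 1) (by omega) (by omega)
      simp only [Units.val_mul] at e1 e2
      show _ = _
      unfold affM
      generalize (↑(cyc T k) : R) = y at *
      generalize (↑(asc T k) : R) = w at *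
      calc ↑(T i) * (y * a * w) = ↑(T i) * y * a * w := by simp only [mul_assoc]
        _ = y * (↑(T (i + 1)) * a) * w := by rw [e1]; simp only [mul_assoc]
        _ = y * a * (↑(T (i + 1)) * w) := by rw [c.eq]; simp only [mul_assoc]
        _ = _ := by rw [e2]; simp only [mul_assoc]
    · omega

/-- The ring version of `affX_comm`, where `a` need not be invertible. -/
theorem affM_comm {n : ℕ} {T : ℕ → Rˣ} (h : IsBraid n T) {a : R}
    (ha : ∀ i, 1 ≤ i → i + 1 < n → Commute (T i : R) a)
    (h4 : 1 < n → a * T 0 * a * T 0 = T 0 * a * T 0 * a) (i j : ℕ) (hi : i < n) (hj : j < n) :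
    Commute (affM T a i) (affM T a j) := by
  have h0 : ∀ k, 1 ≤ k → k < n → Commute a (affM T a k) := by
    intro k hk
    induction k, hk using Nat.le_induction with
    | base =>
      intro hn
      show _ = _
      simpa [affM_succ, affM_zero, mul_assoc] using h4 hn
    | succ k hk ih =>
      intro hn
      have c := (ha k hk hn).symm
      rw [affM_succ]
      exact (c.mul_right (ih (by omega))).mul_right c
  have key : ∀ i j, i < j → j < n → Commute (affM T a i) (affM T a j) := by
    intro i
    induction i with
    | zero => intro j h1 h2; rw [affM_zero]; exact h0 j h1 h2
    | succ i ih =>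
      intro j h1 h2
      have c := affM_commT h ha i j (by omega) h2 (by omega) (by omega)
      rw [affM_succ]
      exact (c.mul_left (ih j (by omega) h2)).mul_left c
  rcases lt_trichotomy i j with hl | rfl | hl
  · exact key i j hl hj
  · exact Commute.refl _
  · exact (key j i hl hi).symm

theorem affRel_affCut {n : ℕ} {T : ℕ → Rˣ} (h : IsBraid n T) {a : R}
    (ha : ∀ i, 1 ≤ i → i + 1 < n → Commute (T i : R) a)
    (h4 : 1 < n → a * T 0 * a * T 0 = T 0 * a * T 0 * a) : AffRel n T (affCut n T a) where
  br := h
  xx i j := by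
    unfold affCut
    split_ifs with h1 h2
    · exact affM_comm h ha h4 i j h1 h2
    · exact Commute.zero_right _
    · exact Commute.zero_left _
    · exact Commute.zero_left _
  TxT i hi := by
    unfold affCut
    rw [if_pos hi, if_pos (by omega), affM_succ]
  Tx i j hi h1 h2 := by
    unfold affCut
    split_ifs with hj
    · exact affM_commT h ha i j hi hj h1 h2
    · exact Commute.zero_right _

/-- The relations between the `T_i`, `a = X_1` and `b = Y_1` that do not contain inverses of
`a` and `b`. Here `a` and `b` need not be invertible. -/
structure PosCore (n : ℕ) (z : R) (T : ℕ → Rˣ) (a b : R) : Prop where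
  br : IsBraid n T
  Ta : ∀ i, 1 ≤ i → i + 1 < n → Commute (T i : R) a
  Tb : ∀ i, 1 ≤ i → i + 1 < n → Commute (T i : R) b
  a4 : 1 < n → a * T 0 * a * T 0 = T 0 * a * T 0 * a
  b4 : 1 < n → b * ↑(T 0)⁻¹ * b * ↑(T 0)⁻¹ = ↑(T 0)⁻¹ * b * ↑(T 0)⁻¹ * b
  ab : 1 < n → b * (T 0 * a * T 0) = T 0 * a * ↑(T 0)⁻¹ * b
  A : 0 < n → ↑(bigA T (n - 1)) * b * a = z * (a * b)

theorem Core.posCore {n : ℕ} {z : Rˣ} {T : ℕ → Rˣ} {a b : Rˣ} (h : Core n z T a b) :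
    PosCore n (z : R) T (a : R) (b : R) where
  br := h.br
  Ta i h1 h2 := (h.Ta i h1 h2).units_val
  Tb i h1 h2 := (h.Tb i h1 h2).units_val
  a4 hn := congrArg Units.val (h.a4 hn)
  b4 hn := congrArg Units.val (h.b4 hn)
  ab hn := by
    have := congrArg Units.val ((ab_iff _ _ _).1 (h.ab hn))
    simpa [mul_assoc] using this
  A hn := congrArg Units.val (h.A hn)

/-- The element `p` with `b = T_0 ⋯ T_{n-2} p`; it permutes the `T_i` and the `X_j` cyclically. -/
def rot (n : ℕ) (T : ℕ → Rˣ) (b : R) : R := ↑(asc T (n - 1))⁻¹ * b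

theorem asc_mul_rot (n : ℕ) (T : ℕ → Rˣ) (b : R) : ↑(asc T (n - 1)) * rot n T b = b := by
  simp [rot]

theorem PosCore.rot_T {n : ℕ} {z : R} {T : ℕ → Rˣ} {a b : R} (h : PosCore n z T a b) {i : ℕ}
    (hi : i + 2 < n) : rot n T b * T (i + 1) = T i * rot n T b := by
  have c := (h.Tb (i + 1) (by omega) (by omega)).eq
  have e := congrArg Units.val (h.br.T_asc (i := i) (k := n - 1) (by omega) (by omega))
  have e' : (↑(asc T (n - 1))⁻¹ : R) * T (i + 1) = T i * ↑(asc T (n - 1))⁻¹ := by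
    rw [← Units.val_mul, ← Units.val_mul]
    congr 1
    rw [inv_mul_eq_iff_eq_mul, ← mul_assoc, eq_mul_inv_iff_mul_eq]
    exact Units.ext e
  rw [rot, mul_assoc, ← c, ← mul_assoc, e', mul_assoc]

theorem PosCore.rot_X_succ {n : ℕ} {z : R} {T : ℕ → Rˣ} {a b : R} (h : PosCore n z T a b) {i : ℕ}
    (hi : i + 1 < n) : rot n T b * affM T a (i + 1) = affM T a i * rot n T b := by
  induction i with
  | zero =>
    have e := h.ab hi
    rw [affM_succ, affM_zero]
    obtain ⟨k, rfl⟩ : ∃ k, n = k + 2 := ⟨n - 2, by omega⟩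
    have hasc : asc T (k + 1) = T 0 * asc (fun i => T (i + 1)) k := asc_succ' T k
    have c : Commute (↑(asc (fun i => T (i + 1)) k)⁻¹ : R) a := by
      have : ∀ j ≤ k, Commute ↑(asc (fun i => T (i + 1)) j) a := by
        intro j
        induction j with
        | zero => intro _; simp [asc]
        | succ j ih =>
          intro hj
          rw [asc, Units.val_mul]
          exact (ih (by omega)).mul_left (h.Ta (j + 1) (by omega) (by omega))
      exact (this k le_rfl).units_inv_left
    unfold rot
    rw [show k + 2 - 1 = k + 1 by omega, mul_assoc, e, hasc, mul_inv_rev, Units.val_mul]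
    calc (↑(asc (fun i => T (i + 1)) k)⁻¹ : R) * ↑(T 0)⁻¹ * (T 0 * a * ↑(T 0)⁻¹ * b)
        = ↑(asc (fun i => T (i + 1)) k)⁻¹ * (↑(T 0)⁻¹ * T 0) * a * ↑(T 0)⁻¹ * b := by
          simp only [mul_assoc]
      _ = _ := by rw [Units.inv_mul, mul_one, c.eq]; simp only [mul_assoc]
  | succ i ih =>
    rw [affM_succ T a (i + 1)]
    calc rot n T b * (T (i + 1) * affM T a (i + 1) * T (i + 1))
        = (rot n T b * T (i + 1)) * affM T a (i + 1) * T (i + 1) := by simp only [mul_assoc]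
      _ = T i * (rot n T b * affM T a (i + 1)) * T (i + 1) := by
          rw [h.rot_T (by omega)]; simp only [mul_assoc]
      _ = T i * affM T a i * (rot n T b * T (i + 1)) := by
          rw [ih (by omega)]; simp only [mul_assoc]
      _ = _ := by rw [h.rot_T (by omega), affM_succ]; simp only [mul_assoc]

theorem PosCore.b_mul_a {n : ℕ} {z : R} {T : ℕ → Rˣ} {a b : R} (hz : ∀ g, Commute z g)
    (h : PosCore n z T a b) (hn : 0 < n) :
    b * a = z * (↑(asc T (n - 1)) * cyc T (n - 1) * a * b) := by
  have e := h.A hn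
  rw [h.br.bigA_eq (by omega)] at e
  have := congrArg (fun y => ((asc T (n - 1) * cyc T (n - 1) : Rˣ) : R) * y) e
  simp only [mul_assoc, Units.mul_inv_cancel_left] at this
  rw [this, ← mul_assoc, ← (hz _).eq]
  simp only [Units.val_mul, mul_assoc]

theorem PosCore.rot_X_zero {n : ℕ} {z : R} {T : ℕ → Rˣ} {a b : R} (hz : ∀ g, Commute z g)
    (h : PosCore n z T a b) (hn : 0 < n) :
    rot n T b * a = z * (affM T a (n - 1) * rot n T b) := by
  unfold rot affM
  rw [mul_assoc, h.b_mul_a hz hn, ← mul_assoc, ← (hz _).eq]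
  simp only [mul_assoc, Units.mul_inv_cancel_left, Units.inv_mul_cancel_left]

/-- Invertible `T_i` and `a` together with a cyclic rotation `p` give the positive relations. -/
theorem posCore_of_rot {n : ℕ} {z : Rˣ} {T : ℕ → Rˣ} {a p : Rˣ} (hz : ∀ g, Commute z g)
    (br : IsBraid n T) (Ta : ∀ i, 1 ≤ i → i + 1 < n → Commute (T i) a)
    (a4 : 1 < n → a * T 0 * a * T 0 = T 0 * a * T 0 * a)
    (pT : ∀ i, i + 2 < n → p * T (i + 1) = T i * p)
    (ppT : 1 < n → p * p * T 0 = T (n - 2) * (p * p))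
    (pX : 1 < n → p * (T 0 * a * T 0) = a * p)
    (pX0 : p * a = z * (affX T a (n - 1) * p)) :
    Core n z T a (asc T (n - 1) * p) := by
  obtain ⟨Tb, b4⟩ := (br.rotation_iff rfl).2 ⟨pT, ppT⟩
  refine ⟨br, hz, Ta, Tb, a4, b4, fun hn => ?_, fun hn => ?_⟩
  · rw [ab_iff]
    obtain ⟨k, rfl⟩ : ∃ k, n = k + 2 := ⟨n - 2, by omega⟩
    have hasc : asc T (k + 1) = T 0 * asc (fun i => T (i + 1)) k := asc_succ' T k
    have c : Commute a (asc (fun i => T (i + 1)) k) :=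
      commute_asc fun i hi => (Ta (i + 1) (by omega) (by omega)).symm
    rw [show k + 2 - 1 = k + 1 by omega, mul_assoc, pX hn, hasc]
    calc T 0 * asc (fun i => T (i + 1)) k * (a * p)
        = T 0 * (asc (fun i => T (i + 1)) k * a) * p := by group
      _ = _ := by rw [← c.eq]; group
  · rw [br.bigA_eq (by omega), mul_assoc, mul_assoc, pX0]
    have : affX T a (n - 1) = cyc T (n - 1) * a * asc T (n - 1) := by
      generalize n - 1 = k
      induction k with
      | zero => simp [affX, cyc, asc]
      | succ k ih => rw [affX, ih, cyc, asc]; group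
    rw [this]
    generalize asc T (n - 1) = g
    generalize cyc T (n - 1) = g'
    calc (g * g')⁻¹ * (g * (z * (g' * a * g * p)))
        = (g * g')⁻¹ * ((g * z) * (g' * a * g * p)) := by group
      _ = (g * g')⁻¹ * z * (g * g' * a * g * p) := by rw [← (hz g).eq]; group
      _ = _ := by rw [← (hz _).eq]; group

end PositivePart

/-! ### Demazure–Lusztig operators -/

section DemazureLusztig
open TensorProduct

/-- The braid relation for operators of the form `s_i t_i + h D_i`, with `D_i` divided difference
operators and `t_i` satisfying the Hecke relations. -/
theorem braid_of_dem {k E : Type*} [CommRing k] [Ring E] [Algebra k E] (h : k)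
    {s₁ s₂ D₁ D₂ t₁ t₂ : E}
    (c11 : t₁ * s₁ = s₁ * t₁) (c12 : t₁ * s₂ = s₂ * t₁) (c21 : t₂ * s₁ = s₁ * t₂)
    (c22 : t₂ * s₂ = s₂ * t₂) (d11 : t₁ * D₁ = D₁ * t₁) (d12 : t₁ * D₂ = D₂ * t₁)
    (d21 : t₂ * D₁ = D₁ * t₂) (d22 : t₂ * D₂ = D₂ * t₂)
    (q₁ : t₁ * t₁ = h • t₁ + 1) (q₂ : t₂ * t₂ = h • t₂ + 1)
    (bt : t₁ * t₂ * t₁ = t₂ * t₁ * t₂) (bs : s₁ * s₂ * s₁ = s₂ * s₁ * s₂)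
    (e1 : D₁ * s₂ * s₁ = s₂ * s₁ * D₂) (e2 : s₁ * s₂ * D₁ = D₂ * s₁ * s₂)
    (e3 : s₁ * D₂ * s₁ = s₂ * D₁ * s₂)
    (e4 : D₂ * s₁ * D₂ = s₁ * D₂ * s₁ + D₁ * D₂ * s₁ + s₁ * D₂ * D₁)
    (e5 : D₁ * s₂ * D₁ = s₂ * D₁ * s₂ + D₂ * D₁ * s₂ + s₂ * D₁ * D₂)
    (e6 : D₁ * D₂ * D₁ = D₂ * D₁ * D₂) :
    (s₁ * t₁ + h • D₁) * (s₂ * t₂ + h • D₂) * (s₁ * t₁ + h • D₁) =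
      (s₂ * t₂ + h • D₂) * (s₁ * t₁ + h • D₁) * (s₂ * t₂ + h • D₂) := by
  have expand : ∀ {s₁ s₂ D₁ D₂ t₁ t₂ : E}, t₁ * s₁ = s₁ * t₁ → t₁ * s₂ = s₂ * t₁ →
      t₂ * s₁ = s₁ * t₂ → t₁ * D₁ = D₁ * t₁ → t₁ * D₂ = D₂ * t₁ → t₂ * D₁ = D₁ * t₂ →
      t₁ * t₁ = h • t₁ + 1 →
      (s₁ * t₁ + h • D₁) * (s₂ * t₂ + h • D₂) * (s₁ * t₁ + h • D₁) =
      s₁ * s₂ * s₁ * (t₁ * t₂ * t₁) + h • (D₁ * s₂ * s₁ * (t₂ * t₁)) + h • (s₁ * D₂ * s₁)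
        + h • (s₁ * s₂ * D₁ * (t₁ * t₂))
        + h ^ 2 • ((s₁ * D₂ * s₁ + D₁ * D₂ * s₁ + s₁ * D₂ * D₁) * t₁) + h ^ 2 • (D₁ * s₂ * D₁ * t₂)
        + h ^ 3 • (D₁ * D₂ * D₁) := by
    intro s₁ s₂ D₁ D₂ t₁ t₂ c11 c12 c21 d11 d12 d21 q₁
    have L : ∀ {x y : E}, x * y = y * x → ∀ u, x * (y * u) = y * (x * u) := by
      intro x y e u; rw [← mul_assoc, e, mul_assoc]
    have q : s₁ * D₂ * s₁ * (t₁ * t₁) = h • (s₁ * D₂ * s₁ * t₁) + s₁ * D₂ * s₁ := by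
      rw [q₁, mul_add, mul_one, mul_smul_comm]
    have q' : s₁ * (D₂ * (s₁ * (t₁ * t₁))) = h • (s₁ * (D₂ * (s₁ * t₁))) + s₁ * (D₂ * s₁) := by
      simpa only [mul_assoc] using q
    simp only [mul_add, add_mul, smul_mul_assoc, mul_smul_comm, smul_smul, mul_assoc,
      d11, d12, d21, L c11, L c12, L c21, L d11, q', smul_add]
    module
  -- both sides are expanded by the same formula, with the two indices exchanged
  rw [expand c11 c12 c21 d11 d12 d21 q₁, expand c22 c21 c12 d22 d21 d12 q₂, bt, bs, e3, e6, e5,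
    e4, e3, ← e1, e2]
  have e8 : D₂ * s₁ * s₂ = s₁ * s₂ * D₁ := e2.symm
  rw [e8]
  module

/-- The quadratic relation for operators of the form `s t + h D`. -/
theorem quad_of_dem {k E : Type*} [CommRing k] [Ring E] [Algebra k E] (h : k)
    {s D t : E} (c : t * s = s * t) (d : t * D = D * t) (qt : t * t = h • t + 1)
    (ss : s * s = 1) (DD : D * D = D) (sD : s * D + D * s = s - 1) :
    (s * t + h • D) * (s * t + h • D) = h • (s * t + h • D) + 1 := by
  have L : ∀ {x y : E}, x * y = y * x → ∀ u, x * (y * u) = y * (x * u) := by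
    intro x y e u; rw [← mul_assoc, e, mul_assoc]
  have e : (s * t + h • D) * (s * t + h • D) =
      s * s * (t * t) + h • ((s * D + D * s) * t) + h ^ 2 • (D * D) := by
    simp only [mul_add, add_mul, smul_mul_assoc, mul_smul_comm, mul_assoc, d, L c]
    module
  rw [e, qt, ss, DD, sD, sub_mul, one_mul, one_mul]
  module

variable {k : Type*} [Field k] {F : Type*} [Field F] [Algebra k F]

/-- A field with elements `x_j` and automorphisms `s_i` that exchange `x_i` and `x_{i+1}`. -/
structure SymField (x : ℕ → F) (s : ℕ → F ≃ₐ[k] F) : Prop where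
  inj : Function.Injective x
  ne : ∀ j, x j ≠ 0
  s_lo : ∀ i, s i (x i) = x (i + 1)
  s_hi : ∀ i, s i (x (i + 1)) = x i
  s_ne : ∀ i j, j ≠ i → j ≠ i + 1 → s i (x j) = x j
  s_s : ∀ i f, s i (s i f) = f
  s_braid : ∀ i f, s i (s (i + 1) (s i f)) = s (i + 1) (s i (s (i + 1) f))
  s_comm : ∀ i j f, i + 1 < j → s i (s j f) = s j (s i f)

/-- The divided difference operator `f ↦ x_{i+1} (f - s_i f) / (x_{i+1} - x_i)`. -/
def dem (x : ℕ → F) (s : ℕ → F ≃ₐ[k] F) (i : ℕ) : Module.End k F :=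
  LinearMap.mulLeft k (x (i + 1) / (x (i + 1) - x i)) ∘ₗ (LinearMap.id - (s i).toLinearMap)

/-- The automorphism `s_i`, as a linear map. -/
def symOp (s : ℕ → F ≃ₐ[k] F) (i : ℕ) : Module.End k F := (s i).toLinearMap

/-- Multiplication by `x_j`, as a linear map. -/
def mulX (x : ℕ → F) (j : ℕ) : Module.End k F := LinearMap.mulLeft k (x j)

theorem dem_apply (x : ℕ → F) (s : ℕ → F ≃ₐ[k] F) (i : ℕ) (f : F) :
    dem x s i f = x (i + 1) / (x (i + 1) - x i) * (f - s i f) := rfl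

theorem symOp_apply (s : ℕ → F ≃ₐ[k] F) (i : ℕ) (f : F) : symOp s i f = s i f := rfl

theorem mulX_apply (x : ℕ → F) (j : ℕ) (f : F) : mulX (k := k) x j f = x j * f := rfl

variable {x : ℕ → F} {s : ℕ → F ≃ₐ[k] F}

theorem SymField.sub_ne (H : SymField x s) {i j : ℕ} (h : i ≠ j) : x i - x j ≠ 0 :=
  sub_ne_zero.2 fun e => h (H.inj e)

theorem SymField.dem_dem (H : SymField x s) (i : ℕ) : dem x s i * dem x s i = dem x s i := by
  ext f
  have h1 := H.sub_ne (show i + 1 ≠ i by omega)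
  have h2 := H.sub_ne (show i ≠ i + 1 by omega)
  simp only [Module.End.mul_apply, dem_apply, map_mul, map_sub, map_div₀, H.s_lo, H.s_hi, H.s_s]
  field_simp
  ring

theorem SymField.sym_sym (H : SymField x s) (i : ℕ) : symOp s i * symOp s i = 1 := by
  ext f
  exact H.s_s i f

theorem SymField.sym_dem (H : SymField x s) (i : ℕ) :
    symOp s i * dem x s i + dem x s i * symOp s i = symOp s i - 1 := by
  ext f
  have h1 := H.sub_ne (show i + 1 ≠ i by omega)
  have h2 := H.sub_ne (show i ≠ i + 1 by omega)
  simp only [Module.End.mul_apply, LinearMap.add_apply, LinearMap.sub_apply, Module.End.one_apply,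
    symOp_apply, dem_apply, map_mul, map_sub, map_div₀, H.s_lo, H.s_hi, H.s_s]
  rw [← neg_sub (x (i + 1)) (x i)]
  field_simp
  ring

theorem SymField.dem_braid (H : SymField x s) (i : ℕ) :
    symOp s i * symOp s (i + 1) * symOp s i = symOp s (i + 1) * symOp s i * symOp s (i + 1) ∧
    dem x s i * symOp s (i + 1) * symOp s i = symOp s (i + 1) * symOp s i * dem x s (i + 1) ∧
    symOp s i * symOp s (i + 1) * dem x s i = dem x s (i + 1) * symOp s i * symOp s (i + 1) ∧
    symOp s i * dem x s (i + 1) * symOp s i = symOp s (i + 1) * dem x s i * symOp s (i + 1) ∧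
    dem x s (i + 1) * symOp s i * dem x s (i + 1) = symOp s i * dem x s (i + 1) * symOp s i +
      dem x s i * dem x s (i + 1) * symOp s i + symOp s i * dem x s (i + 1) * dem x s i ∧
    dem x s i * symOp s (i + 1) * dem x s i = symOp s (i + 1) * dem x s i * symOp s (i + 1) +
      dem x s (i + 1) * dem x s i * symOp s (i + 1) +
      symOp s (i + 1) * dem x s i * dem x s (i + 1) ∧
    dem x s i * dem x s (i + 1) * dem x s i = dem x s (i + 1) * dem x s i * dem x s (i + 1) := by
  have h1 := H.sub_ne (show i + 1 ≠ i by omega)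
  have h2 := H.sub_ne (show i ≠ i + 1 by omega)
  have h3 := H.sub_ne (show i + 1 + 1 ≠ i by omega)
  have h4 := H.sub_ne (show i ≠ i + 1 + 1 by omega)
  have h5 := H.sub_ne (show i + 1 + 1 ≠ i + 1 by omega)
  have h6 := H.sub_ne (show i + 1 ≠ i + 1 + 1 by omega)
  have a1 := H.s_lo i
  have a2 := H.s_hi i
  have a3 := H.s_ne i (i + 1 + 1) (by omega) (by omega)
  have a4 := H.s_lo (i + 1)
  have a5 := H.s_hi (i + 1)
  have a6 := H.s_ne (i + 1) i (by omega) (by omega)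
  refine ⟨?_, ?_, ?_, ?_, ?_, ?_, ?_⟩ <;> ext f <;>
    simp only [Module.End.mul_apply, LinearMap.add_apply, symOp_apply, dem_apply, map_mul,
      map_sub, map_div₀, a1, a2, a3, a4, a5, a6, H.s_s, H.s_braid]
  all_goals
    try rw [← neg_sub (x (i + 1)) (x i)]
    try rw [← neg_sub (x (i + 1 + 1)) (x i)]
    try rw [← neg_sub (x (i + 1 + 1)) (x (i + 1))]
    try field_simp
    try ring

end DemazureLusztig

section DLModule
open TensorProduct

/-- The invertible element given by a solution of `t² = h t + 1`. -/
def unitOfQuad {k E : Type*} [CommRing k] [Ring E] [Algebra k E] (h : k) (t : E)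
    (q : t * t = h • t + 1) : Eˣ :=
  ⟨t, t - h • 1, by rw [mul_sub, q, mul_smul_comm, mul_one]; abel,
    by rw [sub_mul, q, smul_mul_assoc, one_mul]; abel⟩

theorem inv_of_quad {k E : Type*} [CommRing k] [Ring E] [Algebra k E] {h : k} {t : Eˣ}
    (q : (t : E) * t = h • (t : E) + 1) : (↑t⁻¹ : E) = t - h • 1 :=
  Units.inv_eq_of_mul_eq_one_right (by rw [mul_sub, q, mul_smul_comm, mul_one]; abel)

theorem inv_quad {k E : Type*} [CommRing k] [Ring E] [Algebra k E] {h : k} {t : Eˣ}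
    (q : (t : E) * t = h • (t : E) + 1) :
    (↑t⁻¹ : E) * ↑t⁻¹ = (-h) • (↑t⁻¹ : E) + 1 := by
  rw [inv_of_quad q, mul_sub, sub_mul, q, smul_mul_assoc, one_mul, mul_smul_comm, mul_one]
  module

theorem mul_mul_of_quad {k E : Type*} [CommRing k] [Ring E] [Algebra k E] {h : k} {t y y' : E}
    (q : t * t = h • t + 1) (e : t * y = y' * t - h • y') : t * y * t = y' := by
  rw [e, sub_mul, mul_assoc, q, mul_add, mul_one, mul_smul_comm, smul_mul_assoc]
  abel

/-- Under the quadratic relation, `t y t = y'` implies the Bernstein–Lusztig commutation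
formulas, which move `t` to the right. -/
theorem mul_of_mul_mul {k E : Type*} [CommRing k] [Ring E] [Algebra k E] {h : k} {t : Eˣ} {y y' : E}
    (q : (t : E) * t = h • (t : E) + 1) (e : t * y * t = y') :
    t * y = y' * t - h • y' ∧ t * y' = y * t + h • y' := by
  have e1 : t * y = y' * ↑t⁻¹ := by rw [← e, Units.mul_inv_cancel_right]
  have e1' : t * y = y' * t - h • y' := by
    rw [e1, inv_of_quad q, mul_sub, mul_smul_comm, mul_one]
  refine ⟨e1', ?_⟩
  have e3 : y = ↑t⁻¹ * y' * ↑t⁻¹ := by rw [← e]; simp [mul_assoc]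
  have e4 : y * t = ↑t⁻¹ * y' := by rw [e3]; simp [mul_assoc]
  rw [e4, inv_of_quad q, sub_mul, smul_mul_assoc, one_mul]
  abel

variable {k : Type*} [Field k] {F : Type*} [Field F] [Algebra k F]
  {U : Type*} [AddCommGroup U] [Module k U]
  {x : ℕ → F} {s : ℕ → F ≃ₐ[k] F}

/-- Operators on the first factor of `F ⊗ U`. -/
noncomputable def opL : Module.End k F →ₐ[k] Module.End k (F ⊗[k] U) :=
  Module.End.rTensorAlgHom k F U

/-- Operators on the second factor of `F ⊗ U`. -/
noncomputable def opR : Module.End k U →ₐ[k] Module.End k (F ⊗[k] U) :=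
  Module.End.lTensorAlgHom k U F

theorem opL_tmul (f : Module.End k F) (a : F) (u : U) : opL f (a ⊗ₜ[k] u) = f a ⊗ₜ u := rfl

theorem opR_tmul (g : Module.End k U) (a : F) (u : U) : opR g (a ⊗ₜ[k] u) = a ⊗ₜ g u := rfl

theorem opR_mul_opL (f : Module.End k F) (g : Module.End k U) : opR g * opL f = opL f * opR g :=
  TensorProduct.ext' fun _ _ => rfl

/-- The Demazure–Lusztig operator `s_i ⊗ T_i + h D_i ⊗ 1`. -/
noncomputable def dl (x : ℕ → F) (s : ℕ → F ≃ₐ[k] F) (h : k) (T : ℕ → (Module.End k U)ˣ) (i : ℕ) :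
    Module.End k (F ⊗[k] U) :=
  opL (symOp s i) * opR (T i : Module.End k U) + h • opL (dem x s i)

variable {h : k} {T : ℕ → (Module.End k U)ˣ}

theorem dl_quad (H : SymField x s) {i : ℕ}
    (q : (T i : Module.End k U) * T i = h • (T i : Module.End k U) + 1) :
    dl x s h T i * dl x s h T i = h • dl x s h T i + 1 := by
  refine quad_of_dem (E := Module.End k (F ⊗[k] U)) h (opR_mul_opL _ _) (opR_mul_opL _ _)
    ?_ ?_ ?_ ?_
  · rw [← map_mul, q, map_add, map_smul, map_one]
  · rw [← map_mul, H.sym_sym, map_one]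
  · rw [← map_mul, H.dem_dem]
  · rw [← map_mul, ← map_mul, ← map_add, H.sym_dem, map_sub, map_one]

theorem dl_braid (H : SymField x s) {i : ℕ}
    (q : ∀ i, (T i : Module.End k U) * T i = h • (T i : Module.End k U) + 1)
    (b : T i * T (i + 1) * T i = T (i + 1) * T i * T (i + 1)) :
    dl x s h T i * dl x s h T (i + 1) * dl x s h T i =
      dl x s h T (i + 1) * dl x s h T i * dl x s h T (i + 1) := by
  have q' : ∀ i, opR (F := F) (T i : Module.End k U) * opR (T i : Module.End k U) =
      h • opR (T i : Module.End k U) + 1 := by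
    intro i
    rw [← map_mul, q, map_add, map_smul, map_one]
  obtain ⟨e0, e1, e2, e3, e4, e5, e6⟩ := H.dem_braid i
  have hb := congrArg Units.val b
  simp only [Units.val_mul] at hb
  apply braid_of_dem (E := Module.End k (F ⊗[k] U)) h (opR_mul_opL _ _)
    (opR_mul_opL _ _) (opR_mul_opL _ _) (opR_mul_opL _ _) (opR_mul_opL _ _)
    (opR_mul_opL _ _) (opR_mul_opL _ _) (opR_mul_opL _ _) (q' _) (q' _)
  all_goals simp only [← map_mul, ← map_add]
  · rw [hb]
  · rw [e0]
  · rw [e1]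
  · rw [e2]
  · rw [e3]
  · rw [e4]
  · rw [e5]
  · rw [e6]

theorem dl_comm (H : SymField x s) {i j : ℕ} (hij : i + 1 < j) (c : Commute (T i) (T j)) :
    Commute (dl x s h T i) (dl x s h T j) := by
  have n1 := H.s_ne i j (by omega) (by omega)
  have n2 := H.s_ne i (j + 1) (by omega) (by omega)
  have n3 := H.s_ne j i (by omega) (by omega)
  have n4 := H.s_ne j (i + 1) (by omega) (by omega)
  have c1 : Commute (symOp s i) (symOp s j) := by
    show _ = _
    ext f; exact H.s_comm i j f hij
  have c2 : Commute (symOp s i) (dem x s j) := by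
    show _ = _
    ext f
    simp only [Module.End.mul_apply, symOp_apply, dem_apply, map_mul, map_sub, map_div₀, n1, n2,
      H.s_comm i j f hij]
  have c3 : Commute (dem x s i) (symOp s j) := by
    show _ = _
    ext f
    simp only [Module.End.mul_apply, symOp_apply, dem_apply, map_mul, map_sub, map_div₀, n3, n4,
      H.s_comm i j f hij]
  have c4 : Commute (dem x s i) (dem x s j) := by
    show _ = _
    ext f
    simp only [Module.End.mul_apply, dem_apply, map_mul, map_sub, map_div₀, n1, n2, n3, n4,
      H.s_comm i j f hij]
    ring
  have r : Commute (opR (F := F) (T i : Module.End k U)) (opR (T j : Module.End k U)) :=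
    c.units_val.map opR
  have lr : ∀ (f : Module.End k F) (g : Module.End k U), Commute (opR g) (opL f) :=
    fun f g => opR_mul_opL f g
  exact ((((c1.map opL).mul_right (lr _ _).symm).mul_left ((lr _ _).mul_right r)).add_right
    (((c2.map opL).mul_left (lr _ _)).smul_right h)).add_left
    ((((c3.map opL).mul_right (lr _ _).symm).add_right ((c4.map opL).smul_right h)).smul_left h)

theorem dl_mulX_lo (H : SymField x s) (i : ℕ) :
    dl x s h T i * opL (mulX x i) =
      opL (mulX x (i + 1)) * dl x s h T i - h • opL (mulX x (i + 1)) := by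
  have h1 := H.sub_ne (show i + 1 ≠ i by omega)
  have e1 : symOp s i * mulX x i = mulX x (i + 1) * symOp s i := by
    ext f; simp [symOp_apply, mulX_apply, H.s_lo]
  have e2 : dem x s i * mulX x i = mulX x (i + 1) * dem x s i - mulX x (i + 1) := by
    ext f
    simp only [Module.End.mul_apply, LinearMap.sub_apply, dem_apply, mulX_apply, map_mul, H.s_lo]
    field_simp
    ring
  unfold dl
  rw [add_mul, mul_assoc, opR_mul_opL, ← mul_assoc, ← map_mul, e1, smul_mul_assoc, ← map_mul, e2,
    map_sub, map_mul, map_mul, mul_add, mul_smul_comm, smul_sub, mul_assoc]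
  abel

theorem dl_mulX_hi (H : SymField x s) (i : ℕ) :
    dl x s h T i * opL (mulX x (i + 1)) =
      opL (mulX x i) * dl x s h T i + h • opL (mulX x (i + 1)) := by
  have h1 := H.sub_ne (show i + 1 ≠ i by omega)
  have e1 : symOp s i * mulX x (i + 1) = mulX x i * symOp s i := by
    ext f; simp [symOp_apply, mulX_apply, H.s_hi]
  have e2 : dem x s i * mulX x (i + 1) = mulX x i * dem x s i + mulX x (i + 1) := by
    ext f
    simp only [Module.End.mul_apply, LinearMap.add_apply, dem_apply, mulX_apply, map_mul, H.s_hi]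
    field_simp
    ring
  unfold dl
  rw [add_mul, mul_assoc, opR_mul_opL, ← mul_assoc, ← map_mul, e1, smul_mul_assoc, ← map_mul, e2,
    map_add, map_mul, map_mul, mul_add, mul_smul_comm, smul_add, mul_assoc]
  abel

theorem dl_mulX_ne (H : SymField x s) {i j : ℕ} (h1 : j ≠ i) (h2 : j ≠ i + 1) :
    Commute (dl x s h T i) (opL (mulX x j)) := by
  have e1 : Commute (symOp s i) (mulX x j) := by
    show _ = _
    ext f; simp [symOp_apply, mulX_apply, H.s_ne i j h1 h2]
  have e2 : Commute (dem x s i) (mulX x j) := by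
    show _ = _
    ext f
    simp only [Module.End.mul_apply, dem_apply, mulX_apply, map_mul, H.s_ne i j h1 h2]
    ring
  exact ((e1.map opL).mul_left (opR_mul_opL _ _)).add_left ((e2.map opL).smul_left h)

/-- The Demazure–Lusztig operators, as invertible operators. -/
noncomputable def dlUnit (H : SymField x s)
    (q : ∀ i, (T i : Module.End k U) * T i = h • (T i : Module.End k U) + 1) (i : ℕ) :
    (Module.End k (F ⊗[k] U))ˣ := unitOfQuad h (dl x s h T i) (dl_quad H (q i))

/-- `F ⊗ U` is a module over the affine Hecke algebra in which the polynomial generators act on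
`F` by multiplication; it is a localization of the module induced from `U`. -/
theorem affRel_dl {n : ℕ} (H : SymField x s)
    (q : ∀ i, (T i : Module.End k U) * T i = h • (T i : Module.End k U) + 1) (br : IsBraid n T) :
    AffRel n (dlUnit H q) (fun j => opL (U := U) (mulX (k := k) x j)) where
  br :=
    { braid i hi := Units.ext (dl_braid H q (br.braid i hi))
      comm i j hij hj := Units.ext (dl_comm H hij (br.comm i j hij hj)) }
  xx i j := by
    refine Commute.map ?_ opL
    show _ = _
    ext f
    simp only [Module.End.mul_apply, mulX_apply]
    ring
  TxT i hi := by
    show dl x s h T i * opL (mulX x i) * dl x s h T i = _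
    exact mul_mul_of_quad (dl_quad H (q i)) (dl_mulX_lo H i)
  Tx i j _ h1 h2 := dl_mulX_ne H h1 h2

theorem dl_one_tmul (i : ℕ) (u : U) :
    dl x s h T i (1 ⊗ₜ u) = 1 ⊗ₜ ((T i : Module.End k U) u) := by
  have e : dl x s h T i (1 ⊗ₜ u) = symOp s i 1 ⊗ₜ[k] ((T i : Module.End k U) u) +
      h • (dem x s i 1 ⊗ₜ[k] u) := rfl
  rw [e, dem_apply, symOp_apply, map_one, sub_self, mul_zero, TensorProduct.zero_tmul, smul_zero,
    add_zero]

end DLModule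

/-! ### Graphs of evaluation maps -/

section Graph
open TensorProduct

variable {k : Type*} [Field k] {F : Type*} [Field F] [Algebra k F]
  {U : Type*} [AddCommGroup U] [Module k U] {M : Type*} [AddCommGroup M] [Module k M]

open scoped IsMulCommutative in
/-- Commuting elements of an algebra can be substituted for the variables of polynomials. -/
theorem exists_eval {R : Type*} [Ring R] [Algebra k R] (y : ℕ → R)
    (hy : ∀ i j, Commute (y i) (y j)) :
    ∃ ev : MvPolynomial ℕ k →ₐ[k] R, ∀ j, ev (MvPolynomial.X j) = y j := by
  have := Algebra.isMulCommutative_adjoin k (s := Set.range y) (by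
    rintro _ ⟨i, rfl⟩ _ ⟨j, rfl⟩; exact hy i j)
  let y' : ℕ → Algebra.adjoin k (Set.range y) := fun j => ⟨y j, Algebra.subset_adjoin ⟨j, rfl⟩⟩
  let f : MvPolynomial ℕ k →ₐ[k] Algebra.adjoin k (Set.range y) := MvPolynomial.aeval y'
  refine ⟨(Algebra.adjoin k (Set.range y)).val.comp f, fun j => ?_⟩
  exact congrArg Subtype.val (MvPolynomial.aeval_X y' j)

/-- A subspace of `U × M` is (the graph of) a partial function. -/
def IsFunctional (Γ : Submodule k (U × M)) : Prop := ∀ m, ((0, m) : U × M) ∈ Γ → m = 0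

/-- A pair of operators preserves a subspace of `U × M`. -/
def Preserves (Γ : Submodule k (U × M)) (A : Module.End k U) (B : Module.End k M) : Prop :=
  ∀ z ∈ Γ, ((A z.1, B z.2) : U × M) ∈ Γ

theorem Preserves.mul {Γ : Submodule k (U × M)} {A A' : Module.End k U} {B B' : Module.End k M}
    (h : Preserves Γ A B) (h' : Preserves Γ A' B') : Preserves Γ (A * A') (B * B') :=
  fun z hz => h _ (h' z hz)

theorem Preserves.inv {Γ : Submodule k (U × M)} {h : k} {t : (Module.End k U)ˣ}
    {t' : (Module.End k M)ˣ} (q : (t : Module.End k U) * t = h • (t : Module.End k U) + 1)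
    (q' : (t' : Module.End k M) * t' = h • (t' : Module.End k M) + 1)
    (hp : Preserves Γ (t : Module.End k U) (t' : Module.End k M)) :
    Preserves Γ (↑t⁻¹ : Module.End k U) (↑t'⁻¹ : Module.End k M) := by
  intro z hz
  rw [inv_of_quad q, inv_of_quad q']
  exact Γ.sub_mem (hp z hz) (Γ.smul_mem h hz)

/-- A partial function `Γ` on `U` with values in a module over polynomials extends to polynomials
with coefficients in `U`. -/
theorem exists_polyGraph {x : ℕ → F} (hx : AlgebraicIndependent k x) {y : ℕ → Module.End k M}
    (hy : ∀ i j, Commute (y i) (y j)) {Γ : Submodule k (U × M)} (hΓ : IsFunctional Γ) :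
    ∃ G : Submodule k ((F ⊗[k] U) × M), IsFunctional G ∧
      (∀ z ∈ Γ, (1 ⊗ₜ z.1, z.2) ∈ G) ∧ (∀ j, Preserves G (opL (mulX x j)) (y j)) ∧
      ∀ G' : Submodule k ((F ⊗[k] U) × M), (∀ z ∈ Γ, (1 ⊗ₜ z.1, z.2) ∈ G') →
        (∀ j, Preserves G' (opL (mulX x j)) (y j)) → G ≤ G' := by
  obtain ⟨ev, hev⟩ := exists_eval (k := k) y hy
  obtain ⟨φ₁, h1, hinj⟩ : ∃ φ₁ : MvPolynomial ℕ k ⊗[k] Γ →ₗ[k] F ⊗[k] U,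
      (∀ f g, φ₁ (f ⊗ₜ g) = MvPolynomial.aeval x f ⊗ₜ g.1.1) ∧ Function.Injective φ₁ := by
    refine ⟨TensorProduct.map (MvPolynomial.aeval x).toLinearMap
      (LinearMap.fst k U M ∘ₗ Γ.subtype), fun f g => rfl, ?_⟩
    -- algebraic independence: polynomials embed into `F`
    refine TensorProduct.map_injective_of_flat_flat _ _ hx ?_
    rw [← LinearMap.ker_eq_bot, LinearMap.ker_eq_bot']
    rintro ⟨⟨u, m⟩, hz⟩ (rfl : u = 0)
    have := hΓ m hz
    subst this
    rfl
  obtain ⟨φ₂, h2⟩ : ∃ φ₂ : MvPolynomial ℕ k ⊗[k] Γ →ₗ[k] M, ∀ f g, φ₂ (f ⊗ₜ g) = ev f g.1.2 :=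
    ⟨TensorProduct.lift
      ((LinearMap.lcomp k M (LinearMap.snd k U M ∘ₗ Γ.subtype)) ∘ₗ ev.toLinearMap), fun f g => rfl⟩
  refine ⟨LinearMap.range (φ₁.prod φ₂), ?_, ?_, ?_, ?_⟩
  · rintro m ⟨t, ht⟩
    have h3 : φ₁ t = 0 := congrArg Prod.fst ht
    have h4 : φ₂ t = m := congrArg Prod.snd ht
    rw [← h4, hinj (h3.trans (map_zero φ₁).symm), map_zero]
  · intro z hz
    refine ⟨1 ⊗ₜ ⟨z, hz⟩, Prod.ext ?_ ?_⟩
    · exact (h1 _ _).trans (by rw [map_one])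
    · exact (h2 _ _).trans (by rw [map_one]; rfl)
  · rintro j _ ⟨t, rfl⟩
    obtain ⟨μ, hμ⟩ : ∃ μ : MvPolynomial ℕ k ⊗[k] Γ →ₗ[k] MvPolynomial ℕ k ⊗[k] Γ,
        ∀ f g, μ (f ⊗ₜ g) = (MvPolynomial.X j * f) ⊗ₜ g :=
      ⟨LinearMap.rTensor Γ (LinearMap.mulLeft k (MvPolynomial.X j)), fun f g => rfl⟩
    have e1 : φ₁ ∘ₗ μ = opL (mulX x j) ∘ₗ φ₁ := TensorProduct.ext' fun f g => by
      rw [LinearMap.comp_apply, LinearMap.comp_apply, hμ, h1, h1, opL_tmul, map_mul,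
        MvPolynomial.aeval_X, mulX_apply]
    have e2 : φ₂ ∘ₗ μ = y j ∘ₗ φ₂ := TensorProduct.ext' fun f g => by
      rw [LinearMap.comp_apply, LinearMap.comp_apply, hμ, h2, h2, map_mul, hev,
        Module.End.mul_apply]
    exact ⟨μ t, Prod.ext (LinearMap.congr_fun e1 t) (LinearMap.congr_fun e2 t)⟩
  · rintro G' hG hG' _ ⟨t, rfl⟩
    induction t using TensorProduct.induction_on with
    | zero => rw [map_zero]; exact G'.zero_mem
    | add a b ha hb =>
      rw [map_add]
      exact G'.add_mem ha hb
    | tmul f g =>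
      rw [LinearMap.prod_apply, Function.prod_apply, h1, h2]
      induction f using MvPolynomial.induction_on with
      | C c =>
        rw [← MvPolynomial.algebraMap_eq, AlgHom.commutes, AlgHom.commutes,
          Algebra.algebraMap_eq_smul_one, Algebra.algebraMap_eq_smul_one,
          ← TensorProduct.smul_tmul']
        exact G'.smul_mem c (hG _ g.2)
      | add f f' hf hf' =>
        rw [map_add, map_add, TensorProduct.add_tmul]
        exact G'.add_mem hf hf'
      | mul_X f j hf =>
        rw [mul_comm f, map_mul, map_mul, MvPolynomial.aeval_X, hev]
        exact hG' j _ hf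

/-- A pair of operators preserves the extension of `Γ` to polynomials, if it does so on `Γ` and
if this property carries over to products with the variables. -/
theorem preserves_of_min {x : ℕ → F} {y : ℕ → Module.End k M} {Γ : Submodule k (U × M)}
    {G : Submodule k ((F ⊗[k] U) × M)} (hG : ∀ z ∈ Γ, (1 ⊗ₜ z.1, z.2) ∈ G)
    (hxy : ∀ j, Preserves G (opL (mulX x j)) (y j))
    (hmin : ∀ G' : Submodule k ((F ⊗[k] U) × M), (∀ z ∈ Γ, (1 ⊗ₜ z.1, z.2) ∈ G') →
        (∀ j, Preserves G' (opL (mulX x j)) (y j)) → G ≤ G')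
    {A : Module.End k (F ⊗[k] U)} {B : Module.End k M}
    (h1 : ∀ z ∈ Γ, (A (1 ⊗ₜ z.1), B z.2) ∈ G)
    (h2 : ∀ j, ∀ w ∈ G, (A w.1, B w.2) ∈ G → (A (opL (mulX x j) w.1), B (y j w.2)) ∈ G) :
    Preserves G A B := by
  have := hmin (G ⊓ G.comap (A.prodMap B)) (fun z hz => ⟨hG z hz, h1 z hz⟩)
    (fun j w hw => ⟨hxy j w hw.1, h2 j w hw.1 hw.2⟩)
  exact fun z hz => (this hz).2

/-- The Demazure–Lusztig operator on polynomials with coefficients in `U` corresponds to `T_i` on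
`M`, since both satisfy the same commutation formulas with the polynomial generators. -/
theorem preserves_dl {x : ℕ → F} {s : ℕ → F ≃ₐ[k] F} (H : SymField x s) {n : ℕ} {h : k}
    {y : ℕ → Module.End k M} {T : ℕ → (Module.End k U)ˣ} {T' : ℕ → (Module.End k M)ˣ}
    (q' : ∀ i, (T' i : Module.End k M) * T' i = h • (T' i : Module.End k M) + 1)
    (hT' : AffRel n T' y) {Γ : Submodule k (U × M)}
    {G : Submodule k ((F ⊗[k] U) × M)} (hG : ∀ z ∈ Γ, (1 ⊗ₜ z.1, z.2) ∈ G)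
    (hxy : ∀ j, Preserves G (opL (mulX x j)) (y j))
    (hmin : ∀ G' : Submodule k ((F ⊗[k] U) × M), (∀ z ∈ Γ, (1 ⊗ₜ z.1, z.2) ∈ G') →
        (∀ j, Preserves G' (opL (mulX x j)) (y j)) → G ≤ G')
    {i : ℕ} (hi : i + 1 < n) (hT : Preserves Γ (T i : Module.End k U) (T' i : Module.End k M)) :
    Preserves G (dl x s h T i) (T' i : Module.End k M) := by
  refine preserves_of_min hG hxy hmin (fun z hz => ?_) fun j w hw hw' => ?_
  · rw [dl_one_tmul]
    exact hG _ (hT z hz)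
  · by_cases h1 : j = i
    · subst h1
      have e1 := LinearMap.congr_fun (dl_mulX_lo (h := h) (T := T) H j) w.1
      have e2 := LinearMap.congr_fun (mul_of_mul_mul (q' j) (hT'.TxT j hi)).1 w.2
      rw [Module.End.mul_apply] at e1 e2
      rw [e1, e2]
      exact G.sub_mem (hxy _ _ hw') (G.smul_mem h (hxy _ _ hw))
    · by_cases h2 : j = i + 1
      · subst h2
        have e1 := LinearMap.congr_fun (dl_mulX_hi (h := h) (T := T) H i) w.1
        have e2 := LinearMap.congr_fun (mul_of_mul_mul (q' i) (hT'.TxT i hi)).2 w.2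
        rw [Module.End.mul_apply] at e1 e2
        rw [e1, e2]
        exact G.add_mem (hxy _ _ hw') (G.smul_mem h (hxy _ _ hw))
      · have e1 := LinearMap.congr_fun (dl_mulX_ne (h := h) (T := T) H h1 h2).eq w.1
        have e2 := LinearMap.congr_fun (hT'.Tx i j hi h1 h2).eq w.2
        rw [Module.End.mul_apply] at e1 e2
        rw [e1, e2]
        exact hxy _ _ hw'

/-- An operator which permutes the variables up to scalars, twisted by `p`, corresponds to an
operator `p'` on `M` with the same commutation relations. -/
theorem preserves_rot {x : ℕ → F} {y : ℕ → Module.End k M} {Γ : Submodule k (U × M)}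
    {G : Submodule k ((F ⊗[k] U) × M)} (hG : ∀ z ∈ Γ, (1 ⊗ₜ z.1, z.2) ∈ G)
    (hxy : ∀ j, Preserves G (opL (mulX x j)) (y j))
    (hmin : ∀ G' : Submodule k ((F ⊗[k] U) × M), (∀ z ∈ Γ, (1 ⊗ₜ z.1, z.2) ∈ G') →
        (∀ j, Preserves G' (opL (mulX x j)) (y j)) → G ≤ G')
    {P : F ≃ₐ[k] F} {c : ℕ → k} {τ : ℕ → ℕ} (hP : ∀ j, P (x j) = c j • x (τ j))
    {p : Module.End k U} {p' : Module.End k M} (hp : Preserves Γ p p')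
    (hp' : ∀ j, p' * y j = c j • (y (τ j) * p')) :
    Preserves G (opL P.toLinearMap * opR p) p' := by
  refine preserves_of_min hG hxy hmin (fun z hz => ?_) fun j w hw hw' => ?_
  · rw [Module.End.mul_apply, opR_tmul, opL_tmul]
    have : P.toLinearMap 1 = 1 := map_one P
    rw [this]
    exact hG _ (hp z hz)
  · have e : (opL P.toLinearMap * opR p : Module.End k (F ⊗[k] U)) * opL (mulX x j) =
        c j • (opL (mulX x (τ j)) * (opL P.toLinearMap * opR p)) := by
      have : P.toLinearMap * mulX x j = c j • (mulX x (τ j) * P.toLinearMap) := by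
        ext f
        show P (x j * f) = c j • (x (τ j) * P f)
        rw [map_mul, hP, smul_mul_assoc]
      rw [mul_assoc, opR_mul_opL, ← mul_assoc, ← map_mul, this, map_smul, map_mul, smul_mul_assoc,
        mul_assoc]
    have e1 := LinearMap.congr_fun e w.1
    have e2 := LinearMap.congr_fun (hp' j) w.2
    rw [Module.End.mul_apply] at e1 e2
    rw [e1, e2]
    exact G.smul_mem (c j) (hxy (τ j) _ hw')

end Graph

/-! ### The field of rational functions in infinitely many variables -/

section RationalFunctions
variable {k : Type*} [Field k]

/-- The automorphism `X_j ↦ c_j X_{τ j}` of the polynomial ring. -/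
noncomputable def polyAut (c : ℕ → kˣ) (τ : Equiv.Perm ℕ) :
    MvPolynomial ℕ k ≃ₐ[k] MvPolynomial ℕ k :=
  AlgEquiv.ofAlgHom
    (MvPolynomial.aeval fun j => (c j : k) • MvPolynomial.X (τ j))
    (MvPolynomial.aeval fun j => (↑(c (τ.symm j))⁻¹ : k) • MvPolynomial.X (τ.symm j))
    (by ext j; simp [smul_smul]) (by ext j; simp [smul_smul])

/-- The automorphism `x_j ↦ c_j x_{τ j}` of the field of rational functions. -/
noncomputable def ratAut (c : ℕ → kˣ) (τ : Equiv.Perm ℕ) :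
    FractionRing (MvPolynomial ℕ k) ≃ₐ[k] FractionRing (MvPolynomial ℕ k) :=
  IsFractionRing.algEquivOfAlgEquiv (polyAut c τ)

variable (k) in
/-- The variables, in the field of rational functions. -/
noncomputable def ratX (j : ℕ) : FractionRing (MvPolynomial ℕ k) :=
  algebraMap (MvPolynomial ℕ k) _ (MvPolynomial.X j)

theorem ratAut_X (c : ℕ → kˣ) (τ : Equiv.Perm ℕ) (j : ℕ) :
    ratAut c τ (ratX k j) = (c j : k) • ratX k (τ j) := by
  unfold ratAut ratX
  rw [IsFractionRing.algEquivOfAlgEquiv_algebraMap]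
  have : polyAut c τ (MvPolynomial.X j) = (c j : k) • MvPolynomial.X (τ j) := by
    simp [polyAut]
  rw [this, ← algebraMap_smul (MvPolynomial ℕ k), smul_eq_mul, map_mul,
    ← IsScalarTower.algebraMap_apply, Algebra.smul_def]

theorem ratX_algebraicIndependent : AlgebraicIndependent k (ratX k) := by
  have h : MvPolynomial.aeval (ratX k) =
      IsScalarTower.toAlgHom k (MvPolynomial ℕ k) (FractionRing (MvPolynomial ℕ k)) := by
    ext j
    simp [ratX]
  show Function.Injective (MvPolynomial.aeval (ratX k))
  rw [h]
  exact IsFractionRing.injective _ _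

theorem rat_ext {f g : FractionRing (MvPolynomial ℕ k) →ₐ[k] FractionRing (MvPolynomial ℕ k)}
    (h : ∀ j, f (ratX k j) = g (ratX k j)) : f = g := by
  refine IsLocalization.algHom_ext (nonZeroDivisors (MvPolynomial ℕ k)) ?_
  ext j
  exact h j

theorem rat_equiv_ext
    {e e' : FractionRing (MvPolynomial ℕ k) ≃ₐ[k] FractionRing (MvPolynomial ℕ k)}
    (h : ∀ j, e (ratX k j) = e' (ratX k j)) : e = e' := by
  have := rat_ext (f := (e : _ →ₐ[k] _)) (g := (e' : _ →ₐ[k] _)) h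
  ext f
  exact DFunLike.congr_fun this f

/-- The transposition of the variables `x_i` and `x_{i+1}`. -/
noncomputable def ratS (i : ℕ) :
    FractionRing (MvPolynomial ℕ k) ≃ₐ[k] FractionRing (MvPolynomial ℕ k) :=
  ratAut (fun _ => 1) (Equiv.swap i (i + 1))

theorem ratS_X (i j : ℕ) : ratS i (ratX k j) = ratX k (Equiv.swap i (i + 1) j) := by
  rw [ratS, ratAut_X, Units.val_one, one_smul]

theorem symField_rat : SymField (ratX k) ratS where
  inj := ratX_algebraicIndependent.injective
  ne j := ratX_algebraicIndependent.ne_zero j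
  s_lo i := by rw [ratS_X, Equiv.swap_apply_left]
  s_hi i := by rw [ratS_X, Equiv.swap_apply_right]
  s_ne i j h1 h2 := by rw [ratS_X, Equiv.swap_apply_of_ne_of_ne h1 h2]
  s_s i f := by
    have : ratS (k := k) i * ratS i = 1 := rat_equiv_ext fun j => by
      rw [AlgEquiv.mul_apply, ratS_X, ratS_X, Equiv.swap_apply_self, AlgEquiv.one_apply]
    exact DFunLike.congr_fun this f
  s_braid i f := by
    have : ratS (k := k) i * (ratS (i + 1) * ratS i) = ratS (i + 1) * (ratS i * ratS (i + 1)) :=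
      rat_equiv_ext fun j => by
        simp only [AlgEquiv.mul_apply, ratS_X]
        congr 1
        simp only [Equiv.swap_apply_def]
        grind
    exact DFunLike.congr_fun this f
  s_comm i l f hl := by
    have : ratS (k := k) i * ratS l = ratS l * ratS i := rat_equiv_ext fun j => by
      simp only [AlgEquiv.mul_apply, ratS_X]
      congr 1
      simp only [Equiv.swap_apply_def]
      grind
    exact DFunLike.congr_fun this f

/-- The cycle `0 ↦ n - 1`, `i + 1 ↦ i` on `{0, …, n - 1}`. -/
def rotPerm (n : ℕ) : Equiv.Perm ℕ where
  toFun j := if j < n then (if j = 0 then n - 1 else j - 1) else j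
  invFun j := if j < n then (if j = n - 1 then 0 else j + 1) else j
  left_inv j := by grind
  right_inv j := by grind

theorem rotPerm_apply (n j : ℕ) :
    rotPerm n j = if j < n then (if j = 0 then n - 1 else j - 1) else j := rfl

/-- The automorphism `x_0 ↦ z x_{n-1}`, `x_{i+1} ↦ x_i`. -/
noncomputable def ratP (n : ℕ) (z : kˣ) :
    FractionRing (MvPolynomial ℕ k) ≃ₐ[k] FractionRing (MvPolynomial ℕ k) :=
  ratAut (fun j => if j = 0 then z else 1) (rotPerm n)

theorem ratP_S {n i : ℕ} (hi : i + 2 < n) (z : kˣ) (f : FractionRing (MvPolynomial ℕ k)) :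
    ratP n z (ratS (i + 1) f) = ratS i (ratP n z f) := by
  have : ratP n z * ratS (i + 1) = ratS i * ratP n z := rat_equiv_ext fun j => by
    rw [AlgEquiv.mul_apply, AlgEquiv.mul_apply, ratS_X, ratP, ratAut_X, ratAut_X, map_smul, ratS_X]
    have e1 : rotPerm n (Equiv.swap (i + 1) (i + 1 + 1) j) =
        Equiv.swap i (i + 1) (rotPerm n j) := by
      simp only [Equiv.swap_apply_def, rotPerm_apply]
      grind
    have e2 : Equiv.swap (i + 1) (i + 1 + 1) j = 0 ↔ j = 0 := by
      simp only [Equiv.swap_apply_def]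
      grind
    simp only [e1, e2]
  exact DFunLike.congr_fun this f

theorem ratP_P_S {n : ℕ} (hn : 1 < n) (z : kˣ) (f : FractionRing (MvPolynomial ℕ k)) :
    ratP n z (ratP n z (ratS 0 f)) = ratS (n - 2) (ratP n z (ratP n z f)) := by
  have : ratP n z * (ratP n z * ratS 0) = ratS (n - 2) * (ratP n z * ratP n z) :=
      rat_equiv_ext fun j => by
    simp only [AlgEquiv.mul_apply]
    rw [ratS_X, ratP, ratAut_X, ratAut_X, map_smul, map_smul, ratAut_X, ratAut_X, map_smul,
      map_smul, ratS_X]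
    have e1 : rotPerm n (rotPerm n (Equiv.swap 0 (0 + 1) j)) =
        Equiv.swap (n - 2) (n - 2 + 1) (rotPerm n (rotPerm n j)) := by
      simp only [Equiv.swap_apply_def, rotPerm_apply]
      grind
    have e2 : ∀ i, i ≠ 0 → i ≠ 1 → i ≠ n → rotPerm n i ≠ 0 := by
      intro i h1 h2 h3
      simp only [rotPerm_apply]
      grind
    rw [e1, smul_smul, smul_smul]
    congr 1
    have r0 : rotPerm n 0 = n - 1 := by simp only [rotPerm_apply]; grind
    have r1 : rotPerm n 1 = 0 := by simp only [rotPerm_apply]; grind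
    rcases Nat.lt_or_ge 1 j with hj | hj
    · rw [Equiv.swap_apply_of_ne_of_ne (by omega) (by omega)]
    · have hn' : n - 1 ≠ 0 := by omega
      obtain rfl | rfl : j = 0 ∨ j = 1 := by omega
      · simp [r0, r1, hn']
      · simp [r0, r1, hn']
  exact DFunLike.congr_fun this f

end RationalFunctions

/-! ### Modules over the positive part as subquotients -/

section DahaModule
open TensorProduct

theorem AffRel.comm_four {R : Type*} [Ring R] {n : ℕ} {T : ℕ → Rˣ} {x : ℕ → R} (h : AffRel n T x)
    (hn : 1 < n) : x 0 * T 0 * x 0 * T 0 = T 0 * x 0 * T 0 * x 0 := by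
  have e := (h.xx 0 1).eq
  rw [← h.TxT 0 hn] at e
  simpa [mul_assoc] using e

theorem AffRel.affM_eq {R : Type*} [Ring R] {n : ℕ} {T : ℕ → Rˣ} {x : ℕ → R} (h : AffRel n T x)
    {j : ℕ} (hj : j < n) : affM T (x 0) j = x j := by
  induction j with
  | zero => exact affM_zero _ _
  | succ j ih => rw [affM_succ, ih (by omega), h.TxT j hj]

section Preserve
variable {k : Type*} [Field k] {U M : Type*} [AddCommGroup U] [Module k U] [AddCommGroup M]
  [Module k M] {G : Submodule k (U × M)} {T : ℕ → (Module.End k U)ˣ}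
  {T' : ℕ → (Module.End k M)ˣ} {m : ℕ}

theorem Preserves.asc
    (h : ∀ i < m, Preserves G (T i : Module.End k U) (T' i : Module.End k M)) :
    Preserves G (↑(asc T m) : Module.End k U) (↑(asc T' m) : Module.End k M) := by
  induction m with
  | zero => exact fun z hz => hz
  | succ m ih => exact (ih fun i hi => h i (by omega)).mul (h m (by omega))

theorem Preserves.cyc
    (h : ∀ i < m, Preserves G (T i : Module.End k U) (T' i : Module.End k M)) :
    Preserves G (↑(cyc T m) : Module.End k U) (↑(cyc T' m) : Module.End k M) := by
  induction m with
  | zero => exact fun z hz => hz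
  | succ m ih => exact (h m (by omega)).mul (ih fun i hi => h i (by omega))

end Preserve

section Operators
variable {k : Type*} [Field k] {F : Type*} [Field F] [Algebra k F]
  {U : Type*} [AddCommGroup U] [Module k U] {x : ℕ → F} {s : ℕ → F ≃ₐ[k] F}

/-- An automorphism of `F`, as an invertible operator. -/
def autUnit (P : F ≃ₐ[k] F) : (Module.End k F)ˣ where
  val := P.toLinearMap
  inv := P.symm.toLinearMap
  val_inv := by ext f; exact P.apply_symm_apply f
  inv_val := by ext f; exact P.symm_apply_apply f

/-- Multiplication by `x_j`, as an invertible operator. -/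
def mulXUnit (H : SymField x s) (j : ℕ) : (Module.End k F)ˣ where
  val := mulX x j
  inv := LinearMap.mulLeft k (x j)⁻¹
  val_inv := by
    ext f
    simp [mulX_apply, mul_inv_cancel_left₀ (H.ne j)]
  inv_val := by
    ext f
    simp [mulX_apply, inv_mul_cancel_left₀ (H.ne j)]

theorem aut_mul_dl {Q : F ≃ₐ[k] F} {r : Module.End k U} {h c : k} (hc : c ≠ 0)
    {T : ℕ → (Module.End k U)ˣ} {i j : ℕ} (hlo : Q (x i) = c • x j)
    (hhi : Q (x (i + 1)) = c • x (j + 1)) (hs : ∀ f, Q (s i f) = s j (Q f))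
    (hr : r * (T i : Module.End k U) = T j * r) :
    (opL Q.toLinearMap * opR r) * dl x s h T i = dl x s h T j * (opL Q.toLinearMap * opR r) := by
  have e1 : Q.toLinearMap * symOp s i = symOp s j * Q.toLinearMap := by
    ext f; exact hs f
  have e2 : Q.toLinearMap * dem x s i = dem x s j * Q.toLinearMap := by
    ext f
    show Q (x (i + 1) / (x (i + 1) - x i) * (f - s i f)) =
      x (j + 1) / (x (j + 1) - x j) * (Q f - s j (Q f))
    have hc' : algebraMap k F c ≠ 0 := by simpa using hc
    rw [map_mul, map_div₀, map_sub, map_sub, hlo, hhi, hs, ← smul_sub, Algebra.smul_def,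
      Algebra.smul_def, mul_div_mul_left _ _ hc']
  unfold dl
  rw [mul_add, add_mul, mul_smul_comm, smul_mul_assoc]
  have f1 : opL (U := U) Q.toLinearMap * opR r * (opL (symOp s i) * opR (T i : Module.End k U)) =
      opL (symOp s j) * opR (T j : Module.End k U) * (opL Q.toLinearMap * opR r) := by
    calc _ = opL Q.toLinearMap * (opR r * opL (symOp s i)) * opR (T i : Module.End k U) := by
          simp only [mul_assoc]
      _ = opL (Q.toLinearMap * symOp s i) * opR (r * (T i : Module.End k U)) := by
          rw [opR_mul_opL, map_mul, map_mul]; simp only [mul_assoc]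
      _ = opL (symOp s j) * (opL Q.toLinearMap * opR (T j : Module.End k U)) * opR r := by
          rw [e1, hr, map_mul, map_mul]; simp only [mul_assoc]
      _ = _ := by rw [← opR_mul_opL]; simp only [mul_assoc]
  have f2 : opL (U := U) Q.toLinearMap * opR r * opL (dem x s i) =
      opL (dem x s j) * (opL Q.toLinearMap * opR r) := by
    rw [mul_assoc, opR_mul_opL, ← mul_assoc, ← map_mul, e2, map_mul, mul_assoc]
  rw [f1, f2]

end Operators

section Unit
variable {k : Type*} [Field k] {F : Type*} [Field F] [Algebra k F]
  {U : Type*} [AddCommGroup U] [Module k U] {x : ℕ → F} {s : ℕ → F ≃ₐ[k] F} {h : k}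
  {T : ℕ → (Module.End k U)ˣ}

theorem coe_dlUnit (H : SymField x s)
    (q : ∀ i, (T i : Module.End k U) * T i = h • (T i : Module.End k U) + 1) (i : ℕ) :
    (dlUnit H q i : Module.End k (F ⊗[k] U)) = dl x s h T i := rfl

theorem dlUnit_quad (H : SymField x s)
    (q : ∀ i, (T i : Module.End k U) * T i = h • (T i : Module.End k U) + 1) (i : ℕ) :
    (dlUnit H q i : Module.End k (F ⊗[k] U)) * dlUnit H q i = h • (dlUnit H q i :
      Module.End k (F ⊗[k] U)) + 1 := by
  rw [coe_dlUnit]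
  exact dl_quad H (q i)

end Unit

section
variable {k M F : Type} [Field k] [AddCommGroup M] [Module k M] [Field F]
  [Algebra k F] {x : ℕ → F} {s : ℕ → F ≃ₐ[k] F}

/-- A module over the affine Hecke algebra in which `b` need not be invertible is a quotient of a
subspace of a module in which it is. -/
theorem exists_affModule (hind : AlgebraicIndependent k x) (H : SymField x s) {n : ℕ} (hn : 0 < n)
    {h : k} {T : ℕ → (Module.End k M)ˣ} {b : Module.End k M}
    (q : ∀ i, (T i : Module.End k M) * T i = h • (T i : Module.End k M) + 1) (br : IsBraid n T)
    (Tb : ∀ i, 1 ≤ i → i + 1 < n → Commute (T i : Module.End k M) b)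
    (b4 : 1 < n → b * ↑(T 0)⁻¹ * b * ↑(T 0)⁻¹ = ↑(T 0)⁻¹ * b * ↑(T 0)⁻¹ * b) :
    ∃ (W : Type) (_ : AddCommGroup W) (_ : Module k W) (TW : ℕ → (Module.End k W)ˣ)
      (bW : (Module.End k W)ˣ) (G : Submodule k (W × M)),
      (∀ i, (TW i : Module.End k W) * TW i = h • (TW i : Module.End k W) + 1) ∧
      IsBraid n TW ∧ (∀ i, 1 ≤ i → i + 1 < n → Commute (TW i) bW) ∧
      (1 < n → bW * (TW 0)⁻¹ * bW * (TW 0)⁻¹ = (TW 0)⁻¹ * bW * (TW 0)⁻¹ * bW) ∧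
      IsFunctional G ∧ (∀ m, ∃ v, (v, m) ∈ G) ∧
      (∀ i, i + 1 < n → Preserves G (TW i : Module.End k W) (T i : Module.End k M)) ∧
      Preserves G (bW : Module.End k W) b := by
  -- `b` and the inverses `T_i⁻¹` satisfy the relations of `X_1` and `T_i`, with `-h` in place
  -- of `h`
  have q1 : ∀ i, (((T i)⁻¹ : (Module.End k M)ˣ) : Module.End k M) * ↑(T i)⁻¹ =
      (-h) • (↑(T i)⁻¹ : Module.End k M) + 1 := fun i => inv_quad (q i)
  have hy := affRel_affCut br.inv (a := b)
    (fun i h1 h2 => (Tb i h1 h2).units_inv_left) b4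
  have hΓ0 : IsFunctional (LinearMap.range (LinearMap.prod (LinearMap.id (R := k) (M := M))
      LinearMap.id)) := by
    rintro m ⟨u, hu⟩
    have h1 : u = 0 := congrArg Prod.fst hu
    have h2 : u = m := congrArg Prod.snd hu
    rw [← h2, h1]
  have hΓT : ∀ A : Module.End k M, Preserves (LinearMap.range (LinearMap.prod
      (LinearMap.id (R := k) (M := M)) LinearMap.id)) A A := by
    rintro A _ ⟨u, rfl⟩
    exact ⟨A u, rfl⟩
  obtain ⟨G, Gf, GΓ, Gy, Gmin⟩ := exists_polyGraph hind hy.xx hΓ0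
  have A1 := affRel_dl H q1 br.inv
  have q2 := dlUnit_quad H q1
  have P1 : ∀ i, i + 1 < n → Preserves G (dlUnit H q1 i : Module.End k _)
      (↑(T i)⁻¹ : Module.End k M) := by
    intro i hi
    rw [coe_dlUnit]
    exact preserves_dl H q1 hy GΓ Gy Gmin hi (hΓT _)
  generalize dlUnit H q1 = t at A1 P1 q2
  have hy0 : affCut n (fun i => (T i)⁻¹) b 0 = b := by
    rw [affCut, if_pos hn, affM_zero]
  have Gb := Gy 0
  rw [hy0] at Gb
  have hbW : (Units.map (opL (U := M)).toMonoidHom (mulXUnit H 0) : Module.End k (F ⊗[k] M)) =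
    opL (mulX x 0) := rfl
  generalize Units.map (opL (U := M)).toMonoidHom (mulXUnit H 0) = bW at hbW
  refine ⟨F ⊗[k] M, inferInstance, inferInstance, fun i => (t i)⁻¹, bW, G, ?_, A1.br.inv, ?_, ?_,
    Gf, fun m => ⟨_, GΓ _ ⟨m, rfl⟩⟩, ?_, ?_⟩
  · intro i
    have := inv_quad (k := k) (E := Module.End k (F ⊗[k] M)) (h := -h) (t := t i) (q2 i)
    rwa [neg_neg] at this
  · intro i h1 h2
    have := A1.Tx i 0 h2 (by omega) (by omega)
    rw [← hbW] at this
    exact (show Commute (t i) bW from Units.ext this).inv_left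
  · intro h1
    have := A1.comm_four h1
    rw [← hbW] at this
    simp only [inv_inv]
    exact Units.ext this
  · intro i hi
    have := Preserves.inv (h := -h) (t := t i) (q2 i) (q1 i) (P1 i hi)
    rwa [inv_inv] at this
  · rwa [hbW]

/-- The second polynomial extension: given a space `U` with a partial function onto `M` that
respects the operators, where `b` is already invertible on `U`, it provides the space `F ⊗ U` with a partial
function onto `M`, where `a` and `b` are both invertible. -/
theorem exists_dahaModule_aux {U : Type} [AddCommGroup U] [Module k U]
    (hind : AlgebraicIndependent k x)
    (H : SymField x s) {n : ℕ} (hn : 0 < n) {z : kˣ} {P : F ≃ₐ[k] F}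
    (hP : ∀ j, P (x j) = ((if j = 0 then z else 1 : kˣ) : k) • x (rotPerm n j))
    (hPs : ∀ i, i + 2 < n → ∀ f, P (s (i + 1) f) = s i (P f))
    (hPPs : 1 < n → ∀ f, P (P (s 0 f)) = s (n - 2) (P (P f)))
    {h : k} {T : ℕ → (Module.End k M)ˣ} {a b : Module.End k M}
    (q : ∀ i, (T i : Module.End k M) * T i = h • (T i : Module.End k M) + 1)
    (hab : PosCore n (algebraMap k (Module.End k M) z) T a b)
    {TW : ℕ → (Module.End k U)ˣ} {bW : (Module.End k U)ˣ} {G1 : Submodule k (U × M)}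
    (qW : ∀ i, (TW i : Module.End k U) * TW i = h • (TW i : Module.End k U) + 1)
    (brW : IsBraid n TW) (TbW : ∀ i, 1 ≤ i → i + 1 < n → Commute (TW i) bW)
    (b4W : 1 < n → bW * (TW 0)⁻¹ * bW * (TW 0)⁻¹ = (TW 0)⁻¹ * bW * (TW 0)⁻¹ * bW)
    (G1f : IsFunctional G1) (G1M : ∀ m, ∃ v, (v, m) ∈ G1)
    (PT1 : ∀ i, i + 1 < n → Preserves G1 (TW i : Module.End k U) (T i : Module.End k M))
    (Pb1 : Preserves G1 (bW : Module.End k U) b) :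
    ∃ (V : Type) (_ : AddCommGroup V) (_ : Module k V) (TV : ℕ → (Module.End k V)ˣ)
      (aV bV : (Module.End k V)ˣ) (G : Submodule k (V × M)),
      (∀ i, (TV i : Module.End k V) * TV i = h • (TV i : Module.End k V) + 1) ∧
      Core n (Units.map (algebraMap k (Module.End k V)).toMonoidHom z) TV aV bV ∧
      IsFunctional G ∧ (∀ m, ∃ v, (v, m) ∈ G) ∧
      (∀ i, i + 1 < n → Preserves G (TV i : Module.End k V) (T i : Module.End k M)) ∧
      Preserves G (aV : Module.End k V) a ∧ Preserves G (bV : Module.End k V) b := by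
  have hPz : P (x 0) = (z : k) • x (n - 1) := by
    rw [hP, rotPerm_apply, if_pos rfl, if_pos hn, if_pos rfl]
  have hPi : ∀ i, i + 1 < n → P (x (i + 1)) = x i := by
    intro i hi
    rw [hP, rotPerm_apply, if_neg (by omega), if_pos hi, if_neg (by omega)]
    simp
  -- it suffices to construct the cyclic rotation `p` with `b = T_0 ⋯ T_{n-2} p`: it acts on `F ⊗ U`
  -- by rotating the variables
  obtain ⟨pW, hpW⟩ : ∃ pW, bW = asc TW (n - 1) * pW :=
    ⟨(asc TW (n - 1))⁻¹ * bW, by rw [mul_inv_cancel_left]⟩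
  obtain ⟨pT, ppT⟩ := (brW.rotation_iff hpW).1 ⟨TbW, b4W⟩
  have PpW : Preserves G1 (pW : Module.End k U) (rot n T b) := by
    have e : pW = cyc (fun i => (TW i)⁻¹) (n - 1) * bW := by
      rw [cyc_inv, hpW, inv_mul_cancel_left]
    rw [e, rot, ← cyc_inv]
    exact Preserves.mul
      (Preserves.cyc fun i hi => Preserves.inv (qW i) (q i) (PT1 i (by omega))) Pb1
  have hy2 := affRel_affCut hab.br (a := a) hab.Ta hab.a4
  obtain ⟨G2, G2f, G2Γ, G2y, G2min⟩ := exists_polyGraph hind hy2.xx G1f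
  have A2 := affRel_dl H qW brW
  have q2 := dlUnit_quad H qW
  have P2 : ∀ i, i + 1 < n → Preserves G2 (dlUnit H qW i : Module.End k _)
      (T i : Module.End k M) := by
    intro i hi
    rw [coe_dlUnit]
    exact preserves_dl H q hy2 G2Γ G2y G2min hi (PT1 i hi)
  have h1t : ∀ i, i + 2 < n → (opL P.toLinearMap * opR (pW : Module.End k U)) *
      (dlUnit H qW (i + 1) : Module.End k (F ⊗[k] U)) =
      (dlUnit H qW i : Module.End k (F ⊗[k] U)) *
        (opL P.toLinearMap * opR (pW : Module.End k U)) := by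
    intro i hi
    rw [coe_dlUnit, coe_dlUnit]
    refine aut_mul_dl one_ne_zero ?_ ?_ (hPs i hi) (congrArg Units.val (pT i hi))
    · rw [hPi _ (by omega), one_smul]
    · rw [hPi _ (by omega), one_smul]
  have h2t : 1 < n → (opL P.toLinearMap * opR (pW : Module.End k U)) *
      (opL P.toLinearMap * opR (pW : Module.End k U)) *
      (dlUnit H qW 0 : Module.End k (F ⊗[k] U)) =
      (dlUnit H qW (n - 2) : Module.End k (F ⊗[k] U)) *
      ((opL P.toLinearMap * opR (pW : Module.End k U)) *
        (opL P.toLinearMap * opR (pW : Module.End k U))) := by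
    intro h1
    have e : (opL P.toLinearMap * opR (pW : Module.End k U)) *
        (opL P.toLinearMap * opR (pW : Module.End k U)) =
        opL (P * P).toLinearMap * opR ((pW * pW : (Module.End k U)ˣ) : Module.End k U) := by
      have : (P * P).toLinearMap = P.toLinearMap * P.toLinearMap := rfl
      rw [this, Units.val_mul, map_mul, map_mul]
      calc _ = opL P.toLinearMap * (opR (pW : Module.End k U) *
            opL P.toLinearMap) * opR (pW : Module.End k U) := by simp only [mul_assoc]
        _ = _ := by rw [opR_mul_opL]; simp only [mul_assoc]
    have hx1 : P (x (n - 1)) = x (n - 2) := by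
      have := hPi (n - 2) (by omega)
      rwa [show n - 2 + 1 = n - 1 by omega] at this
    rw [e, coe_dlUnit, coe_dlUnit]
    refine aut_mul_dl z.ne_zero ?_ ?_ (hPPs h1) (congrArg Units.val (ppT h1))
    · rw [AlgEquiv.mul_apply, hPz, map_smul, hx1]
    · rw [AlgEquiv.mul_apply, hPi 0 h1, hPz, show n - 2 + 1 = n - 1 by omega]
  generalize dlUnit H qW = TV at *
  have hy20 : affCut n T a 0 = a := by
    rw [affCut, if_pos hn, affM_zero]
  have hpx : ∀ j, (opL P.toLinearMap * opR (pW : Module.End k U)) * opL (mulX x j) =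
      ((if j = 0 then z else 1 : kˣ) : k) • (opL (mulX x (rotPerm n j)) *
        (opL P.toLinearMap * opR (pW : Module.End k U))) := by
    intro j
    have : P.toLinearMap * mulX x j = ((if j = 0 then z else 1 : kˣ) : k) •
        (mulX x (rotPerm n j) * P.toLinearMap) := by
      ext f
      show P (x j * f) = ((if j = 0 then z else 1 : kˣ) : k) • (x (rotPerm n j) * P f)
      rw [map_mul, hP, smul_mul_assoc]
    rw [mul_assoc, opR_mul_opL, ← mul_assoc, ← map_mul, this, map_smul, map_mul,
      smul_mul_assoc, mul_assoc]
  have Pp2 : Preserves G2 (opL P.toLinearMap * opR (pW : Module.End k U)) (rot n T b) := by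
    refine preserves_rot G2Γ G2y G2min (τ := rotPerm n)
      (c := fun j => ((if j = 0 then z else 1 : kˣ) : k)) hP PpW ?_
    intro j
    rcases Nat.lt_or_ge j n with hj | hj
    · obtain rfl | ⟨i, rfl⟩ : j = 0 ∨ ∃ i, j = i + 1 := by
        cases j with
        | zero => exact Or.inl rfl
        | succ i => exact Or.inr ⟨i, rfl⟩
      · have := hab.rot_X_zero (fun g => Algebra.commutes _ g) hn
        rw [rotPerm_apply, if_pos hn, if_pos rfl, if_pos rfl, hy20, affCut, if_pos (by omega),
          Algebra.smul_def]
        exact this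
      · have := hab.rot_X_succ hj
        rw [rotPerm_apply, if_pos hj, if_neg (by omega), if_neg (by omega), affCut, affCut,
          if_pos hj, if_pos (by omega), Units.val_one, one_smul]
        exact this
    · have e : ∀ j ≥ n, affCut n T a j = 0 := fun j hj => if_neg (by omega)
      rw [rotPerm_apply, if_neg (show ¬ j < n by omega), e j hj, mul_zero, zero_mul, smul_zero]
  have Pa2 := G2y 0
  rw [hy20] at Pa2
  have haV : (Units.map (opL (U := U)).toMonoidHom (mulXUnit H 0) : Module.End k (F ⊗[k] U)) =
    opL (mulX x 0) := rfl
  generalize Units.map (opL (U := U)).toMonoidHom (mulXUnit H 0) = aV at haV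
  have hpV : ((Units.map (opL (U := U)).toMonoidHom (autUnit P) *
      Units.map (opR (F := F)).toMonoidHom pW : (Module.End k (F ⊗[k] U))ˣ) :
        Module.End k (F ⊗[k] U)) = opL P.toLinearMap * opR (pW : Module.End k U) := rfl
  generalize Units.map (opL (U := U)).toMonoidHom (autUnit P) *
      Units.map (opR (F := F)).toMonoidHom pW = pV at hpV
  rw [← hpV] at Pp2 h2t
  simp only [← hpV] at h1t hpx
  rw [← haV] at Pa2
  refine ⟨F ⊗[k] U, inferInstance, inferInstance, TV, aV, asc TV (n - 1) * pV, G2, q2, ?_,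
    G2f, ?_, P2, Pa2, ?_⟩
  · refine posCore_of_rot (fun g => Units.ext (Algebra.commutes (z : k) _)) A2.br ?_ ?_ ?_ ?_ ?_ ?_
    · intro i h1 h2
      have := A2.Tx i 0 h2 (by omega) (by omega)
      rw [← haV] at this
      exact Units.ext this
    · intro h1
      have := A2.comm_four h1
      rw [← haV] at this
      exact Units.ext this
    · intro i hi
      exact Units.ext (h1t i hi)
    · intro h1
      exact Units.ext (h2t h1)
    · intro h1
      apply Units.ext
      have := hpx 1
      rw [if_neg one_ne_zero, Units.val_one, one_smul, rotPerm_apply, if_pos h1,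
        if_neg one_ne_zero, ← A2.TxT 0 h1, ← haV] at this
      exact this
    · apply Units.ext
      have := hpx 0
      rw [if_pos rfl, rotPerm_apply, if_pos hn, if_pos rfl, ← A2.affM_eq (j := n - 1) (by omega),
        ← haV, ← coe_affX, Algebra.smul_def] at this
      exact this
  · intro m
    obtain ⟨v, hv⟩ := G1M m
    exact ⟨_, G2Γ _ hv⟩
  · rw [← asc_mul_rot n T b, Units.val_mul]
    exact Preserves.mul (Preserves.asc fun i hi => P2 i (by omega)) Pp2

end

/-- A module `M` over the positive part of the double affine Hecke algebra is a quotient of a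
subspace of a module `V` over the whole algebra. -/
theorem exists_dahaModule {k M : Type} [Field k] [AddCommGroup M] [Module k M] {n : ℕ} (hn : 0 < n)
    {h : k} {z : kˣ} {T : ℕ → (Module.End k M)ˣ} {a b : Module.End k M}
    (q : ∀ i, (T i : Module.End k M) * T i = h • (T i : Module.End k M) + 1)
    (hab : PosCore n (algebraMap k (Module.End k M) z) T a b) :
    ∃ (V : Type) (_ : AddCommGroup V) (_ : Module k V) (TV : ℕ → (Module.End k V)ˣ)
      (aV bV : (Module.End k V)ˣ) (G : Submodule k (V × M)),
      (∀ i, (TV i : Module.End k V) * TV i = h • (TV i : Module.End k V) + 1) ∧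
      Core n (Units.map (algebraMap k (Module.End k V)).toMonoidHom z) TV aV bV ∧
      IsFunctional G ∧ (∀ m, ∃ v, (v, m) ∈ G) ∧
      (∀ i, i + 1 < n → Preserves G (TV i : Module.End k V) (T i : Module.End k M)) ∧
      Preserves G (aV : Module.End k V) a ∧ Preserves G (bV : Module.End k V) b := by
  obtain ⟨W, iW, jW, TW, bW, G, qW, brW, Tb, b4, Gf, GM, GT, Gb⟩ :=
    @exists_affModule k M (FractionRing (MvPolynomial ℕ k)) _ _ _ _ _ (ratX k) ratS
      ratX_algebraicIndependent symField_rat n hn h T b q hab.br hab.Tb hab.b4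
  have hP : ∀ j, ratP n z (ratX k j) = ((if j = 0 then z else 1 : kˣ) : k) •
    ratX k (rotPerm n j) := ratAut_X _ _
  have e := @exists_dahaModule_aux k M (FractionRing (MvPolynomial ℕ k)) _ _ _ _ _ (ratX k) ratS
    W iW jW ratX_algebraicIndependent symField_rat n hn z (ratP n z) hP
    (fun _ hi => ratP_S hi z) (fun h1 => ratP_P_S h1 z) h T a b q hab TW bW G qW brW Tb b4 Gf GM
    GT Gb
  exact e

end DahaModule

/-! ### The induced module -/

section Induced
variable {k : Type*} [Field k] {N : Type*} [AddCommGroup N] [Module k N]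

/-- The operator `T_i` of the module induced from `N`. The element `single p x` with `p ≤ n` stands
for `T_{p-1} ⋯ T_0 ⊗ x`; the remaining summands carry the scalar `v`. -/
noncomputable def indT (v h : k) (n : ℕ) (T : ℕ → (Module.End k N)ˣ) (i : ℕ) :
    Module.End k (ℕ →₀ N) :=
  Finsupp.lsum k fun p =>
    if i < n ∧ p ≤ n then
      if p = i then Finsupp.lsingle (i + 1)
      else if p = i + 1 then h • Finsupp.lsingle (i + 1) + Finsupp.lsingle i
      else if p < i then Finsupp.lsingle p ∘ₗ (T (i - 1) : Module.End k N)
      else Finsupp.lsingle p ∘ₗ (T i : Module.End k N)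
    else v • Finsupp.lsingle p

/-- The operator `X_1` of the induced module. -/
noncomputable def indA (h : k) (n : ℕ) (T : ℕ → (Module.End k N)ˣ) (a : Module.End k N) :
    Module.End k (ℕ →₀ N) :=
  Finsupp.lsum k fun p =>
    if p ≠ 0 ∧ p ≤ n then
      Finsupp.lsingle p ∘ₗ a - h • (Finsupp.lsingle 0 ∘ₗ ((↑(cyc T (p - 1)) : Module.End k N) ∘ₗ a))
    else 0

/-- The operator `Y_1` of the induced module. -/
noncomputable def indB (n : ℕ) (b : Module.End k N) : Module.End k (ℕ →₀ N) :=
  Finsupp.lsum k fun p => if p ≠ 0 ∧ p ≤ n then Finsupp.lsingle p ∘ₗ b else 0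

variable {v h : k} {n : ℕ} {T : ℕ → (Module.End k N)ˣ} {a b : Module.End k N}

open Finsupp (single)

theorem indT_eq {i : ℕ} (hi : i < n) (x : N) :
    indT v h n T i (single i x) = single (i + 1) x := by
  simp [indT, hi, hi.le]

theorem indT_succ {i : ℕ} (hi : i < n) (x : N) :
    indT v h n T i (single (i + 1) x) = h • single (i + 1) x + single i x := by
  simp [indT, hi, Nat.succ_le_of_lt hi]

theorem indT_lt {i p : ℕ} (hi : i < n) (hp : p < i) (x : N) :
    indT v h n T i (single p x) = single p ((T (i - 1) : Module.End k N) x) := by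
  simp [indT, hi, (hp.trans hi).le, hp, hp.ne, (Nat.lt_succ_of_lt hp).ne]

theorem indT_gt {i p : ℕ} (hp : i + 1 < p) (hn : p ≤ n) (x : N) :
    indT v h n T i (single p x) = single p ((T i : Module.End k N) x) := by
  simp [indT, show i < n by omega, hn, show ¬ p = i by omega, show ¬ p = i + 1 by omega,
    show ¬ p < i by omega]

theorem indT_out {i p : ℕ} (hp : ¬ (i < n ∧ p ≤ n)) (x : N) :
    indT v h n T i (single p x) = v • single p x := by
  simp only [indT, if_neg hp, Finsupp.lsum_single, LinearMap.smul_apply, Finsupp.lsingle_apply]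

theorem indA_zero (x : N) : indA h n T a (single 0 x) = 0 := by simp [indA]

theorem indA_succ {p : ℕ} (hp : p < n) (x : N) : indA h n T a (single (p + 1) x) =
    single (p + 1) (a x) - h • single 0 ((↑(cyc T p) : Module.End k N) (a x)) := by
  simp [indA, Nat.succ_le_of_lt hp]

theorem indA_out {p : ℕ} (hp : n < p) (x : N) : indA h n T a (single p x) = 0 := by
  simp [indA, show ¬ p ≤ n by omega]

theorem indB_zero (x : N) : indB n b (single 0 x) = 0 := by simp [indB]

theorem indB_succ {p : ℕ} (hp : p < n) (x : N) :
    indB n b (single (p + 1) x) = single (p + 1) (b x) := by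
  simp [indB, Nat.succ_le_of_lt hp]

theorem indB_out {p : ℕ} (hp : n < p) (x : N) : indB n b (single p x) = 0 := by
  simp [indB, show ¬ p ≤ n by omega]

theorem indT_quad (hv : v * v = h * v + 1)
    (q : ∀ i, (T i : Module.End k N) * T i = h • (T i : Module.End k N) + 1) (i : ℕ) :
    indT v h n T i * indT v h n T i = h • indT v h n T i + 1 := by
  have q' : ∀ i x, (T i : Module.End k N) ((T i : Module.End k N) x) =
      h • (T i : Module.End k N) x + x := fun i x => LinearMap.congr_fun (q i) x
  refine Finsupp.lhom_ext fun p x => ?_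
  rw [Module.End.mul_apply, LinearMap.add_apply, LinearMap.smul_apply, Module.End.one_apply]
  by_cases hp : i < n ∧ p ≤ n
  · obtain ⟨hi, hp⟩ := hp
    rcases Nat.lt_trichotomy p i with h1 | rfl | h1
    · rw [indT_lt hi h1, indT_lt hi h1, q', Finsupp.single_add, Finsupp.smul_single]
    · rw [indT_eq hi, indT_succ hi]
    · by_cases h2 : p = i + 1
      · subst h2
        rw [indT_succ hi, map_add, map_smul, indT_eq hi, indT_succ hi]
      · rw [indT_gt (by omega) hp, indT_gt (by omega) hp, q', Finsupp.single_add,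
          Finsupp.smul_single]
  · rw [indT_out hp, map_smul, indT_out hp, smul_smul, smul_smul, hv, add_smul, one_smul]

/-- The operators `T_i` of the induced module, as invertible operators. -/
noncomputable def indTU (n : ℕ) (hv : v * v = h * v + 1)
    (q : ∀ i, (T i : Module.End k N) * T i = h • (T i : Module.End k N) + 1) (i : ℕ) :
    (Module.End k (ℕ →₀ N))ˣ := unitOfQuad h (indT v h n T i) (indT_quad hv q i)

variable (hv : v * v = h * v + 1)
    (q : ∀ i, (T i : Module.End k N) * T i = h • (T i : Module.End k N) + 1)

theorem coe_indTU (i : ℕ) : (indTU n hv q i : Module.End k (ℕ →₀ N)) = indT v h n T i := rfl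

theorem coe_indTU_inv (i : ℕ) :
    (↑(indTU n hv q i)⁻¹ : Module.End k (ℕ →₀ N)) = indT v h n T i - h • 1 := rfl

theorem indT_comm (br : IsBraid n T) {i j : ℕ} (hij : i + 1 < j) (hj : j < n) :
    Commute (indT v h n T i) (indT v h n T j) := by
  refine Finsupp.lhom_ext fun p x => ?_
  rw [Module.End.mul_apply, Module.End.mul_apply]
  have c : ∀ i j, i + 1 < j → j + 1 < n → (T i : Module.End k N) ((T j : Module.End k N) x) =
      (T j : Module.End k N) ((T i : Module.End k N) x) := fun i j h1 h2 =>
    LinearMap.congr_fun (congrArg Units.val (br.comm i j h1 h2)) x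
  by_cases hp : p ≤ n
  · rcases Nat.lt_trichotomy p i with h1 | rfl | h1
    · rw [indT_lt hj (by omega), indT_lt (by omega) h1, indT_lt (by omega) h1,
        indT_lt hj (by omega), c (i - 1) (j - 1) (by omega) (by omega)]
    · rw [indT_lt hj (by omega), indT_eq (by omega), indT_eq (by omega), indT_lt hj (by omega)]
    · rcases Nat.lt_trichotomy p (i + 1) with h2 | rfl | h2
      · omega
      · rw [indT_lt hj (by omega), indT_succ (by omega), indT_succ (by omega), map_add, map_smul,
          indT_lt hj (by omega), indT_lt hj (by omega)]
      · rcases Nat.lt_trichotomy p j with h3 | rfl | h3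
        · rw [indT_lt hj h3, indT_gt h2 hp, indT_gt h2 hp, indT_lt hj h3,
            c i (j - 1) (by omega) (by omega)]
        · rw [indT_eq hj, indT_gt h2 hp, indT_gt (by omega) (by omega), indT_eq hj]
        · by_cases h4 : p = j + 1
          · subst h4
            rw [indT_succ hj, indT_gt h2 hp, map_add, map_smul, indT_gt h2 hp,
              indT_gt (by omega) (by omega), indT_succ hj]
          · rw [indT_gt (by omega) hp, indT_gt h2 hp, indT_gt h2 hp, indT_gt (by omega) hp,
              c i j (by omega) (by omega)]
  · have h0 : ∀ i, ¬ (i < n ∧ p ≤ n) := fun i e => hp e.2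
    simp only [indT_out (h0 _), map_smul]

include q in
theorem indT_braid (br : IsBraid n T) {i : ℕ} (hi : i + 1 < n) :
    indT v h n T i * indT v h n T (i + 1) * indT v h n T i =
      indT v h n T (i + 1) * indT v h n T i * indT v h n T (i + 1) := by
  refine Finsupp.lhom_ext fun p x => ?_
  simp only [Module.End.mul_apply]
  have c : ∀ i, i + 2 < n → (T i : Module.End k N) ((T (i + 1) : Module.End k N)
      ((T i : Module.End k N) x)) = (T (i + 1) : Module.End k N) ((T i : Module.End k N)
        ((T (i + 1) : Module.End k N) x)) := fun i h1 =>
    LinearMap.congr_fun (congrArg Units.val (br.braid i h1)) x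
  have q' : ∀ i x, (T i : Module.End k N) ((T i : Module.End k N) x) =
      h • (T i : Module.End k N) x + x := fun i x => LinearMap.congr_fun (q i) x
  by_cases hp : p ≤ n
  · rcases Nat.lt_trichotomy p i with h1 | rfl | h1
    · have := c (i - 1) (by omega)
      rw [show i - 1 + 1 = i by omega] at this
      simp only [indT_lt (show i < n by omega) h1, indT_lt hi (show p < i + 1 by omega),
        Nat.add_sub_cancel, this]
    · rw [indT_eq (by omega), indT_eq hi, indT_gt (by omega) (by omega), indT_lt hi (by omega),
        indT_eq (by omega), indT_eq (by omega), Nat.add_sub_cancel]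
    · by_cases h2 : p = i + 1
      · subst h2
        simp only [map_add, map_smul, indT_succ (show i < n by omega), indT_eq hi, indT_succ hi,
          indT_gt (show i + 1 < i + 1 + 1 by omega) (show i + 1 + 1 ≤ n from hi),
          indT_lt hi (show i < i + 1 by omega), Nat.add_sub_cancel, indT_eq (show i < n by omega)]
      · by_cases h3 : p = i + 1 + 1
        · subst h3
          simp only [map_add, map_smul, indT_succ (show i < n by omega), indT_eq hi, indT_succ hi,
            indT_gt (show i + 1 < i + 1 + 1 by omega) hp,
            indT_lt hi (show i < i + 1 by omega), Nat.add_sub_cancel, q', Finsupp.single_add,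
            ← Finsupp.smul_single]
          module
        · simp only [indT_gt (show i + 1 < p by omega) hp, indT_gt (show i + 1 + 1 < p by omega) hp,
            c i (by omega)]
  · have h0 : ∀ i, ¬ (i < n ∧ p ≤ n) := fun i e => hp e.2
    simp only [indT_out (h0 _), map_smul]

theorem isBraid_indTU (br : IsBraid n T) : IsBraid (n + 1) (indTU n hv q) where
  braid i hi := Units.ext (indT_braid q br (by omega))
  comm i j hij hj := Units.ext (indT_comm br hij (by omega))

/-- Two operators on the induced module are equal if they commute with `T_r`, `T_{r+1}`, … and
agree on the first `r + 1` summands. -/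
theorem ind_ext {r : ℕ} {A B : Module.End k (ℕ →₀ N)}
    (hA : ∀ i, r ≤ i → i < n → Commute (indT v h n T i) A)
    (hB : ∀ i, r ≤ i → i < n → Commute (indT v h n T i) B)
    (hlo : ∀ p ≤ r, p ≤ n → ∀ x, A (single p x) = B (single p x))
    (hout : ∀ p, n < p → ∀ x, A (single p x) = B (single p x)) : A = B := by
  refine Finsupp.lhom_ext fun p x => ?_
  rcases Nat.lt_or_ge n p with hp | hp
  · exact hout p hp x
  · induction p with
    | zero => exact hlo 0 (by omega) hp x
    | succ p ih =>
      rcases Nat.lt_or_ge p r with h1 | h1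
      · exact hlo _ h1 hp x
      · have e1 := LinearMap.congr_fun (hA p h1 hp) (single p x)
        have e2 := LinearMap.congr_fun (hB p h1 hp) (single p x)
        rw [Module.End.mul_apply, Module.End.mul_apply, indT_eq hp] at e1 e2
        rw [← e1, ← e2, ih (by omega)]

variable {z : k}

theorem indA_comm (hab : PosCore n (algebraMap k (Module.End k N) z) T a b)
    (q : ∀ i, (T i : Module.End k N) * T i = h • (T i : Module.End k N) + 1) {i : ℕ}
    (h1 : 1 ≤ i) (hi : i < n) : Commute (indT v h n T i) (indA h n T a) := by
  have q' : ∀ i x, (T i : Module.End k N) ((T i : Module.End k N) x) =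
      h • (T i : Module.End k N) x + x := fun i x => LinearMap.congr_fun (q i) x
  refine Finsupp.lhom_ext fun p x => ?_
  rw [Module.End.mul_apply, Module.End.mul_apply]
  have ca : ∀ i, 1 ≤ i → i + 1 < n → (T i : Module.End k N) (a x) =
      a ((T i : Module.End k N) x) := fun i h1 h2 => LinearMap.congr_fun (hab.Ta i h1 h2) x
  rcases Nat.lt_or_ge n p with hp | hp
  · rw [indA_out hp, indT_out (by omega), map_smul, indA_out hp, map_zero, smul_zero]
  obtain _ | p := p
  · rw [indA_zero, indT_lt hi (by omega), indA_zero, map_zero]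
  rw [indA_succ hp, map_sub, map_smul, indT_lt hi h1]
  rcases Nat.lt_trichotomy (p + 1) i with h2 | h2 | h2
  · rw [indT_lt hi h2, indT_lt hi h2, indA_succ hp, ← ca _ (by omega) (by omega)]
    have c : Commute (T (i - 1)) (cyc T p) :=
      commute_cyc fun j hj => (hab.br.comm j (i - 1) (by omega) (by omega)).symm
    have := LinearMap.congr_fun (congrArg Units.val c) (a x)
    simp only [Units.val_mul, Module.End.mul_apply] at this
    rw [this]
  · subst h2
    rw [indT_eq hi, indT_eq hi, indA_succ hi]
    rfl
  · obtain rfl | h3 := Nat.eq_or_lt_of_le (Nat.lt_succ_iff.1 h2)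
    · obtain ⟨r, rfl⟩ : ∃ r, i = r + 1 := ⟨i - 1, by omega⟩
      rw [indT_succ hi, indT_succ hi, map_add, map_smul, indA_succ hi, indA_succ (by omega)]
      simp only [cyc, Units.val_mul, Module.End.mul_apply, Nat.add_sub_cancel]
      rw [q', Finsupp.single_add, ← Finsupp.smul_single]
      module
    · rw [indT_gt (by omega) hp, indT_gt (by omega) hp, indA_succ hp, ca _ h1 (by omega)]
      have := LinearMap.congr_fun (congrArg Units.val
        (hab.br.T_cyc (i := i - 1) (k := p) (by omega) hp)) (a x)
      simp only [Units.val_mul, Module.End.mul_apply, show i - 1 + 1 = i by omega] at this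
      rw [this, ca _ h1 (by omega)]

theorem indB_comm (hab : PosCore n (algebraMap k (Module.End k N) z) T a b) {i : ℕ}
    (h1 : 1 ≤ i) (hi : i < n) : Commute (indT v h n T i) (indB n b) := by
  refine Finsupp.lhom_ext fun p x => ?_
  rw [Module.End.mul_apply, Module.End.mul_apply]
  have cb : ∀ i, 1 ≤ i → i + 1 < n → (T i : Module.End k N) (b x) =
      b ((T i : Module.End k N) x) := fun i h1 h2 => LinearMap.congr_fun (hab.Tb i h1 h2) x
  rcases Nat.lt_or_ge n p with hp | hp
  · rw [indB_out hp, indT_out (by omega), map_smul, indB_out hp, map_zero, smul_zero]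
  obtain _ | p := p
  · rw [indB_zero, indT_lt hi (by omega), indB_zero, map_zero]
  rw [indB_succ hp]
  rcases Nat.lt_trichotomy (p + 1) i with h2 | h2 | h2
  · rw [indT_lt hi h2, indT_lt hi h2, indB_succ hp, ← cb _ (by omega) (by omega)]
  · subst h2
    rw [indT_eq hi, indT_eq hi, indB_succ hi]
  · obtain rfl | h3 := Nat.eq_or_lt_of_le (Nat.lt_succ_iff.1 h2)
    · obtain ⟨r, rfl⟩ : ∃ r, i = r + 1 := ⟨i - 1, by omega⟩
      rw [indT_succ hi, indT_succ hi, map_add, map_smul, indB_succ hi, indB_succ (by omega)]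
    · rw [indT_gt (by omega) hp, indT_gt (by omega) hp, indB_succ hp, cb _ h1 (by omega)]

theorem indA_one {n : ℕ} (hn : 0 < n) (x : N) : indA h n T a (single 1 x) =
    single 1 (a x) - h • single 0 (a x) := indA_succ hn x

theorem indA_two {n : ℕ} (hn : 1 < n) (x : N) : indA h n T a (single 2 x) =
    single 2 (a x) - h • single 0 ((T 0 : Module.End k N) (a x)) := by
  have := indA_succ (h := h) (T := T) (a := a) hn x
  simpa [cyc] using this

theorem T_inv_apply {T : (Module.End k N)ˣ}
    (q : (T : Module.End k N) * T = h • (T : Module.End k N) + 1) (x : N) :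
    (↑T⁻¹ : Module.End k N) x = (T : Module.End k N) x - h • x := by
  rw [inv_of_quad q]
  rfl

theorem indTU_inv_zero (hn : 0 < n) (x : N) :
    (↑(indTU n hv q 0)⁻¹ : Module.End k (ℕ →₀ N)) (single 0 x) = single 1 x - h • single 0 x := by
  rw [coe_indTU_inv, LinearMap.sub_apply, indT_eq hn]
  rfl

theorem indTU_inv_one (hn : 0 < n) (x : N) :
    (↑(indTU n hv q 0)⁻¹ : Module.End k (ℕ →₀ N)) (single 1 x) = single 0 x := by
  rw [coe_indTU_inv, LinearMap.sub_apply, indT_succ hn]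
  show h • single 1 x + single 0 x - h • single 1 x = _
  abel

theorem indTU_inv_two (hn : 1 < n) (x : N) :
    (↑(indTU n hv q 0)⁻¹ : Module.End k (ℕ →₀ N)) (single 2 x) =
      single 2 ((↑(T 0)⁻¹ : Module.End k N) x) := by
  rw [coe_indTU_inv, LinearMap.sub_apply, indT_gt (by omega) hn, T_inv_apply (q 0),
    Finsupp.single_sub, ← Finsupp.smul_single]
  rfl

theorem cyc_shift_single {r : ℕ} (hr : r < n) (y : N) :
    (↑(cyc (fun i => indTU n hv q (i + 1)) r) : Module.End k (ℕ →₀ N)) (single 0 y) =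
      single 0 ((↑(cyc T r) : Module.End k N) y) := by
  induction r with
  | zero => rfl
  | succ r ih =>
    simp only [cyc, Units.val_mul, Module.End.mul_apply]
    rw [ih (by omega), coe_indTU, indT_lt (by omega) (by omega), Nat.add_sub_cancel]

theorem asc_shift_single {r : ℕ} (hr : r < n) (y : N) :
    (↑(asc (fun i => indTU n hv q (i + 1)) r) : Module.End k (ℕ →₀ N)) (single 0 y) =
      single 0 ((↑(asc T r) : Module.End k N) y) := by
  induction r generalizing y with
  | zero => rfl
  | succ r ih =>
    simp only [asc, Units.val_mul, Module.End.mul_apply]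
    rw [coe_indTU, indT_lt (by omega) (by omega), Nat.add_sub_cancel, ih (by omega)]

/-- The full loop `T_0 ⋯ T_{n-1} T_{n-1} ⋯ T_0` carries `T_0⁻¹ ⊗ y` to the image under `T_0` of the
loop of rank one less. -/
theorem loop_single (hn : 0 < n) (y : N) :
    (↑(asc (indTU n hv q) n) : Module.End k (ℕ →₀ N))
      ((↑(cyc (indTU n hv q) n) : Module.End k (ℕ →₀ N)) (single 1 y - h • single 0 y)) =
      single 1 ((↑(asc T (n - 1)) : Module.End k N) ((↑(cyc T (n - 1)) : Module.End k N) y)) := by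
  have ea := asc_succ' (indTU n hv q) (n - 1)
  have ec := cyc_succ' (indTU n hv q) (n - 1)
  rw [show n - 1 + 1 = n by omega] at ea ec
  rw [ea, ec, ← indTU_inv_zero hv q hn, Units.val_mul, Units.val_mul, Module.End.mul_apply,
    Module.End.mul_apply, ← Module.End.mul_apply _ _ (single 0 y), Units.mul_inv,
    Module.End.one_apply, cyc_shift_single hv q (by omega), asc_shift_single hv q (by omega),
    coe_indTU, indT_eq hn]

/-- The positive relations hold in the induced module. -/
theorem posCore_ind (hn : 0 < n) (hab : PosCore n (algebraMap k (Module.End k N) z) T a b) :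
    PosCore (n + 1) (algebraMap k (Module.End k (ℕ →₀ N)) z) (indTU n hv q) (indA h n T a)
      (indB n b) := by
  have br := isBraid_indTU hv q hab.br
  have q' : ∀ i x, (T i : Module.End k N) ((T i : Module.End k N) x) =
      h • (T i : Module.End k N) x + x := fun i x => LinearMap.congr_fun (q i) x
  have cA : ∀ i, 1 ≤ i → i < n → Commute (indTU n hv q i : Module.End k (ℕ →₀ N))
    (indA h n T a) := fun i h1 hi => indA_comm hab q h1 hi
  have cB : ∀ i, 1 ≤ i → i < n → Commute (indTU n hv q i : Module.End k (ℕ →₀ N))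
    (indB n b) := fun i h1 hi => indB_comm hab h1 hi
  have cT : ∀ i, 2 ≤ i → i < n → Commute (indTU n hv q i : Module.End k (ℕ →₀ N))
    (indTU n hv q 0 : Module.End k (ℕ →₀ N)) := fun i h1 hi =>
      (br.comm 0 i (by omega) (by omega)).symm.units_val
  have cT' : ∀ i, 2 ≤ i → i < n → Commute (indTU n hv q i : Module.End k (ℕ →₀ N))
    (↑(indTU n hv q 0)⁻¹ : Module.End k (ℕ →₀ N)) := fun i h1 hi => (cT i h1 hi).units_inv_right
  refine ⟨br, fun i h1 hi => cA i h1 (by omega), fun i h1 hi => cB i h1 (by omega),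
    fun _ => ?_, fun _ => ?_, fun _ => ?_, fun _ => ?_⟩
  · refine ind_ext (r := 2) (v := v) (h := h) (n := n) (T := T) (fun i h1 hi => ?_)
      (fun i h1 hi => ?_) ?_ ?_
    · have c1 := cA i (by omega) hi
      have c2 := cT i h1 hi
      exact ((c1.mul_right c2).mul_right c1).mul_right c2
    · have c1 := cA i (by omega) hi
      have c2 := cT i h1 hi
      exact ((c2.mul_right c1).mul_right c2).mul_right c1
    · intro p hp hpn x
      simp only [Module.End.mul_apply, coe_indTU]
      obtain rfl | rfl | rfl : p = 0 ∨ p = 1 ∨ p = 2 := by omega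
      · rw [indA_zero, indT_eq hn, indA_one hn, map_sub, map_smul, indT_eq hn, indT_succ hn]
        simp only [map_zero, map_add, map_sub, map_smul, indA_one hn, indA_zero]
        simp
      · rw [indT_succ hn]
        simp only [map_zero, map_add, map_sub, map_smul, indA_one hn, indA_zero, indT_eq hn,
          indT_succ hn]
        simp
      · have e := LinearMap.congr_fun (hab.a4 hpn) x
        simp only [Module.End.mul_apply] at e
        simp only [map_sub, map_smul, indA_one hn, indA_two hpn, indT_eq hn,
          indT_succ hn, indT_gt (show 0 + 1 < 2 by omega) hpn, Nat.zero_add, e, q',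
          Finsupp.single_add, ← Finsupp.smul_single]
        module
    · intro p hp x
      simp [coe_indTU, indT_out (show ¬ (0 < n ∧ p ≤ n) by omega), indA_out hp]
  · refine ind_ext (r := 2) (v := v) (h := h) (n := n) (T := T) (fun i h1 hi => ?_)
      (fun i h1 hi => ?_) ?_ ?_
    · have c1 := cB i (by omega) hi
      have c2 := cT' i h1 hi
      exact ((c1.mul_right c2).mul_right c1).mul_right c2
    · have c1 := cB i (by omega) hi
      have c2 := cT' i h1 hi
      exact ((c2.mul_right c1).mul_right c2).mul_right c1
    · intro p hp hpn x
      simp only [Module.End.mul_apply]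
      obtain rfl | rfl | rfl : p = 0 ∨ p = 1 ∨ p = 2 := by omega
      · rw [indTU_inv_zero hv q hn, indB_zero, map_sub, map_smul, indB_zero, smul_zero, sub_zero,
          indB_succ hn, indTU_inv_one hv q hn, indB_zero, map_zero, map_zero, map_zero]
      · rw [indTU_inv_one hv q hn, indB_zero, map_zero, map_zero, indB_succ hn,
          indTU_inv_one hv q hn, indB_zero, map_zero]
      · have e := LinearMap.congr_fun (hab.b4 hpn) x
        simp only [Module.End.mul_apply] at e
        have hb2 : ∀ x, indB n b (single 2 x) = single 2 (b x) := fun x => indB_succ hpn x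
        simp only [indTU_inv_two hv q hpn, hb2, e]
    · intro p hp x
      simp [coe_indTU_inv, indT_out (show ¬ (0 < n ∧ p ≤ n) by omega), indB_out hp]
  · refine ind_ext (r := 2) (v := v) (h := h) (n := n) (T := T) (fun i h1 hi => ?_)
      (fun i h1 hi => ?_) ?_ ?_
    · have c1 := cA i (by omega) hi
      have c2 := cT i h1 hi
      have c3 := cB i (by omega) hi
      exact c3.mul_right ((c2.mul_right c1).mul_right c2)
    · have c1 := cA i (by omega) hi
      have c2 := cT i h1 hi
      have c3 := cB i (by omega) hi
      exact ((c2.mul_right c1).mul_right (cT' i h1 hi)).mul_right c3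
    · intro p hp hpn x
      simp only [Module.End.mul_apply]
      have hb1 : ∀ x, indB n b (single 1 x) = single 1 (b x) := fun x => indB_succ hn x
      obtain rfl | rfl | rfl : p = 0 ∨ p = 1 ∨ p = 2 := by omega
      · simp only [coe_indTU, indB_zero, map_zero, indT_eq hn, Nat.zero_add, indA_one hn, map_sub,
          map_smul, indT_succ hn, map_add, hb1]
        simp
      · simp only [hb1, indTU_inv_one hv q hn]
        simp only [coe_indTU, indA_zero, indB_zero, map_zero, indT_eq hn, Nat.zero_add,
          indA_one hn, map_sub, map_smul, indT_succ hn, map_add, hb1]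
        simp
      · have e := LinearMap.congr_fun (hab.ab hpn) x
        simp only [Module.End.mul_apply] at e
        have hb2 : ∀ x, indB n b (single 2 x) = single 2 (b x) := fun x => indB_succ hpn x
        simp only [hb2, indTU_inv_two hv q hpn, coe_indTU, map_sub, map_smul, indA_two hpn,
          indT_gt (show 0 + 1 < 2 by omega) hpn, indT_eq hn, Nat.zero_add, hb1, e]
    · intro p hp x
      simp [coe_indTU, indT_out (show ¬ (0 < n ∧ p ≤ n) by omega), indA_out hp, indB_out hp]
  · refine ind_ext (r := 1) (v := v) (h := h) (n := n) (T := T) (fun i h1 hi => ?_)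
      (fun i h1 hi => ?_) ?_ ?_
    · have c1 := cA i (by omega) hi
      have c3 := cB i (by omega) hi
      have c4 := br.bigA_comm (i := i - 1) (by omega)
      rw [show i - 1 + 1 = i by omega] at c4
      exact (c4.symm.units_val.mul_right c3).mul_right c1
    · have c1 := cA i (by omega) hi
      have c3 := cB i (by omega) hi
      exact Commute.mul_right (Algebra.commutes z _).symm (c1.mul_right c3)
    · intro p hp hpn x
      simp only [Module.End.mul_apply]
      have hb1 : ∀ x, indB n b (single 1 x) = single 1 (b x) := fun x => indB_succ hn x
      obtain rfl | rfl : p = 0 ∨ p = 1 := by omega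
      · rw [indA_zero, indB_zero]; simp
      · rw [indA_one hn, map_sub, map_smul, indB_zero, smul_zero, sub_zero, hb1, hb1, indA_one hn]
        have e := LinearMap.congr_fun (hab.A hn) x
        simp only [Module.End.mul_apply] at e
        have key : ∀ y, (↑(bigA (indTU n hv q) n) : Module.End k (ℕ →₀ N)) (single 1 y) =
            single 1 ((↑(bigA T (n - 1)) : Module.End k N) y) -
              h • single 0 ((↑(bigA T (n - 1)) : Module.End k N) y) := by
          intro y
          have e1 : (↑(asc T (n - 1)) : Module.End k N) ((↑(cyc T (n - 1)) : Module.End k N)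
              ((↑(bigA T (n - 1)) : Module.End k N) y)) = y := by
            rw [← Module.End.mul_apply, ← Module.End.mul_apply, ← Units.val_mul, ← Units.val_mul,
              hab.br.bigA_eq (by omega), mul_inv_cancel]
            rfl
          conv_lhs => rw [← e1, ← loop_single hv q hn]
          rw [← Module.End.mul_apply, ← Module.End.mul_apply, ← Units.val_mul, ← Units.val_mul,
            br.bigA_eq (by omega), mul_assoc, inv_mul_cancel]
          rfl
        rw [Nat.add_sub_cancel, key, e]
        show single 1 (z • a (b x)) - h • single 0 (z • a (b x)) =
          z • (single 1 (a (b x)) - h • single 0 (a (b x)))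
        rw [← Finsupp.smul_single, ← Finsupp.smul_single]
        module
    · intro p hp x
      simp [indA_out hp, indB_out hp]

end Induced

/-! ### Relations of the double affine Hecke algebra in the induced module -/

section Relation

theorem bigA_congr {G : Type*} [Group G] {T T' : ℕ → G} {k : ℕ} (e : ∀ i < k, T i = T' i) :
    bigA T k = bigA T' k := by
  have hal : ∀ j < k, al T j = al T' j := by
    intro j
    induction j with
    | zero => intro hj; simp only [al, e 0 hj]
    | succ j ih => intro hj; simp only [al, e _ hj, ih (by omega)]
  have : ∀ j ≤ k, bigA T j = bigA T' j := by
    intro j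
    induction j with
    | zero => intro _; rfl
    | succ j ih => intro hj; simp only [bigA, hal j hj, ih (by omega)]
  exact this k le_rfl

theorem Core.congr {G : Type*} [Group G] {n : ℕ} {z : G} {T T' : ℕ → G} {a b : G}
    (h : Core n z T a b) (e : ∀ i, i + 1 < n → T i = T' i) : Core n z T' a b where
  br :=
    { braid i hi := by rw [← e i (by omega), ← e (i + 1) (by omega)]; exact h.br.braid i hi
      comm i j hij hj := by rw [← e i (by omega), ← e j hj]; exact h.br.comm i j hij hj }
  z_comm := h.z_comm
  Ta i h1 h2 := by rw [← e i h2]; exact h.Ta i h1 h2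
  Tb i h1 h2 := by rw [← e i h2]; exact h.Tb i h1 h2
  a4 hn := by rw [← e 0 (by omega)]; exact h.a4 hn
  b4 hn := by rw [← e 0 (by omega)]; exact h.b4 hn
  ab hn := by rw [← e 0 (by omega)]; exact h.ab hn
  A hn := by rw [← bigA_congr fun i hi => e i (by omega)]; exact h.A hn

theorem map_bigA {G G' : Type*} [Group G] [Group G'] (f : G →* G') (T : ℕ → G) (k : ℕ) :
    bigA (fun i => f (T i)) k = f (bigA T k) := by
  have hal : ∀ j, al (fun i => f (T i)) j = f (al T j) := by
    intro j
    induction j with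
    | zero => simp [al]
    | succ j ih => simp [al, ih]
  induction k with
  | zero => simp [bigA]
  | succ k ih => simp [bigA, ih, hal]

theorem Core.map {G G' : Type*} [Group G] [Group G'] (f : G →* G') {n : ℕ} {z : G} {T : ℕ → G}
    {a b : G} (h : Core n z T a b) (hz : ∀ g, Commute (f z) g) :
    Core n (f z) (fun i => f (T i)) (f a) (f b) where
  br :=
    { braid i hi := by simpa using congrArg f (h.br.braid i hi)
      comm i j hij hj := (h.br.comm i j hij hj).map f }
  z_comm := hz
  Ta i h1 h2 := (h.Ta i h1 h2).map f
  Tb i h1 h2 := (h.Tb i h1 h2).map f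
  a4 hn := by simpa using congrArg f (h.a4 hn)
  b4 hn := by simpa using congrArg f (h.b4 hn)
  ab hn := by simpa using congrArg f (h.ab hn)
  A hn := by simpa [map_bigA] using congrArg f (h.A hn)

/-- The parameter `v - v⁻¹` of the quadratic relation `T² = (v - v⁻¹) T + 1`. -/
noncomputable def hv : K := v - v⁻¹

theorem v_mul_v : v * v = hv * v + 1 := by
  rw [hv, sub_mul, inv_mul_cancel₀ v_ne_zero, sub_add_cancel]

/-- The generators `T_i`, extended by the scalar `v`, so that the quadratic relation holds for all
indices. -/
noncomputable def tH (n : ℕ) (i : ℕ) : (H n)ˣ :=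
  if h : i < n - 1 then T ⟨i, h⟩
  else Units.map (algebraMap K (H n)).toMonoidHom (Units.mk0 v v_ne_zero)

theorem tH_of_lt {n i : ℕ} (h : i < n - 1) : tH n i = T ⟨i, h⟩ := dif_pos h

theorem tH_eq_ext {n i : ℕ} (h : i + 1 < n) : tH n i = ext T i := by
  rw [tH_of_lt (by omega), ext_of_lt _ (by omega)]

theorem tH_quad (n i : ℕ) : (tH n i : H n) * tH n i = hv • (tH n i : H n) + 1 := by
  by_cases h : i < n - 1
  · rw [tH_of_lt h]
    exact T_sq _
  · have : (tH n i : H n) = algebraMap K (H n) v := by rw [tH, dif_neg h]; rfl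
    rw [this, ← map_mul, v_mul_v, map_add, map_one, map_mul, ← Algebra.smul_def]

theorem core_tH (n : ℕ) : Core n (scalUnit (H n)) (tH n) (ext X 0) (ext Y 0) :=
  (core_H n).congr fun _ hi => (tH_eq_ext hi).symm

/-- The generator `X_1`. -/
noncomputable abbrev xH (n : ℕ) : (H n)ˣ := ext X 0

/-- The generator `Y_1`. -/
noncomputable abbrev yH (n : ℕ) : (H n)ˣ := ext Y 0

/-- Left multiplication by units of an algebra, as invertible operators. -/
noncomputable def lU (R : Type*) [Ring R] [Algebra K R] : Rˣ →* (Module.End K R)ˣ :=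
  Units.map (Algebra.lmul K R : R →* Module.End K R)

theorem coe_lU {R : Type*} [Ring R] [Algebra K R] (u : Rˣ) :
    (lU R u : Module.End K R) = Algebra.lmul K R u := rfl

theorem lU_apply {R : Type*} [Ring R] [Algebra K R] (u : Rˣ) (x : R) :
    (lU R u : Module.End K R) x = u * x := rfl

theorem lU_tH_quad (n i : ℕ) : (lU (H n) (tH n i) : Module.End K (H n)) * lU (H n) (tH n i) =
    hv • (lU (H n) (tH n i) : Module.End K (H n)) + 1 := by
  rw [coe_lU, ← map_mul, tH_quad, map_add, map_smul, map_one]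

/-- The operators `T_i` on the module over the algebra of rank `n + 1` induced from the regular
module over the algebra of rank `n`. -/
noncomputable def tM (n : ℕ) (i : ℕ) : (Module.End K (ℕ →₀ H n))ˣ :=
  indTU n v_mul_v (lU_tH_quad n) i

/-- The operator `X_1` on the induced module. -/
noncomputable def aM (n : ℕ) : Module.End K (ℕ →₀ H n) :=
  indA hv n (fun i => lU (H n) (tH n i)) (Algebra.lmul K (H n) (xH n))

/-- The operator `Y_1` on the induced module. -/
noncomputable def bM (n : ℕ) : Module.End K (ℕ →₀ H n) :=
  indB n (Algebra.lmul K (H n) (yH n))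

theorem posCore_M {n : ℕ} (hn : 0 < n) :
    PosCore (n + 1) (algebraMap K (Module.End K (ℕ →₀ H n)) q) (tM n) (aM n) (bM n) := by
  refine posCore_ind v_mul_v (lU_tH_quad n) hn ?_
  have := ((core_tH n).map (lU (H n)) (fun g => ?_)).posCore
  · have e : (lU (H n) (scalUnit (H n)) : Module.End K (H n)) = algebraMap K _ q :=
      (Algebra.lmul K (H n)).commutes q
    rw [e] at this
    exact this
  · exact Units.ext (by
      show Algebra.lmul K (H n) (algebraMap K (H n) q) * _ = _
      rw [AlgHom.commutes]
      exact Algebra.commutes q _)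

/-- The operators on the induced module that correspond to elements of the double affine Hecke
algebra are well defined: a relation between `T_i`, `X_1` and `Y_1` in the algebra also holds in
the induced module. -/
theorem exists_relation {n : ℕ} (hn : 0 < n) :
    ∃ C : Subalgebra K (H (n + 1) × Module.End K (ℕ →₀ H n)),
      (∀ μ, ((0 : H (n + 1)), μ) ∈ C → μ = 0) ∧
      (∀ i, i < n → ((tH (n + 1) i : H (n + 1)), (tM n i : Module.End K (ℕ →₀ H n))) ∈ C) ∧
      ((xH (n + 1) : H (n + 1)), aM n) ∈ C ∧
      ((yH (n + 1) : H (n + 1)), bM n) ∈ C := by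
  obtain ⟨V, _, _, TV, aV, bV, G, qV, core, Gf, GM, GT, Ga, Gb⟩ :=
    exists_dahaModule (n := n + 1) (k := K) (M := ℕ →₀ H n) (by omega) (h := hv)
      (z := Units.mk0 q q_ne_zero) (T := tM n) (a := aM n) (b := bM n)
      (indT_quad v_mul_v (lU_tH_quad n)) (posCore_M hn)
  have core' : Core (n + 1) (scalUnit (Module.End K V)) (ext fun i : Fin (n + 1 - 1) => TV i)
      aV bV := core.congr fun i hi => by rw [ext_of_lt _ (by omega)]
  have hq : ∀ i : Fin (n + 1 - 1), ((TV i : Module.End K V) + algebraMap K _ v⁻¹) *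
      ((TV i : Module.End K V) - algebraMap K _ v) = 0 := by
    intro i
    rw [add_mul, mul_sub, mul_sub, qV, ← map_mul, inv_mul_cancel₀ v_ne_zero, map_one,
      ← (Algebra.commutes v (TV i : Module.End K V)), ← Algebra.smul_def, ← Algebra.smul_def, hv]
    rw [sub_smul]
    abel
  let θ := lift _ _ _ hq core'.finRel
  have θT : ∀ i, i < n → θ (tH (n + 1) i) = TV i := by
    intro i hi
    rw [tH_of_lt (by omega)]
    exact lift_T ..
  have θX : θ (xH (n + 1)) = aV := by
    rw [xH, ext_of_lt _ (by omega)]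
    exact lift_X ..
  have θY : θ (yH (n + 1)) = bV := by
    rw [yH, ext_of_lt _ (by omega)]
    exact lift_Y ..
  let C : Subalgebra K (H (n + 1) × Module.End K (ℕ →₀ H n)) :=
    { carrier := {p | Preserves G (θ p.1) p.2}
      mul_mem' := fun {p p'} hp hp' => by
        show Preserves G (θ (p.1 * p'.1)) (p.2 * p'.2)
        rw [map_mul]
        exact hp.mul hp'
      add_mem' := fun {p p'} hp hp' z hz => by
        show (θ (p.1 + p'.1) z.1, (p.2 + p'.2) z.2) ∈ G
        rw [map_add]
        exact G.add_mem (hp z hz) (hp' z hz)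
      algebraMap_mem' := fun c z hz => by
        show (θ (algebraMap K (H (n + 1)) c) z.1, (algebraMap K _ c : Module.End K _) z.2) ∈ G
        rw [AlgHom.commutes]
        exact G.smul_mem c hz }
  refine ⟨C, fun μ hμ => ?_, fun i hi => ?_, ?_, ?_⟩
  · refine LinearMap.ext fun m => ?_
    obtain ⟨u, hu⟩ := GM m
    have := hμ _ hu
    simp only [map_zero] at this
    exact Gf _ this
  · show Preserves G _ _
    rw [θT i hi]
    exact GT i (by omega)
  · show Preserves G _ _
    rwa [θX]
  · show Preserves G _ _
    rwa [θY]

end Relation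

/-! ### The full twist, and words in two generators -/

section Twist
variable {G : Type*} [Group G]

/-- The full twist of the braid group with generators `T_0, …, T_{r-1}`. -/
def twist : ℕ → (ℕ → G) → G
  | 0, _ => 1
  | r + 1, T => asc T (r + 1) * cyc T (r + 1) * twist r fun i => T (i + 1)

theorem commute_twist {g : G} {r : ℕ} {T : ℕ → G} (h : ∀ i < r, Commute g (T i)) :
    Commute g (twist r T) := by
  induction r generalizing T with
  | zero => exact Commute.one_right _
  | succ r ih =>
    exact ((commute_asc h).mul_right (commute_cyc h)).mul_right
      (ih fun i hi => h (i + 1) (by omega))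

theorem IsBraid.loop_comm {r : ℕ} {T : ℕ → G} (h : IsBraid (r + 2) T) {i : ℕ} (hi : i < r) :
    Commute (asc T (r + 1) * cyc T (r + 1)) (T (i + 1)) := by
  have := h.bigA_comm (i := i) (by omega)
  rw [show r + 2 - 1 = r + 1 by omega, h.bigA_eq (by omega)] at this
  exact Commute.inv_left_iff.1 this

/-- The full twist is central. -/
theorem IsBraid.twist_comm {r : ℕ} {T : ℕ → G} (h : IsBraid (r + 1) T) {i : ℕ} (hi : i < r) :
    Commute (twist r T) (T i) := by
  induction r generalizing T i with
  | zero => omega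
  | succ r ih =>
    obtain _ | i := i
    · obtain _ | r := r
      · simp only [twist, asc, cyc]
        exact (((Commute.one_left _).mul_left (Commute.refl _)).mul_left
          ((Commute.refl _).mul_left (Commute.one_left _))).mul_left (Commute.one_left _)
      · have c2 : Commute (T 0) (twist r fun i => T (i + 1 + 1)) :=
          commute_twist fun i hi => h.comm 0 (i + 1 + 1) (by omega) (by omega)
        have hl : asc T (r + 1 + 1) * cyc T (r + 1 + 1) = T 0 * (asc (fun i => T (i + 1)) (r + 1) *
            cyc (fun i => T (i + 1)) (r + 1)) * T 0 := by
          rw [asc_succ', cyc_succ']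
          group
        have c1 : Commute (asc T (r + 1 + 1) * cyc T (r + 1 + 1))
            (asc (fun i => T (i + 1)) (r + 1) * cyc (fun i => T (i + 1)) (r + 1)) :=
          (commute_asc fun i hi => h.loop_comm (by omega)).mul_right
            (commute_cyc fun i hi => h.loop_comm (by omega))
        show Commute (_ * (_ * _)) _
        rw [← mul_assoc]
        refine Commute.mul_left ?_ c2.symm
        rw [hl] at c1 ⊢
        generalize asc (fun i => T (i + 1)) (r + 1) * cyc (fun i => T (i + 1)) (r + 1) = l at *
        calc T 0 * l * T 0 * l * T 0 = T 0 * (l * (T 0 * l * T 0)) := by group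
          _ = T 0 * (T 0 * l * T 0 * l) := by rw [← c1.eq]
    · exact (h.loop_comm (by omega)).mul_left (ih h.shift (by omega))

/-- Conjugation by the full twist agrees with conjugation by `bigA` on elements that commute with
`T_1, T_2, …`. -/
theorem IsBraid.twist_conj {n : ℕ} {T : ℕ → G} (h : IsBraid n T) {a : G}
    (ha : ∀ i, 1 ≤ i → i + 1 < n → Commute (T i) a) :
    (twist (n - 1) T)⁻¹ * a * twist (n - 1) T =
      bigA T (n - 1) * a * (bigA T (n - 1))⁻¹ := by
  obtain _ | _ | r := n
  · simp [twist, bigA]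
  · simp [twist, bigA]
  · have c : Commute a (twist r fun i => T (i + 1)) :=
      commute_twist fun i hi => (ha (i + 1) (by omega) (by omega)).symm
    have c' : Commute (asc T (r + 1) * cyc T (r + 1)) (twist r fun i => T (i + 1)) :=
      commute_twist fun i hi => h.loop_comm hi
    rw [show r + 1 + 1 - 1 = r + 1 by omega, h.bigA_eq (by omega), twist, c'.eq]
    generalize asc T (r + 1) * cyc T (r + 1) = l at *
    generalize (twist r fun i => T (i + 1)) = y at *
    calc (y * l)⁻¹ * a * (y * l) = l⁻¹ * y⁻¹ * (a * y) * l := by group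
      _ = _ := by rw [c.eq]; group

end Twist

section NormalForm
variable {G : Type*} [Group G]

/-- In a group generated by `r_1`, `r_2` with `r_1 r_2⁻¹ r_1 = r_2⁻¹ r_1 r_2⁻¹ = s`, every element
is of the form `s^a w s^b` with a positive word `w`. -/
theorem exists_normalForm {r : Bool → G} {s : G} (h1 : s = r true * (r false)⁻¹ * r true)
    (h2 : s = (r false)⁻¹ * r true * (r false)⁻¹) (g : FreeGroup Bool) :
    ∃ (a b : ℤ) (l : List Bool), FreeGroup.lift r g = s ^ a * (l.map r).prod * s ^ b := by
  have e1 : s * r true = (r false)⁻¹ * s := by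
    nth_rw 1 [h2]; rw [h1]; group
  have e2 : s * r false = (r true)⁻¹ * s := by
    nth_rw 1 [h2]; rw [h1]; group
  have f1 : s * (r false)⁻¹ = r true * s := by
    rw [mul_inv_eq_iff_eq_mul, mul_assoc, e2]; group
  have f2 : s * (r true)⁻¹ = r false * s := by
    rw [mul_inv_eq_iff_eq_mul, mul_assoc, e1]; group
  have cen : ∀ b, Commute (s * s) (r b) := by
    intro b
    show s * s * r b = r b * (s * s)
    cases b
    · rw [mul_assoc, e2, ← mul_assoc, f2, mul_assoc]
    · rw [mul_assoc, e1, ← mul_assoc, f1, mul_assoc]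
  have cen' : ∀ b (t : ℤ), Commute ((s * s) ^ t) (r b) := fun b t => (cen b).zpow_left t
  have hss : ∀ t : ℤ, (s * s) ^ t = s ^ (2 * t) := fun t => by
    rw [zpow_mul, zpow_two]
  have g1 : r true * s * r true = r false * (s * s) := by
    have : r true * (r false)⁻¹ = r false * s := by
      rw [h2]; group
    rw [mul_assoc, e1, ← mul_assoc, this, mul_assoc]
  have g2 : r false * s * r false = r true := by
    have : r false * (r true)⁻¹ = r true * s⁻¹ := by
      rw [h1]; group
    rw [mul_assoc, e2, ← mul_assoc, this, inv_mul_cancel_right]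
  let E : G → Prop := fun x => ∃ (a b : ℤ) (l : List Bool), x = s ^ a * (l.map r).prod * s ^ b
  have hs : ∀ (c : ℤ) x, E x → E (s ^ c * x) := by
    rintro c _ ⟨a, b, l, rfl⟩
    exact ⟨c + a, b, l, by rw [zpow_add]; simp only [mul_assoc]⟩
  have hr : ∀ i x, E x → E (r i * x) := by
    rintro i _ ⟨a, b, l, rfl⟩
    obtain ⟨t, rfl | rfl⟩ := Int.even_or_odd' a
    · refine ⟨2 * t, b, i :: l, ?_⟩
      rw [← hss, List.map_cons, List.prod_cons, ← mul_assoc, ← mul_assoc, ← (cen' i t).eq]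
      simp only [mul_assoc]
    · have e : r i * (s ^ (2 * t + 1) * (l.map r).prod * s ^ b) =
          s ^ (2 * t) * (r i * s * (l.map r).prod * s ^ b) := by
        rw [zpow_add_one, ← hss]
        calc _ = (r i * (s * s) ^ t) * s * (l.map r).prod * s ^ b := by simp only [mul_assoc]
          _ = _ := by rw [← (cen' i t).eq]; simp only [mul_assoc]
      rw [e]
      apply hs
      obtain _ | ⟨j, l⟩ := l
      · exact ⟨0, 1 + b, [i], by rw [zpow_add]; simp [mul_assoc]⟩
      · rw [List.map_cons, List.prod_cons, ← mul_assoc (r i * s)]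
        cases i <;> cases j
        · exact ⟨0, b, true :: l, by rw [g2]; simp⟩
        · refine ⟨1, b, l, ?_⟩
          rw [mul_assoc (r false), e1]; simp
        · refine ⟨1, b, l, ?_⟩
          rw [mul_assoc (r true), e2]; simp
        · refine ⟨2, b, false :: l, ?_⟩
          rw [g1, ← (cen false).eq, zpow_two]; simp [mul_assoc]
  have hri : ∀ i x, E x → E ((r i)⁻¹ * x) := by
    intro i x hx
    have : (r i)⁻¹ * x = s ^ (1 : ℤ) * (r (!i) * (s ^ (-1 : ℤ) * x)) := by
      cases i
      · rw [zpow_one, zpow_neg_one, Bool.not_false, ← mul_assoc, ← mul_assoc, e1]; group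
      · rw [zpow_one, zpow_neg_one, Bool.not_true, ← mul_assoc, ← mul_assoc, e2]; group
    rw [this]
    exact hs _ _ (hr _ _ (hs _ _ hx))
  have key : ∀ x, E x → E (FreeGroup.lift r g * x) := by
    induction g using FreeGroup.induction_on with
    | C1 => intro x hx; rwa [map_one, one_mul]
    | of b => intro x hx; rw [FreeGroup.lift_apply_of]; exact hr b x hx
    | inv_of b _ => intro x hx; rw [map_inv, FreeGroup.lift_apply_of]; exact hri b x hx
    | mul a b ha hb => intro x hx; rw [map_mul, mul_assoc]; exact ha _ (hb _ hx)
  have := key 1 ⟨0, 0, [], by simp⟩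
  rwa [mul_one] at this

end NormalForm

/-! ### Independence of the word -/

section Matrices
open Matrix

/-- The matrix of `ρ₁ ρ₂⁻¹ ρ₁`. -/
def sSL : SpecialLinearGroup (Fin 2) ℤ := A1 * A2⁻¹ * A1

theorem sl_mul_apply (g h : SpecialLinearGroup (Fin 2) ℤ) (i j : Fin 2) :
    (g * h).1 i j = g.1 i 0 * h.1 0 j + g.1 i 1 * h.1 1 j := by
  show (g.1 * h.1) i j = _
  rw [Matrix.mul_apply, Fin.sum_univ_two]

/-- The matrix of a positive word. -/
def posMat (l : List Bool) : SpecialLinearGroup (Fin 2) ℤ :=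
  (l.map fun b => if b then A1 else A2).prod

/-- A positive word has a matrix with nonnegative entries and positive diagonal, which is diagonal
only for the empty word. -/
theorem posMat_entries (l : List Bool) :
    1 ≤ (posMat l).1 0 0 ∧ 0 ≤ (posMat l).1 0 1 ∧ 0 ≤ (posMat l).1 1 0 ∧ 1 ≤ (posMat l).1 1 1 ∧
      (l ≠ [] → 1 ≤ (posMat l).1 0 1 + (posMat l).1 1 0) := by
  induction l with
  | nil => simp [posMat]
  | cons b l ih =>
    obtain ⟨h1, h2, h3, h4, -⟩ := ih
    have e : posMat (b :: l) = (if b then A1 else A2) * posMat l := by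
      simp [posMat]
    rw [e]
    generalize posMat l = W at *
    cases b
    · have c1 : A2.1 0 0 = 1 := rfl
      have c2 : A2.1 0 1 = 1 := rfl
      have c3 : A2.1 1 0 = 0 := rfl
      have c4 : A2.1 1 1 = 1 := rfl
      simp only [Bool.false_eq_true, if_false, sl_mul_apply, c1, c2, c3, c4, one_mul, zero_mul]
      omega
    · have c1 : A1.1 0 0 = 1 := rfl
      have c2 : A1.1 0 1 = 0 := rfl
      have c3 : A1.1 1 0 = 1 := rfl
      have c4 : A1.1 1 1 = 1 := rfl
      simp only [if_true, sl_mul_apply, c1, c2, c3, c4, one_mul, zero_mul]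
      omega

/-- The matrix `sSL` has order four, and its powers other than `1` have an upper left entry `≤ 0`,
so only the trivial one is the matrix of a positive word. -/
theorem eq_one_of_posMat {l : List Bool} {c : ℤ}
    (h : posMat l = sSL ^ c) :
    l = [] ∧ ∃ t : ℤ, c = 4 * t := by
  obtain ⟨h1, -, -, -, h5⟩ := posMat_entries l
  rw [h] at h1 h5
  have h4 : sSL ^ (4 : ℤ) = 1 := by decide
  obtain ⟨t, r, hr, hr', rfl⟩ : ∃ t r : ℤ, 0 ≤ r ∧ r < 4 ∧ c = 4 * t + r :=
    ⟨c / 4, c % 4, Int.emod_nonneg _ (by norm_num), Int.emod_lt_of_pos _ (by norm_num), by omega⟩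
  rw [_root_.zpow_add, _root_.zpow_mul, h4, _root_.one_zpow, one_mul] at h1 h5
  have hr0 : r = 0 := by
    by_contra hne
    obtain rfl | rfl | rfl : r = 1 ∨ r = 2 ∨ r = 3 := by omega
    all_goals revert h1; decide
  subst hr0
  refine ⟨?_, t, by omega⟩
  by_contra hl
  have := h5 hl
  revert this
  decide

theorem eq_zpow_A1_of_act_eq {g : SpecialLinearGroup (Fin 2) ℤ} {e : ℤ} (he : 0 < e)
    (h : act g (0, e) = (0, e)) : ∃ t : ℤ, g = A1 ^ t := by
  have e1 : g.1 0 1 * e = 0 := by simpa [act] using congrArg Prod.fst h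
  have e2 : g.1 1 1 * e = e := by simpa [act] using congrArg Prod.snd h
  have f1 : g.1 0 1 = 0 := by
    rcases mul_eq_zero.1 e1 with h | h
    · exact h
    · omega
  have f2 : g.1 1 1 = 1 := by
    have : (g.1 1 1 - 1) * e = 0 := by rw [sub_mul, e2]; ring
    rcases mul_eq_zero.1 this with h | h <;> omega
  have f3 : g.1 0 0 = 1 := by
    have := g.2
    rw [det_fin_two, f1, f2] at this
    linarith
  have hA : ∀ t : ℤ, (A1 ^ t).1 = !![1, 0; t, 1] := by
    have hn : ∀ t : ℕ, (A1 ^ t).1 = !![1, 0; (t : ℤ), 1] := by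
      intro t
      induction t with
      | zero => ext i j; fin_cases i <;> fin_cases j <;> simp
      | succ t ih =>
        ext i j
        rw [pow_succ, sl_mul_apply, ih]
        fin_cases i <;> fin_cases j <;> simp [A1]
    intro t
    obtain ⟨t, rfl | rfl⟩ := t.eq_nat_or_neg
    · rw [_root_.zpow_natCast, hn]
    · have e : ((A1 ^ t)⁻¹).1 = adjugate (A1 ^ t).1 := Matrix.SpecialLinearGroup.coe_inv _
      rw [_root_.zpow_neg, _root_.zpow_natCast, e, hn, adjugate_fin_two]
      ext i j; fin_cases i <;> fin_cases j <;> simp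
  refine ⟨g.1 1 0, Subtype.ext ?_⟩
  rw [hA]
  ext i j; fin_cases i <;> fin_cases j <;> simp [f1, f2, f3]

theorem gcd_act (g : SpecialLinearGroup (Fin 2) ℤ) (e : ℕ) :
    Int.gcd (act g (0, (e : ℤ))).1 (act g (0, (e : ℤ))).2 = e := by
  have hc : Int.gcd (g.1 0 1) (g.1 1 1) = 1 := by
    rw [← Int.isCoprime_iff_gcd_eq_one]
    refine ⟨-g.1 1 0, g.1 0 0, ?_⟩
    have := g.2
    rw [det_fin_two] at this
    linarith
  simp [act, Int.gcd_mul_right, hc]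

end Matrices

section Independence
variable {n : ℕ}

/-- The action of an automorphism on units. -/
noncomputable abbrev aU (f : H n ≃ₐ[K] H n) : (H n)ˣ →* (H n)ˣ := onUnits (f : H n →ₐ[K] H n)

theorem aU_mul (f g : H n ≃ₐ[K] H n) (u : (H n)ˣ) : aU (f * g) u = aU f (aU g u) := rfl

theorem aut_ext {f g : H n ≃ₐ[K] H n} (hf : ∀ i : Fin (n - 1), aU f (T i) = T i)
    (hg : ∀ i : Fin (n - 1), aU g (T i) = T i) (hX : aU f (xH n) = aU g (xH n))
    (hY : aU f (yH n) = aU g (yH n)) : f = g := by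
  have := end_ext hf hg hX hY
  ext x
  exact DFunLike.congr_fun this x

theorem rho1_T' (i : Fin (n - 1)) : aU (rho1 n) (T i) = T i := (rho1_spec n).1 i
theorem rho1_x : aU (rho1 n) (xH n) = xH n * yH n := (rho1_spec n).2.1
theorem rho1_y : aU (rho1 n) (yH n) = yH n := (rho1_spec n).2.2
theorem rho2_x : aU (rho2 n) (xH n) = xH n := (rho2_spec n).2.1
theorem rho2_y : aU (rho2 n) (yH n) = yH n * xH n := (rho2_spec n).2.2
theorem rho1_inv_x : aU (rho1 n)⁻¹ (xH n) = xH n * (yH n)⁻¹ := (rho1Inv_spec n).2.1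
theorem rho1_inv_y : aU (rho1 n)⁻¹ (yH n) = yH n := (rho1Inv_spec n).2.2
theorem rho2_inv_T (i : Fin (n - 1)) : aU (rho2 n)⁻¹ (T i) = T i := (rho2Inv_spec n).1 i
theorem rho2_inv_x : aU (rho2 n)⁻¹ (xH n) = xH n := (rho2Inv_spec n).2.1
theorem rho2_inv_y : aU (rho2 n)⁻¹ (yH n) = yH n * (xH n)⁻¹ := (rho2Inv_spec n).2.2

/-- The automorphism `ρ₁ ρ₂⁻¹ ρ₁`. -/
noncomputable def sAut (n : ℕ) : H n ≃ₐ[K] H n := rho1 n * (rho2 n)⁻¹ * rho1 n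

theorem sAut_T (i : Fin (n - 1)) : aU (sAut n) (T i) = T i := by
  rw [sAut, aU_mul, aU_mul, rho1_T', rho2_inv_T, rho1_T']

theorem sAut_x : aU (sAut n) (xH n) = xH n * yH n * (xH n)⁻¹ := by
  rw [sAut, aU_mul, aU_mul, rho1_x]
  simp only [map_mul, map_inv, rho2_inv_x, rho2_inv_y, rho1_x, rho1_y]
  group

theorem sAut_y : aU (sAut n) (yH n) = (xH n)⁻¹ := by
  rw [sAut, aU_mul, aU_mul, rho1_y]
  simp only [map_mul, map_inv, rho2_inv_y, rho1_x, rho1_y]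
  group

/-- The relation of `SL(2, ℤ)` (the braid relation on three strands) between `ρ₁` and `ρ₂⁻¹`. -/
theorem sAut_eq (n : ℕ) : sAut n = (rho2 n)⁻¹ * rho1 n * (rho2 n)⁻¹ := by
  refine aut_ext sAut_T (fun i => ?_) ?_ ?_
  · rw [aU_mul, aU_mul, rho2_inv_T, rho1_T', rho2_inv_T]
  · rw [sAut_x, aU_mul, aU_mul]
    simp only [map_mul, rho2_inv_x, rho2_inv_y, rho1_x]
    group
  · rw [sAut_y, aU_mul, aU_mul]
    simp only [map_mul, map_inv, rho2_inv_x, rho2_inv_y, rho1_x, rho1_y]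
    group

/-- Conjugation by a unit. -/
noncomputable def conjHom (u : (H n)ˣ) : H n →ₐ[K] H n where
  toFun x := u * x * ↑u⁻¹
  map_one' := by simp
  map_mul' x y := by
    simp only [mul_assoc, Units.inv_mul_cancel_left]
  map_zero' := by simp
  map_add' x y := by rw [mul_add, add_mul]
  commutes' c := by rw [← Algebra.commutes, mul_assoc, Units.mul_inv, mul_one]

theorem onUnits_conjHom (u w : (H n)ˣ) : onUnits (conjHom u) w = u * w * u⁻¹ := Units.ext rfl

/-- The fourth power of `ρ₁ ρ₂⁻¹ ρ₁` is conjugation by the inverse of the full twist. -/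
theorem sAut_pow_four (hn : 0 < n) (x : H n) :
    (sAut n ^ 4) x = ↑(twist (n - 1) (tH n))⁻¹ * x * twist (n - 1) (tH n) := by
  have core := core_tH n
  have br : IsBraid (n - 1 + 1) (tH n) := by rw [Nat.sub_add_cancel hn]; exact core.br
  have hconj : ∀ w, onUnits (conjHom (twist (n - 1) (tH n))⁻¹) w =
      (twist (n - 1) (tH n))⁻¹ * w * twist (n - 1) (tH n) := fun w => by
    rw [onUnits_conjHom, inv_inv]
  -- the commutator of `X_1` and `Y_1` is a multiple of `bigA`
  have hc : xH n * yH n * (xH n)⁻¹ * (yH n)⁻¹ = (scalUnit (H n))⁻¹ * bigA (tH n) (n - 1) := by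
    have := core.A hn
    have : xH n * yH n = (scalUnit (H n))⁻¹ * (bigA (tH n) (n - 1) * yH n * xH n) := by
      rw [this]; group
    rw [this]; group
  have hcc : ∀ w : (H n)ˣ, xH n * yH n * (xH n)⁻¹ * (yH n)⁻¹ * w *
      (xH n * yH n * (xH n)⁻¹ * (yH n)⁻¹)⁻¹ =
      bigA (tH n) (n - 1) * w * (bigA (tH n) (n - 1))⁻¹ := by
    intro w
    rw [hc]
    have cz := (core.z_comm (bigA (tH n) (n - 1) * w * (bigA (tH n) (n - 1))⁻¹)).eq
    calc _ = (scalUnit (H n))⁻¹ * ((bigA (tH n) (n - 1) * w * (bigA (tH n) (n - 1))⁻¹) *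
          scalUnit (H n)) := by group
      _ = _ := by rw [← cz]; group
  have e4 : ∀ u, aU (sAut n ^ 4) u = aU (sAut n) (aU (sAut n) (aU (sAut n) (aU (sAut n) u))) :=
    fun u => rfl
  have key : ((sAut n ^ 4 : H n ≃ₐ[K] H n) : H n →ₐ[K] H n) =
      conjHom (twist (n - 1) (tH n))⁻¹ := by
    refine end_ext (fun i => ?_) (fun i => ?_) ?_ ?_
    · have := e4 (T i)
      simp only [sAut_T] at this
      exact this
    · rw [hconj]
      have c := br.twist_comm (i := i) i.2
      rw [tH_of_lt i.2] at c
      rw [mul_assoc, ← c.eq, inv_mul_cancel_left]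
    · rw [hconj, core.br.twist_conj core.Ta]
      refine (e4 (xH n)).trans ?_
      rw [← hcc]
      simp only [sAut_x, sAut_y, map_mul, map_inv]
      group
    · rw [hconj, core.br.twist_conj core.Tb]
      refine (e4 (yH n)).trans ?_
      rw [← hcc]
      simp only [sAut_x, sAut_y, map_mul, map_inv]
      group
  have := DFunLike.congr_fun key x
  refine this.trans ?_
  show _ * x * _ = _
  rw [inv_inv]

theorem T_mul_S (i : Fin (n - 1)) : (T i : H n) * S n = v • S n := by
  rw [S, mul_smul_comm, T_mul_Stilde, smul_comm]

theorem tH_mul_S (i : ℕ) : (tH n i : H n) * S n = v • S n := by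
  by_cases h : i < n - 1
  · rw [tH_of_lt h, T_mul_S]
  · have : (tH n i : H n) = algebraMap K (H n) v := by rw [tH, dif_neg h]; rfl
    rw [this, ← Algebra.smul_def]

/-- The full twist acts on `S` by a nonzero scalar. -/
theorem twist_mul_S (r : ℕ) (f : ℕ → (H n)ˣ) (hf : ∀ i, (f i : H n) * S n = v • S n) :
    ∃ c : K, c ≠ 0 ∧ (↑(twist r f) : H n) * S n = c • S n := by
  have hm : ∀ {u w : (H n)ˣ}, (∃ c : K, c ≠ 0 ∧ (u : H n) * S n = c • S n) →
      (∃ c : K, c ≠ 0 ∧ (w : H n) * S n = c • S n) →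
      ∃ c : K, c ≠ 0 ∧ ((u * w : (H n)ˣ) : H n) * S n = c • S n := by
    rintro u w ⟨c, hc, hu⟩ ⟨d, hd, hw⟩
    exact ⟨d * c, mul_ne_zero hd hc, by
      rw [Units.val_mul, mul_assoc, hw, mul_smul_comm, hu, smul_smul]⟩
  have h1 : ∃ c : K, c ≠ 0 ∧ ((1 : (H n)ˣ) : H n) * S n = c • S n := ⟨1, one_ne_zero, by simp⟩
  have hasc : ∀ (f : ℕ → (H n)ˣ), (∀ i, (f i : H n) * S n = v • S n) → ∀ k,
      ∃ c : K, c ≠ 0 ∧ (↑(asc f k) : H n) * S n = c • S n := by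
    intro f hf k
    induction k with
    | zero => exact h1
    | succ k ih => exact hm ih ⟨v, v_ne_zero, hf k⟩
  have hcyc : ∀ (f : ℕ → (H n)ˣ), (∀ i, (f i : H n) * S n = v • S n) → ∀ k,
      ∃ c : K, c ≠ 0 ∧ (↑(cyc f k) : H n) * S n = c • S n := by
    intro f hf k
    induction k with
    | zero => exact h1
    | succ k ih => exact hm ⟨v, v_ne_zero, hf k⟩ ih
  induction r generalizing f with
  | zero => exact h1
  | succ r ih =>
    exact hm (hm (hasc f hf _) (hcyc f hf _)) (ih _ fun i => hf (i + 1))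

theorem rho_true : rho n (FreeGroup.of true) = rho1 n := by simp [rho]

theorem rho_false : rho n (FreeGroup.of false) = rho2 n := by simp [rho]

theorem sAut_S : sAut n (S n) = S n := by
  have := rho_S (n := n) (FreeGroup.of true * (FreeGroup.of false)⁻¹ * FreeGroup.of true)
  rwa [map_mul, map_mul, map_inv, rho_true, rho_false] at this

theorem sAut_pow_four_spherical (hn : 0 < n) (x : H n) :
    (sAut n ^ 4) (S n * x * S n) = S n * x * S n := by
  obtain ⟨c, hc, hS⟩ := twist_mul_S (n - 1) (tH n) tH_mul_S
  have hS' : ↑(twist (n - 1) (tH n))⁻¹ * S n = c⁻¹ • S n := by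
    rw [Units.inv_mul_eq_iff_eq_mul, mul_smul_comm, hS, smul_smul, inv_mul_cancel₀ hc, one_smul]
  have hfix : (sAut n ^ 4) (S n) = S n := by
    show sAut n (sAut n (sAut n (sAut n (S n)))) = S n
    simp only [sAut_S]
  -- the full twist commutes with `S`
  have hSc : S n * twist (n - 1) (tH n) = c • S n := by
    rw [sAut_pow_four hn, mul_assoc, Units.inv_mul_eq_iff_eq_mul] at hfix
    rw [hfix, hS]
  rw [sAut_pow_four hn]
  calc _ = (↑(twist (n - 1) (tH n))⁻¹ * S n) * x * (S n * twist (n - 1) (tH n)) := by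
        simp only [mul_assoc]
    _ = _ := by
        rw [hS', hSc, smul_mul_assoc, smul_mul_assoc, mul_smul_comm, smul_smul,
          inv_mul_cancel₀ hc, one_smul]

/-- A word with trivial matrix acts trivially on the spherical algebra. -/
theorem rho_spherical_of_toSL_eq_one (hn : 0 < n) {g : FreeGroup Bool} (hg : toSL g = 1) (x : H n) :
    rho n g (S n * x * S n) = S n * x * S n := by
  let r : Bool → (H n ≃ₐ[K] H n) × Matrix.SpecialLinearGroup (Fin 2) ℤ := fun b =>
    (if b then rho1 n else rho2 n, if b then A1 else A2)
  have hr : ∀ g, FreeGroup.lift r g = (rho n g, toSL g) := by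
    intro g
    have : FreeGroup.lift r = (rho n).prod toSL := FreeGroup.ext_hom _ _ fun b => by
      simp [r, rho, toSL]
    rw [this]
    rfl
  obtain ⟨a, b, l, e⟩ := exists_normalForm (r := r) (s := (sAut n, sSL)) rfl
    (Prod.ext (sAut_eq n) (show sSL = A2⁻¹ * A1 * A2⁻¹ by decide)) g
  have hl : ((l.map r).prod).2 = posMat l := by
    have := map_list_prod (MonoidHom.snd (H n ≃ₐ[K] H n) (Matrix.SpecialLinearGroup (Fin 2) ℤ))
      (l.map r)
    rw [List.map_map] at this
    exact this
  rw [hr, hg] at e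
  have e1 : rho n g = sAut n ^ a * ((l.map r).prod).1 * sAut n ^ b := congrArg Prod.fst e
  have e2 : 1 = sSL ^ a * ((l.map r).prod).2 * sSL ^ b := congrArg Prod.snd e
  rw [hl] at e2
  obtain ⟨rfl, t, ht⟩ := eq_one_of_posMat (l := l) (c := -a - b) (by
    rw [zpow_sub, zpow_neg, eq_mul_inv_iff_mul_eq, eq_inv_iff_mul_eq_one]
    exact mul_eq_one_comm.1 (by rw [← mul_assoc]; exact e2.symm))
  have h4 := sAut_pow_four_spherical hn x
  have h5 := (MulAction.stabilizer (H n ≃ₐ[K] H n) (S n * x * S n)).zpow_mem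
    (MulAction.mem_stabilizer_iff.2 h4) (-t)
  have e3 : rho n g = (sAut n ^ 4) ^ (-t) := by
    rw [e1]
    simp only [List.map_nil, List.prod_nil, Prod.fst_one, mul_one]
    rw [← zpow_add, ← zpow_natCast, ← zpow_mul]
    congr 1
    push_cast
    omega
  rw [e3]
  exact MulAction.mem_stabilizer_iff.1 h5

theorem rho1_Y (j : Fin n) : rho1 n (Y j : H n) = Y j := lift_Y ..

theorem rho1_P0 (e : ℕ) : rho1 n (P0 n e) = P0 n e := by
  have h1 := map_S (rho1 n) rho1_T
  simp only [P0, map_mul, map_sum, map_pow, h1, rho1_Y]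

theorem rho_P0_of_toSL_eq {g : FreeGroup Bool} {t : ℤ} (hn : 0 < n) (h : toSL g = A1 ^ t) (e : ℕ) :
    rho n g (P0 n e) = P0 n e := by
  have h1 := rho_spherical_of_toSL_eq_one hn (g := g * (FreeGroup.of true) ^ (-t))
    (by rw [map_mul, h, map_zpow]; simp [toSL]) (∑ i : Fin n, (Y i : H n) ^ e)
  have h2 := (MulAction.stabilizer (H n ≃ₐ[K] H n) (P0 n e)).zpow_mem
    (MulAction.mem_stabilizer_iff.2 (rho1_P0 e)) (-t)
  have h3 : (rho1 n ^ (-t)) (P0 n e) = P0 n e := MulAction.mem_stabilizer_iff.1 h2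
  have h4 : rho n (g * (FreeGroup.of true) ^ (-t)) = rho n g * rho1 n ^ (-t) := by
    rw [map_mul, map_zpow, rho_true]
  rw [h4] at h1
  nth_rw 1 [← h3]
  exact h1

/-- The element `ρ(g) (S ∑ Y_i^e S)` depends only on the vector `g (0, e)`. -/
theorem rhoP_eq_of_act_eq (hn : 0 < n) {g g' : FreeGroup Bool} {e : ℕ} (he : 0 < e)
    (h : act (toSL g) (0, (e : ℤ)) = act (toSL g') (0, (e : ℤ))) : rhoP n g e = rhoP n g' e := by
  have hf : act (toSL (g'⁻¹ * g)) (0, (e : ℤ)) = (0, (e : ℤ)) := by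
    rw [map_mul, act_mul, h, ← act_mul, ← map_mul, inv_mul_cancel, map_one]
    simp [act]
  obtain ⟨t, ht⟩ := eq_zpow_A1_of_act_eq (by exact_mod_cast he) hf
  have := rho_P0_of_toSL_eq hn ht e
  rw [map_mul, map_inv, AlgEquiv.mul_apply] at this
  refine Subtype.ext ?_
  show rho n g (P0 n e) = rho n g' (P0 n e)
  have h2 := congrArg (rho n g') this
  rwa [← AlgEquiv.mul_apply, mul_inv_cancel, AlgEquiv.one_apply] at h2

/-- The element `P_x` may be computed with any word. -/
theorem P_act (hn : 0 < n) (g : FreeGroup Bool) {e : ℕ} (he : 0 < e) :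
    P n (act (toSL g) (0, (e : ℤ))) = rhoP n g e := by
  have h := (exists_toSL (act (toSL g) (0, (e : ℤ)))).choose_spec
  unfold P
  generalize (exists_toSL (act (toSL g) (0, (e : ℤ)))).choose = w at h
  rw [gcd_act] at h ⊢
  exact rhoP_eq_of_act_eq hn he h

/-- The automorphisms `ρ(w)` permute the elements `P_x`. -/
theorem rho_P (hn : 0 < n) (w : FreeGroup Bool) {x : ℤ × ℤ} (hx : x ≠ (0, 0)) :
    rho n w (P n x).1 = (P n (act (toSL w) x)).1 := by
  have he : 0 < Int.gcd x.1 x.2 := by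
    refine Nat.pos_of_ne_zero fun h => hx ?_
    obtain ⟨h1, h2⟩ := Int.gcd_eq_zero_iff.1 h
    exact Prod.ext h1 h2
  obtain ⟨g, hg⟩ := exists_toSL x
  have h1 : P n x = rhoP n g (Int.gcd x.1 x.2) := by
    rw [← P_act hn g he, hg]
  have h2 : P n (act (toSL w) x) = rhoP n (w * g) (Int.gcd x.1 x.2) := by
    rw [← P_act hn (w * g) he, map_mul, act_mul, hg]
  rw [h1, h2]
  show rho n w (rho n g _) = rho n (w * g) _
  rw [map_mul, AlgEquiv.mul_apply]

end Independence

/-! ### The symmetrizer and power sums -/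

section RightS
variable {n : ℕ}

theorem len_inv (w : Equiv.Perm (Fin n)) : len w⁻¹ = len w := by
  have h : ∀ w : Equiv.Perm (Fin n), len w⁻¹ ≤ len w := by
    intro w
    obtain ⟨l, hl, hlen⟩ := exists_word w
    have : wordPerm l.reverse = w⁻¹ := by
      rw [← hl, wordPerm, wordPerm, List.prod_inv_reverse, List.map_map, ← List.map_reverse]
      congr 2
    rw [← this, ← hlen, ← List.length_reverse]
    exact len_wordPerm_le _
  exact le_antisymm (h w) (by simpa using h w⁻¹)

theorem Tw_mul_T {i : Fin (n - 1)} {w : Equiv.Perm (Fin n)} (h : Up i w⁻¹) :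
    Tw (w * s i) = Tw w * (T i : H n) := by
  have h1 := isReduced_iff.1 (redWord_spec w)
  have hlen : len (w * s i) = len w + 1 := by
    rw [← len_inv (w * s i), mul_inv_rev, s_inv, len_up h, len_inv]
  have := prod_reduced (fun i => (T i : H n))
    (fun i j e => congrArg Units.val ((finRel_H n).braid i j e))
    (fun i j e => congrArg Units.val ((finRel_H n).TT i j e)) (w * s i) (redWord (w * s i))
    (redWord w ++ [i]) (isReduced_iff.1 (redWord_spec _))
    ⟨by rw [wordPerm, List.map_append, List.prod_append]; simpa [wordPerm] using h1.1,
      by rw [List.length_append, h1.2, hlen]; rfl⟩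
  rw [Tw, this, List.map_append, List.prod_append]
  simp [Tw]

theorem Stilde_mul_T (i : Fin (n - 1)) : Stilde n * (T i : H n) = v • Stilde n := by
  classical
  have hs : ∀ w : Equiv.Perm (Fin n), w * s i * s i = w := fun w => by
    rw [mul_assoc, s_s, mul_one]
  have hup : ∀ w : Equiv.Perm (Fin n), Up i (w * s i)⁻¹ ↔ ¬ Up i w⁻¹ := fun w => by
    rw [mul_inv_rev, s_inv, up_s_iff]
  have hsplit : Stilde n = ∑ w ∈ Finset.univ.filter (fun w : Equiv.Perm (Fin n) => Up i w⁻¹),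
      (v ^ len w • Tw w + v ^ (len w + 1) • (Tw w * (T i : H n))) := by
    unfold Stilde
    rw [← Finset.sum_filter_add_sum_filter_not Finset.univ
      (fun w : Equiv.Perm (Fin n) => Up i w⁻¹), Finset.sum_add_distrib]
    congr 1
    refine Finset.sum_bij' (fun w _ => w * s i) (fun w _ => w * s i) ?_ ?_ ?_ ?_ ?_
    · intro w hw
      simpa only [Finset.mem_filter, Finset.mem_univ, true_and, hup] using hw
    · intro w hw
      simpa only [Finset.mem_filter, Finset.mem_univ, true_and, hup, not_not] using hw
    · intro w _; exact hs w
    · intro w _; exact hs w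
    · intro w hw
      have hw : ¬ Up i w⁻¹ := by simpa using hw
      have hu := (hup w).2 hw
      have e := Tw_mul_T hu
      have hl : len (w * s i) + 1 = len w := by
        have := len_up hu
        rw [mul_inv_rev, s_inv, s_mul_s_mul, len_inv, ← s_inv, ← mul_inv_rev, len_inv] at this
        exact this.symm
      rw [hs] at e
      rw [← e, hl]
  rw [hsplit, Finset.sum_mul, Finset.smul_sum]
  refine Finset.sum_congr rfl fun w _ => ?_
  rw [add_mul, smul_mul_assoc, smul_mul_assoc, mul_assoc, T_sq, mul_add, mul_one, mul_smul_comm]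
  exact smul_aux v_ne_zero _ _ _

theorem S_mul_tH (i : ℕ) : S n * (tH n i : H n) = v • S n := by
  by_cases h : i < n - 1
  · rw [tH_of_lt h, S, smul_mul_assoc, Stilde_mul_T, smul_comm]
  · have : (tH n i : H n) = algebraMap K (H n) v := by rw [tH, dif_neg h]; rfl
    rw [this, ← Algebra.commutes, ← Algebra.smul_def]

/-- The symmetrizer `[n]⁺!⁻¹ ∑_w v^{l(w)} t_w`, for a family `t`. -/
noncomputable def symm {A : Type*} [Semiring A] [Algebra K A] (n : ℕ) (t : ℕ → A) : A :=
  (qFact n)⁻¹ • ∑ w : Equiv.Perm (Fin n), v ^ len w •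
    ((redWord w).map fun i : Fin (n - 1) => t i.val).prod

theorem symm_tH : symm n (fun i => (tH n i : H n)) = S n := by
  have : ∀ i : Fin (n - 1), tH n i = T i := fun i => tH_of_lt i.2
  simp only [symm, S, Stilde, Tw, this]

theorem map_symm {A B : Type*} [Semiring A] [Algebra K A] [Semiring B] [Algebra K B] (f : A →ₐ[K] B)
    (t : ℕ → A) : f (symm n t) = symm n fun i => f (t i) := by
  simp only [symm, map_smul, map_sum, map_list_prod, List.map_map, Function.comp_def]

theorem symm_mem {A : Type*} [Semiring A] [Algebra K A] {C : Subalgebra K A} {t : ℕ → A}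
    (h : ∀ i, i + 1 < n → t i ∈ C) : symm n t ∈ C := by
  refine C.smul_mem (C.sum_mem fun w _ => C.smul_mem (C.list_prod_mem fun x hx => ?_) _) _
  obtain ⟨i, -, rfl⟩ := List.mem_map.1 hx
  exact h i (by omega)

theorem symm_commute {A : Type*} [Semiring A] [Algebra K A] {t : ℕ → A} {y : A}
    (h : ∀ i, i + 1 < n → Commute (t i) y) : Commute (symm n t) y := by
  have : symm n t ∈ Subalgebra.centralizer K {y} := symm_mem fun i hi => by
    rw [Subalgebra.mem_centralizer_iff]
    rintro g rfl
    exact (h i hi).eq.symm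
  rw [Subalgebra.mem_centralizer_iff] at this
  exact (this y rfl).symm

/-- A linear map on which all `t_i` act by `v` does not see the symmetrizer. -/
theorem apply_symm {M N : Type*} [AddCommGroup M] [Module K M] [AddCommGroup N] [Module K N]
    {t : ℕ → Module.End K M} {ψ : M →ₗ[K] N} (h : ∀ i, i + 1 < n → ∀ x, ψ (t i x) = v • ψ x)
    (x : M) : ψ (symm n t x) = ψ x := by
  have hw : ∀ (l : List (Fin (n - 1))) x,
      ψ ((l.map fun i : Fin (n - 1) => t i.val).prod x) = v ^ l.length • ψ x := by
    intro l
    induction l with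
    | nil => intro x; simp
    | cons i l ih =>
      intro x
      rw [List.map_cons, List.prod_cons, Module.End.mul_apply, h i (by omega), ih, smul_smul,
        List.length_cons, pow_succ']
  simp only [symm, LinearMap.smul_apply, LinearMap.sum_apply, map_smul, map_sum, hw,
    length_redWord, smul_smul]
  rw [← Finset.sum_smul, smul_smul]
  have : ∑ w : Equiv.Perm (Fin n), v ^ len w * v ^ len w = qFact n := by
    rw [qFact_eq_sum]
    refine Finset.sum_congr rfl fun w _ => ?_
    ring
  rw [this, inv_mul_cancel₀ (qFact_ne_zero n), one_smul]

end RightS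

section PowerSums

/-- Newton's recursion for power sums in two variables. -/
theorem commute_pow_add_pow {R : Type*} [Ring R] {t y y' : R} (c : Commute y y')
    (h1 : Commute t (y + y')) (h2 : Commute t (y * y')) (e : ℕ) : Commute t (y ^ e + y' ^ e) := by
  induction e using Nat.strong_induction_on with
  | _ e ih =>
    obtain _ | _ | e := e
    · simp only [pow_zero]
      exact (Commute.one_right t).add_right (Commute.one_right t)
    · simpa using h1
    · have : y ^ (e + 1 + 1) + y' ^ (e + 1 + 1) =
          (y + y') * (y ^ (e + 1) + y' ^ (e + 1)) - y * y' * (y ^ e + y' ^ e) := by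
        have e1 : y * y' * y ^ e = y' * y ^ (e + 1) := by rw [c.eq, mul_assoc, ← pow_succ']
        have e2 : y * y' * y' ^ e = y * y' ^ (e + 1) := by rw [mul_assoc, ← pow_succ']
        rw [mul_add (y * y'), e1, e2, add_mul, mul_add, mul_add, ← pow_succ', ← pow_succ']
        abel
      rw [this]
      exact (h1.mul_right (ih _ (by omega))).sub_right (h2.mul_right (ih _ (by omega)))

/-- Power sums of the `x_j` commute with the `T_i`. -/
theorem AffRel.commute_sum_pow {R : Type*} [Ring R] [Algebra K R] {n : ℕ} {T : ℕ → Rˣ} {x : ℕ → R}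
    (H : AffRel n T x) {h : K} {i : ℕ} (hi : i + 1 < n)
    (q : (T i : R) * T i = h • (T i : R) + 1) (e : ℕ) :
    Commute (T i : R) (∑ j ∈ Finset.range n, x j ^ e) := by
  have h0 := H.TxT i hi
  obtain ⟨e1, e2⟩ := mul_of_mul_mul q h0
  have hsum : Commute (T i : R) (x i + x (i + 1)) := by
    show _ = _
    rw [mul_add, add_mul, e1, e2]
    abel
  have hprod : Commute (T i : R) (x i * x (i + 1)) := by
    show _ = _
    rw [(H.xx i (i + 1)).eq]
    nth_rw 1 [(H.xx (i + 1) i).eq]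
    rw [← h0]
    simp only [mul_assoc]
  have hp := commute_pow_add_pow (H.xx i (i + 1)) hsum hprod e
  rw [← Finset.add_sum_erase _ _ (Finset.mem_range.2 (show i < n by omega)),
    ← Finset.add_sum_erase _ _ (Finset.mem_erase.2 ⟨show i + 1 ≠ i by omega,
      Finset.mem_range.2 hi⟩), ← add_assoc]
  refine hp.add_right (Commute.sum_right _ _ _ fun j hj => ?_)
  simp only [Finset.mem_erase, Finset.mem_range] at hj
  exact (H.Tx i j hi hj.2.1 hj.1).pow_right e

variable {n : ℕ}

theorem sum_Y_pow (e : ℕ) : ∑ i : Fin n, (Y i : H n) ^ e =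
    ∑ j ∈ Finset.range n, affM (fun i => (tH n i)⁻¹) (yH n : H n) j ^ e := by
  rw [← Fin.sum_univ_eq_sum_range (fun j => affM (fun i => (tH n i)⁻¹) (yH n : H n) j ^ e)]
  refine Finset.sum_congr rfl fun j _ => ?_
  rw [← coe_affX, (finRel_H n).Y_eq]
  have : ∀ k ≤ j.val, affX (fun i => (ext T i)⁻¹) (ext Y 0) k =
      affX (fun i => (tH n i)⁻¹) (yH n) k := by
    intro k
    induction k with
    | zero => intro _; rfl
    | succ k ih => intro hk; simp only [affX, ih (by omega), tH_eq_ext (show k + 1 < n by omega)]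
  rw [this j.val le_rfl]

theorem commute_sum_Y {i : ℕ} (hi : i + 1 < n) (e : ℕ) :
    Commute (tH n i : H n) (∑ i : Fin n, (Y i : H n) ^ e) := by
  have core := (core_tH n).posCore
  have A := affRel_affCut core.br.inv (a := (yH n : H n))
    (fun i h1 h2 => (core.Tb i h1 h2).units_inv_left) core.b4
  have := A.commute_sum_pow hi (inv_quad (tH_quad n i)) e
  have h2 : ∑ j ∈ Finset.range n, affCut n (fun i => (tH n i)⁻¹) (yH n : H n) j ^ e =
      ∑ i : Fin n, (Y i : H n) ^ e := by
    rw [sum_Y_pow]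
    refine Finset.sum_congr rfl fun j hj => ?_
    rw [affCut, if_pos (Finset.mem_range.1 hj)]
  rw [h2] at this
  exact Commute.units_inv_left_iff.1 this

theorem rho_tH (w : FreeGroup Bool) (i : ℕ) : rho n w (tH n i : H n) = tH n i := by
  by_cases h : i < n - 1
  · rw [tH_of_lt h]
    have h1 := rho1_T (n := n) ⟨i, h⟩
    have h2 := rho2_T (n := n) ⟨i, h⟩
    have h3 : rho n w ∈ MulAction.stabilizer (H n ≃ₐ[K] H n) (T ⟨i, h⟩ : H n) := by
      induction w using FreeGroup.induction_on with
      | C1 => rw [map_one]; exact one_mem _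
      | of b => cases b
                · exact MulAction.mem_stabilizer_iff.2 (by rw [rho_false]; exact h2)
                · exact MulAction.mem_stabilizer_iff.2 (by rw [rho_true]; exact h1)
      | inv_of b hb => rw [map_inv]; exact inv_mem hb
      | mul a b ha hb => rw [map_mul]; exact mul_mem ha hb
    exact MulAction.mem_stabilizer_iff.1 h3
  · have : (tH n i : H n) = algebraMap K (H n) v := by rw [tH, dif_neg h]; rfl
    rw [this, AlgEquiv.commutes]

/-- The images of `∑ Y_i^e` under the automorphisms commute with the symmetrizer. -/
theorem commute_S_rho_sum (w : FreeGroup Bool) (e : ℕ) :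
    Commute (S n) (rho n w (∑ i : Fin n, (Y i : H n) ^ e)) := by
  rw [← symm_tH]
  refine symm_commute fun i hi => ?_
  have := (commute_sum_Y hi e).map (rho n w)
  rwa [rho_tH] at this

end PowerSums

/-! ### Positive words act on the induced module -/

section Comparison
variable {n : ℕ}

open Finsupp (single)

/-- A subalgebra of pairs in which an element of the double affine Hecke algebra of rank `n + 1`
has at most one partner, and which contains the pairs of corresponding operators `T_i`, `X_1`,
`Y_1`. -/
structure IsRelation (n : ℕ) (C : Subalgebra K (H (n + 1) × Module.End K (ℕ →₀ H n))) : Prop where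
  functional : ∀ μ, ((0 : H (n + 1)), μ) ∈ C → μ = 0
  mem_T : ∀ i, i < n → ((tH (n + 1) i : H (n + 1)), (tM n i : Module.End K (ℕ →₀ H n))) ∈ C
  mem_X : ((xH (n + 1) : H (n + 1)), aM n) ∈ C
  mem_Y : ((yH (n + 1) : H (n + 1)), bM n) ∈ C

variable {C : Subalgebra K (H (n + 1) × Module.End K (ℕ →₀ H n))}

theorem IsRelation.unique (hC : IsRelation n C) {y : H (n + 1)} {μ μ' : Module.End K (ℕ →₀ H n)}
    (h : (y, μ) ∈ C) (h' : (y, μ') ∈ C) : μ = μ' := by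
  have h1 : y + (-1 : K) • y = 0 := by rw [neg_one_smul, add_neg_cancel]
  have h2 := C.add_mem h (C.smul_mem h' (-1))
  rw [Prod.smul_mk, Prod.mk_add_mk, h1] at h2
  refine LinearMap.ext fun x => ?_
  have h3 : μ x + (-1 : K) • μ' x = 0 := LinearMap.congr_fun (hC.functional _ h2) x
  rwa [neg_one_smul, add_neg_eq_zero] at h3

/-- Operators that act on the first two summands of the induced module as `X_1` does. -/
def LikeX (α : Module.End K (ℕ →₀ H n)) (a : H n) : Prop :=
  ∀ x, α (single 0 x) = 0 ∧ α (single 1 x) = single 1 (a * x) - hv • single 0 (a * x)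

/-- Operators that act on the first two summands of the induced module as `Y_1` does. -/
def LikeY (β : Module.End K (ℕ →₀ H n)) (b : H n) : Prop :=
  ∀ x, β (single 0 x) = 0 ∧ β (single 1 x) = single 1 (b * x)

theorem likeX_aM (hn : 0 < n) : LikeX (aM n) (xH n : H n) := fun x =>
  ⟨indA_zero x, indA_one hn x⟩

theorem likeY_bM (hn : 0 < n) : LikeY (bM n) (yH n : H n) := fun x =>
  ⟨indB_zero x, indB_succ hn x⟩

theorem LikeX.mul_likeY {α β : Module.End K (ℕ →₀ H n)} {a b : H n} (hα : LikeX α a)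
    (hβ : LikeY β b) : LikeX (α * β) (a * b) := fun x => by
  rw [Module.End.mul_apply, Module.End.mul_apply, (hβ x).1, (hβ x).2, map_zero, (hα _).2,
    mul_assoc]
  exact ⟨rfl, rfl⟩

theorem LikeY.mul_likeX {α β : Module.End K (ℕ →₀ H n)} {a b : H n} (hβ : LikeY β b)
    (hα : LikeX α a) : LikeY (β * α) (b * a) := fun x => by
  rw [Module.End.mul_apply, Module.End.mul_apply, (hα x).1, (hα x).2, map_zero, map_sub, map_smul,
    (hβ _).1, (hβ _).2, mul_assoc, smul_zero, sub_zero]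
  exact ⟨rfl, rfl⟩

/-- The loop `T_1 ⋯ T_n T_n ⋯ T_1` turns an operator of the type of `X_1` into one of the type of
`Y_1`. -/
theorem LikeX.loop_mul (hn : 0 < n) {α : Module.End K (ℕ →₀ H n)} {a : H n} (hα : LikeX α a) :
    LikeY ((↑(asc (tM n) n) : Module.End K (ℕ →₀ H n)) * (↑(cyc (tM n) n) :
      Module.End K (ℕ →₀ H n)) * α) (↑(asc (tH n) (n - 1)) * ↑(cyc (tH n) (n - 1)) * a) := by
  have e1 : ∀ k, asc (fun i => lU (H n) (tH n i)) k = lU (H n) (asc (tH n) k) := by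
    intro k
    induction k with
    | zero => exact (map_one _).symm
    | succ k ih => rw [asc, asc, ih, map_mul]
  have e2 : ∀ k, cyc (fun i => lU (H n) (tH n i)) k = lU (H n) (cyc (tH n) k) := by
    intro k
    induction k with
    | zero => exact (map_one _).symm
    | succ k ih => rw [cyc, cyc, ih, map_mul]
  intro x
  rw [Module.End.mul_apply, Module.End.mul_apply, Module.End.mul_apply, Module.End.mul_apply,
    (hα x).1, (hα x).2, map_zero, map_zero]
  refine ⟨rfl, ?_⟩
  have := loop_single v_mul_v (lU_tH_quad n) hn (a * x)
  rw [e1, e2, lU_apply, lU_apply] at this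
  rw [mul_assoc, mul_assoc]
  exact this

theorem LikeY.smul {β : Module.End K (ℕ →₀ H n)} {b : H n} (hβ : LikeY β b) (c : K) :
    LikeY (c • β) (c • b) := fun x => by
  rw [LinearMap.smul_apply, LinearMap.smul_apply, (hβ x).1, (hβ x).2, smul_zero, smul_mul_assoc,
    Finsupp.smul_single]
  exact ⟨rfl, rfl⟩

/-- The positive word in `ρ₁`, `ρ₂` given by a list. -/
def posWord (l : List Bool) : FreeGroup Bool := (l.map FreeGroup.of).prod

theorem posWord_append (l : List Bool) (b : Bool) :
    posWord (l ++ [b]) = posWord l * FreeGroup.of b := by simp [posWord]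

theorem rho_mul_true_x (m : ℕ) (w : FreeGroup Bool) : rho m (w * FreeGroup.of true) (xH m : H m) =
    rho m w (xH m) * rho m w (yH m) := by
  rw [map_mul, rho_true, AlgEquiv.mul_apply, ← map_mul]
  exact congrArg (fun u : (H m)ˣ => rho m w (u : H m)) rho1_x

theorem rho_mul_true_y (m : ℕ) (w : FreeGroup Bool) : rho m (w * FreeGroup.of true) (yH m : H m) =
    rho m w (yH m) := by
  rw [map_mul, rho_true, AlgEquiv.mul_apply]
  exact congrArg (fun u : (H m)ˣ => rho m w (u : H m)) rho1_y

theorem rho_mul_false_x (m : ℕ) (w : FreeGroup Bool) :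
    rho m (w * FreeGroup.of false) (xH m : H m) = rho m w (xH m) := by
  rw [map_mul, rho_false, AlgEquiv.mul_apply]
  exact congrArg (fun u : (H m)ˣ => rho m w (u : H m)) rho2_x

theorem rho_mul_false_y (m : ℕ) (w : FreeGroup Bool) :
    rho m (w * FreeGroup.of false) (yH m : H m) = rho m w (yH m) * rho m w (xH m) := by
  rw [map_mul, rho_false, AlgEquiv.mul_apply, ← map_mul]
  exact congrArg (fun u : (H m)ˣ => rho m w (u : H m)) rho2_y

/-- For a positive word `w`, the elements `ρ(w) X_1` and `ρ(w) Y_1` act on the induced module, and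
they do so in the same way as `X_1` and `Y_1`, by the corresponding elements of the algebra of lower
rank. -/
theorem IsRelation.mem_posWord (hC : IsRelation n C) (hn : 0 < n) (l : List Bool) :
    ∃ α β, (rho (n + 1) (posWord l) (xH (n + 1) : H (n + 1)), α) ∈ C ∧
      (rho (n + 1) (posWord l) (yH (n + 1) : H (n + 1)), β) ∈ C ∧
      LikeX α (rho n (posWord l) (xH n : H n)) ∧
      LikeY β (rho n (posWord l) (yH n : H n)) := by
  induction l using List.reverseRecOn with
  | nil =>
    refine ⟨aM n, bM n, ?_, ?_, ?_, ?_⟩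
    · simpa [posWord] using hC.mem_X
    · simpa [posWord] using hC.mem_Y
    · simpa [posWord] using likeX_aM hn
    · simpa [posWord] using likeY_bM hn
  | append_singleton l b ih =>
    obtain ⟨α, β, h1, h2, h3, h4⟩ := ih
    rw [posWord_append]
    cases b
    · simp only [rho_mul_false_x, rho_mul_false_y]
      exact ⟨α, β * α, h1, C.mul_mem h2 h1, h3, h4.mul_likeX h3⟩
    · simp only [rho_mul_true_x, rho_mul_true_y]
      exact ⟨α * β, β, C.mul_mem h1 h2, h2, h3.mul_likeY h4, h4⟩

/-- Words `g` for which `ρ(g) Y_1` acts on the induced module, in the same way as `Y_1` does. -/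
def Comparable (C : Subalgebra K (H (n + 1) × Module.End K (ℕ →₀ H n))) (g : FreeGroup Bool) :
    Prop :=
  ∃ β, (rho (n + 1) g (yH (n + 1) : H (n + 1)), β) ∈ C ∧ LikeY β (rho n g (yH n : H n))

/-- `ρ₁⁻¹ ρ₂` takes `Y_1` to `Y_1 X_1 Y_1⁻¹`, which is a positive expression up to the loop. -/
theorem rho_mul_turn_y {m : ℕ} (hm : 0 < m) (w : FreeGroup Bool) :
    rho m (w * ((FreeGroup.of true)⁻¹ * FreeGroup.of false)) (yH m : H m) =
      q • ((↑(asc (tH m) (m - 1)) : H m) * ↑(cyc (tH m) (m - 1)) * rho m w (xH m)) := by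
  have core := core_tH m
  have e1 : aU ((rho1 m)⁻¹ * rho2 m) (yH m) = yH m * xH m * (yH m)⁻¹ := by
    rw [aU_mul, rho2_y, map_mul, rho1_inv_x, rho1_inv_y, mul_assoc]
  have e2 : yH m * xH m * (yH m)⁻¹ =
      scalUnit (H m) * (asc (tH m) (m - 1) * cyc (tH m) (m - 1) * xH m) := by
    have hA := core.A hm
    rw [core.br.bigA_eq (by omega)] at hA
    have h2 : yH m * xH m = asc (tH m) (m - 1) * cyc (tH m) (m - 1) *
        (scalUnit (H m) * (xH m * yH m)) := by
      rw [← hA]; group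
    rw [h2, ← mul_assoc, ← (core.z_comm _).eq]
    group
  have e3 : ∀ k, rho m w (↑(asc (tH m) k) : H m) = ↑(asc (tH m) k) := by
    intro k
    induction k with
    | zero => simp [asc]
    | succ k ih => rw [asc, Units.val_mul, map_mul, ih, rho_tH]
  have e4 : ∀ k, rho m w (↑(cyc (tH m) k) : H m) = ↑(cyc (tH m) k) := by
    intro k
    induction k with
    | zero => simp [cyc]
    | succ k ih => rw [cyc, Units.val_mul, map_mul, ih, rho_tH]
  have e5 : ((rho1 m)⁻¹ * rho2 m) (yH m : H m) =
      q • ((↑(asc (tH m) (m - 1)) : H m) * ↑(cyc (tH m) (m - 1)) * (xH m : H m)) := by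
    rw [Algebra.smul_def]
    exact congrArg Units.val (e1.trans e2)
  rw [map_mul, map_mul, map_inv, rho_true, rho_false, AlgEquiv.mul_apply, e5, map_smul, map_mul,
    map_mul, e3, e4]

theorem IsRelation.comparable_posWord (hC : IsRelation n C) (hn : 0 < n) (l : List Bool) :
    Comparable C (posWord l) := by
  obtain ⟨_, β, _, h2, _, h4⟩ := hC.mem_posWord hn l
  exact ⟨β, h2, h4⟩

theorem IsRelation.mem_asc (hC : IsRelation n C) {k : ℕ} (hk : k ≤ n) :
    ((↑(asc (tH (n + 1)) k) : H (n + 1)), (↑(asc (tM n) k) : Module.End K (ℕ →₀ H n))) ∈ C := by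
  induction k with
  | zero => exact C.one_mem
  | succ k ih => exact C.mul_mem (ih (by omega)) (hC.mem_T k hk)

theorem IsRelation.mem_cyc (hC : IsRelation n C) {k : ℕ} (hk : k ≤ n) :
    ((↑(cyc (tH (n + 1)) k) : H (n + 1)), (↑(cyc (tM n) k) : Module.End K (ℕ →₀ H n))) ∈ C := by
  induction k with
  | zero => exact C.one_mem
  | succ k ih => exact C.mul_mem (hC.mem_T k hk) (ih (by omega))

theorem IsRelation.comparable_posWord_turn (hC : IsRelation n C) (hn : 0 < n) (l : List Bool) :
    Comparable C (posWord l * ((FreeGroup.of true)⁻¹ * FreeGroup.of false)) := by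
  obtain ⟨α, _, h1, _, h3, _⟩ := hC.mem_posWord hn l
  refine ⟨q • ((↑(asc (tM n) n) : Module.End K (ℕ →₀ H n)) * (↑(cyc (tM n) n) :
    Module.End K (ℕ →₀ H n)) * α), ?_, ?_⟩
  · rw [rho_mul_turn_y (Nat.succ_pos n)]
    exact C.smul_mem (C.mul_mem (C.mul_mem (hC.mem_asc le_rfl) (hC.mem_cyc le_rfl)) h1) q
  · rw [rho_mul_turn_y hn]
    exact (h3.loop_mul hn).smul q

end Comparison

section Euclid

theorem act_posWord_cons (b : Bool) (l : List Bool) (w : FreeGroup Bool) (x : ℤ × ℤ) :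
    act (toSL (posWord (b :: l) * w)) x =
      act (if b then A1 else A2) (act (toSL (posWord l * w)) x) := by
  rw [posWord, List.map_cons, List.prod_cons, mul_assoc, map_mul, act_mul]
  simp [toSL, posWord]

theorem act_A1 (x : ℤ × ℤ) : act A1 x = (x.1, x.1 + x.2) := by simp [act, A1]

theorem act_A2 (x : ℤ × ℤ) : act A2 x = (x.1 + x.2, x.2) := by simp [act, A2]

/-- The Euclidean algorithm: a nonzero vector with nonnegative coordinates is obtained by a
positive word from a vector on one of the coordinate axes. -/
theorem exists_posWord {x : ℤ × ℤ} (hx : x ∈ Zplusplus) : ∃ (l : List Bool) (e : ℕ), 0 < e ∧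
    (act (toSL (posWord l * 1)) (0, (e : ℤ)) = x ∨
      act (toSL (posWord l * ((FreeGroup.of true)⁻¹ * FreeGroup.of false))) (0, (e : ℤ)) = x) := by
  obtain ⟨k, hk⟩ : ∃ k : ℕ, x.1 + x.2 ≤ k := ⟨(x.1 + x.2).toNat, Int.self_le_toNat _⟩
  induction k generalizing x with
  | zero =>
    obtain ⟨⟨h1, h2⟩, h3⟩ := hx
    exact absurd (Prod.ext (show x.1 = 0 by omega) (show x.2 = 0 by omega)) h3
  | succ k ih =>
    obtain ⟨r, d⟩ := x
    obtain ⟨⟨h1, h2⟩, h3⟩ := hx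
    simp only at h1 h2 hk
    rcases h1.eq_or_lt with rfl | h1
    · have hd : d ≠ 0 := fun h => h3 (by rw [h])
      refine ⟨[], d.toNat, by omega, Or.inl ?_⟩
      simp [posWord, act, h2]
    rcases h2.eq_or_lt with rfl | h2
    · refine ⟨[], r.toNat, by omega, Or.inr ?_⟩
      have e : act A1⁻¹ (r, r) = (r, 0) := by
        rw [show (r, r) = act A1 (r, 0) by simp [act_A1], ← act_mul, inv_mul_cancel]
        simp [act]
      have hr : ((r.toNat : ℕ) : ℤ) = r := Int.toNat_of_nonneg h1.le
      rw [hr]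
      simp only [posWord, List.map_nil, List.prod_nil, one_mul, map_mul, act_mul, map_inv, toSL,
        FreeGroup.lift_apply_of, if_true, Bool.false_eq_true, if_false, act_A2, zero_add]
      exact e
    rcases le_total r d with h | h
    · obtain ⟨l, e, he, hl⟩ := ih (x := (r, d - r))
        ⟨⟨h1.le, by simp only; omega⟩, fun h => by
          have := congrArg Prod.fst h
          simp only at this
          omega⟩
        (by simp only; omega)
      refine ⟨true :: l, e, he, ?_⟩
      rw [act_posWord_cons, act_posWord_cons, if_pos rfl]
      refine hl.imp (fun hl => ?_) (fun hl => ?_) <;> rw [hl, act_A1] <;> simp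
    · obtain ⟨l, e, he, hl⟩ := ih (x := (r - d, d))
        ⟨⟨by simp only; omega, h2.le⟩, fun h => by
          have := congrArg Prod.snd h
          simp only at this
          omega⟩
        (by simp only; omega)
      refine ⟨false :: l, e, he, ?_⟩
      rw [act_posWord_cons, act_posWord_cons, if_neg (by simp)]
      refine hl.imp (fun hl => ?_) (fun hl => ?_) <;> rw [hl, act_A2] <;> simp

end Euclid

/-! ### The elements `P_x` on the spherical part of the induced module -/

section PowerSumOperators
variable {n : ℕ} {C : Subalgebra K (H (n + 1) × Module.End K (ℕ →₀ H n))}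

open Finsupp (single)

theorem tH_inv (m i : ℕ) : (↑(tH m i)⁻¹ : H m) = tH m i - hv • 1 := inv_of_quad (tH_quad m i)

theorem IsRelation.mem_T_inv (hC : IsRelation n C) {i : ℕ} (hi : i < n) :
    ((↑(tH (n + 1) i)⁻¹ : H (n + 1)), (↑(tM n i)⁻¹ : Module.End K (ℕ →₀ H n))) ∈ C := by
  have e2 : (↑(tM n i)⁻¹ : Module.End K (ℕ →₀ H n)) =
      (tM n i : Module.End K (ℕ →₀ H n)) + (-hv) • 1 := LinearMap.ext fun x => by
    show (tM n i : Module.End K (ℕ →₀ H n)) x - hv • x =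
      (tM n i : Module.End K (ℕ →₀ H n)) x + (-hv) • x
    rw [neg_smul, sub_eq_add_neg]
  rw [tH_inv, e2, sub_eq_add_neg, ← neg_smul]
  exact C.add_mem (hC.mem_T i hi) (C.smul_mem C.one_mem (-hv))

theorem rho_tH_inv {m : ℕ} (w : FreeGroup Bool) (i : ℕ) :
    rho m w (↑(tH m i)⁻¹ : H m) = ↑(tH m i)⁻¹ := by
  rw [tH_inv, map_sub, map_smul, map_one, rho_tH]

theorem rho_affM {m : ℕ} (w : FreeGroup Bool) (y : H m) (j : ℕ) :
    rho m w (affM (fun i => (tH m i)⁻¹) y j) = affM (fun i => (tH m i)⁻¹) (rho m w y) j := by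
  induction j with
  | zero => rw [affM_zero, affM_zero]
  | succ j ih => rw [affM_succ, affM_succ, map_mul, map_mul, ih, rho_tH_inv]

theorem IsRelation.mem_affM (hC : IsRelation n C) {y : H (n + 1)} {β : Module.End K (ℕ →₀ H n)}
    (h : (y, β) ∈ C) {j : ℕ} (hj : j ≤ n) :
    (affM (fun i => (tH (n + 1) i)⁻¹) y j, affM (fun i => (tM n i)⁻¹) β j) ∈ C := by
  induction j with
  | zero => rwa [affM_zero, affM_zero]
  | succ j ih =>
    rw [affM_succ, affM_succ]
    exact C.mul_mem (C.mul_mem (hC.mem_T_inv hj) (ih (by omega))) (hC.mem_T_inv hj)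

/-- If `β` is of the type of `Y_1`, then the operator corresponding to `Y_{j+2}` acts on `1 ⊗ N`
as `Y_{j+1}` does. -/
theorem LikeY.affM_succ_single {β : Module.End K (ℕ →₀ H n)} {b : H n} (hβ : LikeY β b) {j : ℕ}
    (hj : j < n) (x : H n) : affM (fun i => (tM n i)⁻¹) β (j + 1) (single 0 x) =
      single 0 (affM (fun i => (tH n i)⁻¹) b j * x) := by
  induction j generalizing x with
  | zero =>
    have e0 := indTU_inv_zero v_mul_v (lU_tH_quad n) hj x
    have e1 := indTU_inv_one v_mul_v (lU_tH_quad n) hj (b * x)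
    rw [Daha.affM_succ, affM_zero, affM_zero, Module.End.mul_apply, Module.End.mul_apply]
    refine (congrArg (fun y => (↑(tM n 0)⁻¹ : Module.End K (ℕ →₀ H n)) (β y)) e0).trans ?_
    simp only [map_sub, map_smul, (hβ x).1, (hβ x).2, smul_zero, sub_zero]
    exact e1
  | succ j ih =>
    have e : ∀ y : H n, (↑(tM n (j + 1))⁻¹ : Module.End K (ℕ →₀ H n)) (single 0 y) =
        single 0 ((↑(tH n j)⁻¹ : H n) * y) := by
      intro y
      rw [tM, coe_indTU_inv, LinearMap.sub_apply, indT_lt hj (by omega), Nat.add_sub_cancel,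
        lU_apply, tH_inv, sub_mul, Finsupp.single_sub, smul_mul_assoc, one_mul,
        ← Finsupp.smul_single]
      rfl
    rw [Daha.affM_succ, Module.End.mul_apply, Module.End.mul_apply, e, ih (by omega), e,
      Daha.affM_succ, mul_assoc, mul_assoc]

/-- The image of `∑ Y_i^e` under `ρ(g)` acts on `1 ⊗ N` as the corresponding element of the algebra
of rank one less. -/
theorem Comparable.exists_sum (hC : IsRelation n C) {g : FreeGroup Bool} (hg : Comparable C g)
    {e : ℕ} (he : 0 < e) : ∃ μ, (rho (n + 1) g (∑ i : Fin (n + 1), (Y i : H (n + 1)) ^ e), μ) ∈ C ∧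
      ∀ x, μ (single 0 x) = single 0 (rho n g (∑ i : Fin n, (Y i : H n) ^ e) * x) := by
  obtain ⟨β, hβC, hβ⟩ := hg
  have hrho : ∀ m, rho m g (∑ i : Fin m, (Y i : H m) ^ e) = ∑ j ∈ Finset.range m,
      affM (fun i => (tH m i)⁻¹) (rho m g (yH m : H m)) j ^ e := by
    intro m
    rw [sum_Y_pow, map_sum]
    exact Finset.sum_congr rfl fun j _ => by rw [map_pow, rho_affM]
  refine ⟨∑ j ∈ Finset.range (n + 1), affM (fun i => (tM n i)⁻¹) β j ^ e, ?_, fun x => ?_⟩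
  · have h := C.sum_mem (t := Finset.range (n + 1)) fun j hj => C.pow_mem
      (hC.mem_affM hβC (j := j) (Nat.lt_succ_iff.1 (Finset.mem_range.1 hj))) e
    convert h using 1
    rw [hrho]
    exact Prod.ext (by rw [Prod.fst_sum]; rfl) (by rw [Prod.snd_sum]; rfl)
  · rw [hrho, Finset.sum_range_succ', LinearMap.add_apply, LinearMap.sum_apply, affM_zero]
    have e0 : (β ^ e) (single 0 x) = 0 := by
      obtain ⟨e, rfl⟩ : ∃ e', e = e' + 1 := ⟨e - 1, by omega⟩
      rw [pow_succ, Module.End.mul_apply, (hβ x).1, map_zero]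
    rw [e0, add_zero, Finset.sum_mul, Finsupp.single_finsetSum]
    refine Finset.sum_congr rfl fun j hj => ?_
    have hj := Finset.mem_range.1 hj
    generalize e = r
    induction r with
    | zero => simp
    | succ r ih =>
      rw [pow_succ', Module.End.mul_apply, ih, hβ.affM_succ_single hj, pow_succ', mul_assoc]

end PowerSumOperators

section Symmetrized
variable {n : ℕ} {C : Subalgebra K (H (n + 1) × Module.End K (ℕ →₀ H n))}

open Finsupp (single)

/-- The symmetrizer of rank `n + 1`, as an operator on the induced module. -/
noncomputable def sM (n : ℕ) : Module.End K (ℕ →₀ H n) :=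
  symm (n + 1) fun i => (tM n i : Module.End K (ℕ →₀ H n))

theorem IsRelation.mem_S (hC : IsRelation n C) : (S (n + 1), sM n) ∈ C := by
  have h := symm_mem (n := n + 1) (C := C) (t := fun i => ((tH (n + 1) i : H (n + 1)),
    (tM n i : Module.End K (ℕ →₀ H n)))) fun i hi => hC.mem_T i (by omega)
  have e1 := map_symm (n := n + 1) (AlgHom.fst K (H (n + 1)) (Module.End K (ℕ →₀ H n)))
    (fun i => ((tH (n + 1) i : H (n + 1)), (tM n i : Module.End K (ℕ →₀ H n))))
  have e2 := map_symm (n := n + 1) (AlgHom.snd K (H (n + 1)) (Module.End K (ℕ →₀ H n)))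
    (fun i => ((tH (n + 1) i : H (n + 1)), (tM n i : Module.End K (ℕ →₀ H n))))
  have e1 := e1.trans symm_tH
  convert h using 1
  exact Prod.ext e1.symm e2.symm

theorem IsRelation.sM_sM (hC : IsRelation n C) : sM n * sM n = sM n := by
  have h := C.mul_mem hC.mem_S hC.mem_S
  rw [Prod.mk_mul_mk, (S_idem (n + 1)).eq] at h
  exact hC.unique h hC.mem_S

/-- The map from the induced module to the algebra of rank one less which takes
`T_{p-1} ⋯ T_0 ⊗ x` to `v^p S x`. It does not see the symmetrizer. -/
noncomputable def psi (n : ℕ) : (ℕ →₀ H n) →ₗ[K] H n :=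
  Finsupp.lsum K fun p => v ^ p • Algebra.lmul K (H n) (S n)

theorem psi_single (p : ℕ) (x : H n) : psi n (single p x) = v ^ p • (S n * x) := by
  simp [psi]

theorem psi_T {i : ℕ} (hi : i < n) (x : ℕ →₀ H n) :
    psi n ((tM n i : Module.End K (ℕ →₀ H n)) x) = v • psi n x := by
  have hS : ∀ (j : ℕ) (x : H n), S n * ((tH n j : H n) * x) = v • (S n * x) := fun j x => by
    rw [← mul_assoc, S_mul_tH, smul_mul_assoc]
  induction x using Finsupp.induction_linear with
  | zero => simp
  | add f g hf hg => rw [map_add, map_add, hf, hg, map_add, smul_add]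
  | single p x =>
    rw [tM, coe_indTU, psi_single]
    by_cases hp : p ≤ n
    · rcases Nat.lt_trichotomy p i with h1 | rfl | h1
      · rw [indT_lt hi h1, psi_single, lU_apply, hS, smul_comm]
      · rw [indT_eq hi, psi_single, smul_smul, pow_succ']
      · by_cases h2 : p = i + 1
        · subst h2
          rw [indT_succ hi, map_add, map_smul, psi_single, psi_single, smul_smul, smul_smul,
            ← add_smul, pow_succ', ← mul_assoc v, v_mul_v, add_mul, one_mul, mul_assoc]
        · rw [indT_gt (by omega) hp, psi_single, lU_apply, hS, smul_comm]
    · rw [indT_out (by omega), map_smul, psi_single]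

theorem psi_sM (x : ℕ →₀ H n) : psi n (sM n x) = psi n x :=
  apply_symm (fun i hi x => psi_T (by omega) x) x

/-- `y` acts on the image of `S N` in the spherical part of the induced module as `y'` does. -/
def ActsAs (C : Subalgebra K (H (n + 1) × Module.End K (ℕ →₀ H n))) (y : H (n + 1)) (y' : H n) :
    Prop :=
  ∃ μ, (y, μ) ∈ C ∧ ∀ x, S n * x = x → μ (sM n (single 0 x)) = sM n (single 0 (y' * x))

/-- The element `y'` of the spherical algebra is determined by its action, which `psi` detects. -/
theorem ActsAs.eq_zero (hC : IsRelation n C) {y' : H n} (h : ActsAs C 0 y') :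
    S n * y' * S n = 0 := by
  obtain ⟨μ, h1, h2⟩ := h
  have := congrArg (psi n) (h2 (S n) (S_idem n).eq)
  rw [hC.functional _ h1, LinearMap.zero_apply, map_zero, psi_sM, psi_single, pow_zero,
    one_smul, ← mul_assoc] at this
  exact this.symm

theorem ActsAs.mul {y z : H (n + 1)} {y' z' : H n} (h : ActsAs C y y') (h' : ActsAs C z z')
    (hz : S n * z' = z') : ActsAs C (y * z) (y' * z') := by
  obtain ⟨μ, h1, h2⟩ := h
  obtain ⟨μ', h3, h4⟩ := h'
  refine ⟨μ * μ', C.mul_mem h1 h3, fun x hx => ?_⟩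
  rw [Module.End.mul_apply, h4 x hx, h2 _ (by rw [← mul_assoc, hz]), mul_assoc]

theorem ActsAs.add {y z : H (n + 1)} {y' z' : H n} (h : ActsAs C y y') (h' : ActsAs C z z') :
    ActsAs C (y + z) (y' + z') := by
  obtain ⟨μ, h1, h2⟩ := h
  obtain ⟨μ', h3, h4⟩ := h'
  refine ⟨μ + μ', C.add_mem h1 h3, fun x hx => ?_⟩
  rw [LinearMap.add_apply, h4 x hx, h2 x hx, add_mul, Finsupp.single_add, map_add]

theorem ActsAs.smul {y : H (n + 1)} {y' : H n} (h : ActsAs C y y') (c : K) :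
    ActsAs C (c • y) (c • y') := by
  obtain ⟨μ, h1, h2⟩ := h
  refine ⟨c • μ, C.smul_mem h1 c, fun x hx => ?_⟩
  rw [LinearMap.smul_apply, h2 x hx, smul_mul_assoc, ← Finsupp.smul_single, map_smul]

theorem actsAs_S (hC : IsRelation n C) : ActsAs C (S (n + 1)) (S n) :=
  ⟨sM n, hC.mem_S, fun x hx => by rw [← Module.End.mul_apply, hC.sM_sM, hx]⟩

/-- If `ρ(g) Y_1` is comparable in ranks `n + 1` and `n`, then so is `ρ(g) (S ∑ Y_i^e S)`. -/
theorem Comparable.actsAs (hC : IsRelation n C) {g : FreeGroup Bool} (hg : Comparable C g) {e : ℕ}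
    (he : 0 < e) : ActsAs C (rhoP (n + 1) g e).1 (rhoP n g e).1 := by
  obtain ⟨μ, h1, h2⟩ := hg.exists_sum hC he
  have hP : ∀ m, (rhoP m g e).1 = S m * rho m g (∑ i : Fin m, (Y i : H m) ^ e) * S m := by
    intro m
    show rho m g (P0 m e) = _
    rw [P0, map_mul, map_mul, rho_S]
  have hc := commute_S_rho_sum (n := n + 1) g e
  have hcμ : sM n * μ = μ * sM n := by
    have h3 := C.mul_mem hC.mem_S h1
    rw [Prod.mk_mul_mk, hc.eq] at h3
    exact hC.unique h3 (C.mul_mem h1 hC.mem_S)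
  refine ⟨sM n * μ * sM n, ?_, fun x hx => ?_⟩
  · rw [hP]
    exact C.mul_mem (C.mul_mem hC.mem_S h1) hC.mem_S
  · have hx' : (rhoP n g e).1 * x = rho n g (∑ i : Fin n, (Y i : H n) ^ e) * x := by
      rw [hP, mul_assoc, hx, (commute_S_rho_sum g e).eq, mul_assoc, hx]
    rw [hx', mul_assoc, ← hcμ, ← mul_assoc, hC.sM_sM, hcμ, Module.End.mul_apply,
      ← Module.End.mul_apply (sM n), hC.sM_sM, ← Module.End.mul_apply μ, ← hcμ,
      Module.End.mul_apply, h2]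

theorem IsRelation.actsAs_P (hC : IsRelation n C) (hn : 0 < n) {x : ℤ × ℤ} (hx : x ∈ Zplusplus) :
    ActsAs C (P (n + 1) x).1 (P n x).1 := by
  obtain ⟨l, e, he, h⟩ := exists_posWord hx
  obtain ⟨g, hg, rfl⟩ : ∃ g, Comparable C g ∧ act (toSL g) (0, (e : ℤ)) = x := by
    rcases h with h | h
    · rw [mul_one] at h
      exact ⟨_, hC.comparable_posWord hn l, h⟩
    · exact ⟨_, hC.comparable_posWord_turn hn l, h⟩
  rw [P_act (Nat.succ_pos n) g he, P_act hn g he]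
  exact hg.actsAs hC he

end Symmetrized

/-! ### The morphisms -/

section Morphism

/-- A linear relation that is the graph of a partially defined morphism induces a morphism between
the subalgebras generated by related families. -/
theorem exists_algHom_of_functional {A B ι : Type*} [Ring A] [Algebra K A] [Ring B] [Algebra K B]
    (D : Subalgebra K (A × B)) (hD : ∀ b, ((0 : A), b) ∈ D → b = 0) (p : ι → A) (p' : ι → B)
    (Z : Set ι) (h : ∀ i ∈ Z, (p i, p' i) ∈ D) :
    ∃ Φ : Algebra.adjoin K (p '' Z) →ₐ[K] Algebra.adjoin K (p' '' Z),
      (∀ i : Z, Φ ⟨p i, Algebra.subset_adjoin (Set.mem_image_of_mem _ i.2)⟩ =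
        ⟨p' i, Algebra.subset_adjoin (Set.mem_image_of_mem _ i.2)⟩) ∧
      Function.Surjective Φ ∧
      ∀ Φ' : Algebra.adjoin K (p '' Z) →ₐ[K] Algebra.adjoin K (p' '' Z),
        (∀ i : Z, Φ' ⟨p i, Algebra.subset_adjoin (Set.mem_image_of_mem _ i.2)⟩ =
          ⟨p' i, Algebra.subset_adjoin (Set.mem_image_of_mem _ i.2)⟩) → Φ' = Φ := by
  let G : Subalgebra K (A × B) := Algebra.adjoin K ((fun i => (p i, p' i)) '' Z)
  have hG : G ≤ D := Algebra.adjoin_le (by rintro _ ⟨i, hi, rfl⟩; exact h i hi)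
  have h1 : G.map (AlgHom.fst K A B) = Algebra.adjoin K (p '' Z) := by
    rw [AlgHom.map_adjoin, Set.image_image]; rfl
  have h2 : G.map (AlgHom.snd K A B) = Algebra.adjoin K (p' '' Z) := by
    rw [AlgHom.map_adjoin, Set.image_image]; rfl
  let f : G →ₐ[K] Algebra.adjoin K (p '' Z) := ((AlgHom.fst K A B).comp G.val).codRestrict _
    fun x => h1 ▸ Subalgebra.mem_map.2 ⟨x.1, x.2, rfl⟩
  let f' : G →ₐ[K] Algebra.adjoin K (p' '' Z) := ((AlgHom.snd K A B).comp G.val).codRestrict _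
    fun x => h2 ▸ Subalgebra.mem_map.2 ⟨x.1, x.2, rfl⟩
  have hf : Function.Bijective f := by
    constructor
    · refine (injective_iff_map_eq_zero f).2 fun x hx => ?_
      have hx1 : x.1.1 = 0 := congrArg Subtype.val hx
      have hx2 : x.1.2 = 0 := hD _ (by rw [← hx1]; exact hG x.2)
      exact Subtype.ext (Prod.ext hx1 hx2)
    · rintro ⟨a, ha⟩
      rw [← h1] at ha
      obtain ⟨x, hx, rfl⟩ := Subalgebra.mem_map.1 ha
      exact ⟨⟨x, hx⟩, rfl⟩
  have hf' : Function.Surjective f' := by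
    rintro ⟨a, ha⟩
    rw [← h2] at ha
    obtain ⟨x, hx, rfl⟩ := Subalgebra.mem_map.1 ha
    exact ⟨⟨x, hx⟩, rfl⟩
  let e := AlgEquiv.ofBijective f hf
  have key : ∀ i : Z, (f'.comp e.symm.toAlgHom)
      ⟨p i, Algebra.subset_adjoin (Set.mem_image_of_mem _ i.2)⟩ =
        ⟨p' i, Algebra.subset_adjoin (Set.mem_image_of_mem _ i.2)⟩ := by
    intro i
    have : e ⟨(p i, p' i), Algebra.subset_adjoin (Set.mem_image_of_mem _ i.2)⟩ =
        ⟨p i, Algebra.subset_adjoin (Set.mem_image_of_mem _ i.2)⟩ := rfl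
    rw [← this]
    exact congrArg f' (e.symm_apply_apply _)
  refine ⟨f'.comp e.symm.toAlgHom, key, hf'.comp e.symm.surjective, fun Φ' hΦ => ?_⟩
  refine AlgHom.adjoin_ext fun x hx => ?_
  obtain ⟨i, hi, rfl⟩ := hx
  exact (hΦ ⟨i, hi⟩).trans (key ⟨i, hi⟩).symm

variable {n : ℕ} {C : Subalgebra K (H (n + 1) × Module.End K (ℕ →₀ H n))}

theorem S_mul_coe {m : ℕ} (x : SH m) : S m * x.1 = x.1 := by
  obtain ⟨r, hr⟩ := x.2
  rw [← hr]
  show S m * (S m * r * S m) = S m * r * S m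
  rw [← mul_assoc, ← mul_assoc, (S_idem m).eq]

theorem coe_mul_S {m : ℕ} (x : SH m) : x.1 * S m = x.1 := by
  obtain ⟨r, hr⟩ := x.2
  rw [← hr]
  show S m * r * S m * S m = S m * r * S m
  rw [mul_assoc _ (S m) (S m), (S_idem m).eq]

theorem S_mul_rho_coe {m : ℕ} (w : FreeGroup Bool) (x : SH m) :
    S m * rho m w x.1 = rho m w x.1 := by
  have := congrArg (rho m w) (S_mul_coe x)
  rwa [map_mul, rho_S] at this

theorem rho_coe_mul_S {m : ℕ} (w : FreeGroup Bool) (x : SH m) :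
    rho m w x.1 * S m = rho m w x.1 := by
  have := congrArg (rho m w) (coe_mul_S x)
  rwa [map_mul, rho_S] at this

/-- The pairs of elements of the spherical algebras of ranks `n + 1` and `n` whose images under
sufficiently high powers of `ρ₁` act in the same way on the spherical part of the induced module. -/
noncomputable def sphericalRelation (hC : IsRelation n C) : Subalgebra K (SH (n + 1) × SH n) where
  carrier := {p | ∃ k₀ : ℕ, ∀ k ≥ k₀, ActsAs C (rho (n + 1) (FreeGroup.of true ^ k) p.1.1)
    (rho n (FreeGroup.of true ^ k) p.2.1)}
  mul_mem' := by
    rintro p p' ⟨k, hk⟩ ⟨k', hk'⟩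
    refine ⟨max k k', fun r hr => ?_⟩
    have := (hk r (le_trans (le_max_left _ _) hr)).mul (hk' r (le_trans (le_max_right _ _) hr))
      (S_mul_rho_coe _ _)
    rwa [← map_mul, ← map_mul] at this
  add_mem' := by
    rintro p p' ⟨k, hk⟩ ⟨k', hk'⟩
    refine ⟨max k k', fun r hr => ?_⟩
    have := (hk r (le_trans (le_max_left _ _) hr)).add (hk' r (le_trans (le_max_right _ _) hr))
    rwa [← map_add, ← map_add] at this
  algebraMap_mem' c := by
    refine ⟨0, fun k _ => ?_⟩
    have e : ∀ m, ((algebraMap K (SH m) c).1 : H m) = c • S m := fun m =>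
      congrArg Subtype.val (Algebra.algebraMap_eq_smul_one (A := SH m) c)
    show ActsAs C (rho (n + 1) _ (algebraMap K (SH (n + 1)) c).1)
      (rho n _ (algebraMap K (SH n) c).1)
    rw [e, e, map_smul, map_smul, rho_S, rho_S]
    exact (actsAs_S hC).smul c

theorem sphericalRelation_functional (hC : IsRelation n C) (y : SH n)
    (h : ((0 : SH (n + 1)), y) ∈ sphericalRelation hC) : y = 0 := by
  obtain ⟨k, hk⟩ := h
  have h1 := hk k le_rfl
  have e : rho (n + 1) (FreeGroup.of true ^ k) (0 : SH (n + 1)).1 = 0 := map_zero _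
  rw [e] at h1
  have h2 := h1.eq_zero hC
  rw [S_mul_rho_coe, rho_coe_mul_S] at h2
  exact Subtype.ext ((map_eq_zero_iff _ (AlgEquiv.injective _)).1 h2)

theorem act_A1_pow (k : ℕ) (x : ℤ × ℤ) :
    act (toSL (FreeGroup.of true ^ k)) x = (x.1, k * x.1 + x.2) := by
  induction k with
  | zero => simp [act]
  | succ k ih =>
    have e : toSL (FreeGroup.of true) = A1 := by simp [toSL]
    rw [pow_succ', map_mul, act_mul, ih, e, act_A1]
    ext
    · rfl
    · push_cast
      ring

/-- A high power of `ρ₁` moves the half plane `ℤ^{2,+}` into the quadrant `ℤ^{2,++}`. -/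
theorem P_mem_sphericalRelation (hC : IsRelation n C) (hn : 0 < n) {x : ℤ × ℤ} (hx : x ∈ Zplus) :
    (P (n + 1) x, P n x) ∈ sphericalRelation hC := by
  refine ⟨x.2.natAbs, fun k hk => ?_⟩
  rw [rho_P (Nat.succ_pos n) _ hx.2, rho_P hn _ hx.2, act_A1_pow]
  refine hC.actsAs_P hn ⟨⟨?_, ?_⟩, fun h => hx.2 ?_⟩
  · rcases hx.1 with h | h <;> simp only <;> omega
  · rcases hx.1 with h | h
    · have : (k : ℤ) * 1 ≤ k * x.1 := mul_le_mul_of_nonneg_left h (by positivity)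
      simp only
      omega
    · simp [h.1, h.2]
  · have h1 : x.1 = 0 := congrArg Prod.fst h
    have h2 : (k : ℤ) * x.1 + x.2 = 0 := congrArg Prod.snd h
    rw [h1, mul_zero, zero_add] at h2
    exact Prod.ext h1 h2

theorem Zplusplus_subset : Zplusplus ⊆ Zplus := fun x hx => by
  obtain ⟨⟨h1, h2⟩, h3⟩ := hx
  exact ⟨by omega, h3⟩

/-- The morphism `P_x ↦ P_x` from rank `n + 1` to rank `n`, for any set of `x` in the half plane. -/
theorem exists_morphism (hn : 0 < n) {Z : Set (ℤ × ℤ)} (hZ : Z ⊆ Zplus) :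
    ∃ Φ : subalg (n + 1) Z →ₐ[K] subalg n Z,
      (∀ x : Z, Φ (Psub (n + 1) Z x) = Psub n Z x) ∧ Function.Surjective Φ ∧
      ∀ Φ' : subalg (n + 1) Z →ₐ[K] subalg n Z,
        (∀ x : Z, Φ' (Psub (n + 1) Z x) = Psub n Z x) → Φ' = Φ := by
  obtain ⟨C, h1, h2, h3, h4⟩ := exists_relation hn
  have hC : IsRelation n C := ⟨h1, h2, h3, h4⟩
  exact exists_algHom_of_functional (sphericalRelation hC) (sphericalRelation_functional hC)
    (P (n + 1)) (P n) Z fun x hx => P_mem_sphericalRelation hC hn (hZ hx)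

end Morphism
end Daha

theorem proposition4p1 :
    -- the element `P n x` does not depend on the choice of `g` with `x = g (0, e)`
    (∀ n : ℕ, 1 ≤ n → ∀ (g : FreeGroup Bool) (e : ℕ), 0 < e →
      Daha.P n (Daha.act (Daha.toSL g) (0, (e : ℤ))) = Daha.rhoP n g e) ∧
    ∀ m : ℕ, 2 ≤ m →
      -- the algebra for `ℤ^{2,+}`
      (∃ Φ : Daha.SHplus m →ₐ[Daha.K] Daha.SHplus (m - 1),
        (∀ x : Daha.Zplus, Φ (Daha.Psub m Daha.Zplus x) = Daha.Psub (m - 1) Daha.Zplus x) ∧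
        Function.Surjective Φ ∧
        ∀ Φ' : Daha.SHplus m →ₐ[Daha.K] Daha.SHplus (m - 1),
          (∀ x : Daha.Zplus, Φ' (Daha.Psub m Daha.Zplus x) = Daha.Psub (m - 1) Daha.Zplus x) →
            Φ' = Φ) ∧
      -- the algebra for `ℤ^{2,++}`
      (∃ Φ : Daha.SHplusplus m →ₐ[Daha.K] Daha.SHplusplus (m - 1),
        (∀ x : Daha.Zplusplus,
          Φ (Daha.Psub m Daha.Zplusplus x) = Daha.Psub (m - 1) Daha.Zplusplus x) ∧
        Function.Surjective Φ ∧
        ∀ Φ' : Daha.SHplusplus m →ₐ[Daha.K] Daha.SHplusplus (m - 1),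
          (∀ x : Daha.Zplusplus,
            Φ' (Daha.Psub m Daha.Zplusplus x) = Daha.Psub (m - 1) Daha.Zplusplus x) →
            Φ' = Φ) := by
  refine ⟨fun n hn g e he => Daha.P_act hn g he, fun m hm => ?_⟩
  obtain ⟨n, rfl⟩ : ∃ n, m = n + 1 := ⟨m - 1, by omega⟩
  have hn : 0 < n := by omega
  exact ⟨Daha.exists_morphism hn subset_rfl, Daha.exists_morphism hn Daha.Zplusplus_subset⟩
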